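/- **Theorem.** Let $c\ge 3$ be real. Let $\{L_m, J_n, G^1_r, G^2_s \mid m,n\in\mathbb Z,\ r,s\in\mathbb Z-\frac12\}$ be a representation with central charge $c$ of the $N=2$ super-Virasoro algebra on a complex vector superspace $V$: the $L_m,J_n$ are even and the $G^i_r$ odd operators, and, with $[\cdot,\cdot]$ the supercommutator, $$[L_m,L_n]=(m-n)L_{m+n}+\tfrac{c(m^3-m)}{12}\delta_{m,-n},\quad [L_m,J_n]=-nJ_{m+n},\quad [J_m,J_n]=\tfrac c3 m\,\delta_{m,-n},$$ $$[L_m,G^i_r]=(\tfrac m2-r)G^i_{m+r},\quad [G^i_r,G^i_s]=2L_{r+s}+\tfrac c3(r^2-\tfrac14)\delta_{r,-s}\quad (i=1,2),$$ $$[G^1_r,G^2_s]=i(r-s)J_{r+s},\quad [G^1_r,J_n]=-iG^2_{r+n},\quad [G^2_r,J_n]=iG^1_{r+n}.$$ Suppose that: (i) there is a cyclic lowest weight vector $\Omega\neq 0$ with $L_0\Omega=J_0\Omega=0$ (and $L_n\Omega=J_n\Omega=0$ for $n>0$, $G^i_r\Omega=0$ for $r>0$); (ii) there is a scalar product $(\cdot|\cdot)$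 on $V$ (positive definite, Hermitian, linear in the second variable) for which $J(z)=\sum_n J_nz^{-n}$ is symmetric, i.e. $J_n^\dagger=J_{-n}$ for all $n$, and for which $T(z)=\sum_m L_mz^{-m}$ and $G^i(z)=\sum_r G^i_rz^{-r}$ satisfy, as formal series, $$\bigl(p(z)T(z)\bigr)^\dagger=\overline p(z)T(z),\qquad \bigl(p(z)z^{1/2}G^i(z)\bigr)^\dagger=\overline p(z)z^{-1/2}G^i(z)\qquad(i=1,2)$$ for all trigonometric (Laurent) polynomials $p(z)=\sum_k p_kz^k$ with $p(-1)=0$. Here $\overline p(z)=\sum_k\overline{p_k}z^{-k}$, and $\bigl(\sum_n A_nz^{-n}\bigr)^\dagger=\sum_n A_n^\dagger z^{n}$, where $A^\dagger$ is the operator on $V$ with $(A\Psi_1|\Psi_2)=(\Psi_1|A^\dagger\Psi_2)$ for all $\Psi_1,\Psi_2\in V$. Then $L_m^\dagger=L_{-m}$ and $(G^i_r)^\dagger=G^i_{-r}$ for $i=1,2$ and all $m\in\mathbb Z$, $r\in\mathbb Z-\frac12$; that is, the representation is unitary. Furthermore, $\Omega$ is homogeneous for the parity of $V$ and, after exchanging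 the even and odd parts of $V$ in case $\Omega$ is odd, $V$ has a structure of simple VOSA (vertex operator superalgebra) of central charge $c$ with vacuum vector $\Omega$ and conformal vector $\nu=L_{-2}\Omega$, such that, with $j=J_{-1}\Omega$ and $\tau^i=G^i_{-3/2}\Omega$, $$Y(\nu,z)=\sum_m L_mz^{-m-2},\quad Y(j,z)=\sum_n J_nz^{-n-1},\quad Y(\tau^i,z)=\sum_r G^i_rz^{-r-3/2}.$$ It is unitary for the normalized scalar product $(\cdot|\cdot)/(\Omega|\Omega)$: for some antilinear VOSA involution $\theta$ of $V$, $$(Y(\theta(a),z)b|d)=(b|Y(e^{zL_1}(-1)^{2L_0^2+L_0}z^{-2L_0}a,z^{-1})d)\qquad\text{for all }a,b,d\in V.$$ Finally, $V$ is isomorphic as a VOSA to the $N=2$ super-Virasoro VOSA $V^c(N2)$, i.e. the irreducible lowest weight module of the $N=2$ super-Virasoro algebra with central charge $c$ and lowest weight $(0,0)$ with the vertex superalgebra structure in which the fields of the four vectors $\nu,j,\tau^1,\tau^2$ formed from its lowest weight vector are given as above. It is also unitarily isomorphic to it: for every normalized scalar product making $V^c(N2)$ a unitary VOSA there is a VOSA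 isomorphism $V\to V^c(N2)$ that is isometric for that scalar product and $(\cdot|\cdot)/(\Omega|\Omega)$. -/

import Mathlib

/-! ### Scalar products, adjoints, formal series -/

/-- A scalar product: a positive definite Hermitian form, antilinear in the first variable and
linear in the second one. -/
structure IsScalarProduct {V : Type*} [AddCommGroup V] [Module ℂ V]
    (B : V →ₗ⋆[ℂ] V →ₗ[ℂ] ℂ) : Prop where
  conj_symm : ∀ x y, starRingEnd ℂ (B y x) = B x y
  pos : ∀ x, x ≠ 0 → 0 < (B x x).re

/-- `A' = A†` with respect to `B`. -/
def IsAdjoint {V : Type*} [AddCommGroup V] [Module ℂ V] (B : V →ₗ⋆[ℂ] V →ₗ[ℂ] ℂ)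
    (A A' : Module.End ℂ V) : Prop :=
  ∀ x y, B (A x) y = B x (A' y)

/-- The formal series `A(z) = ∑ₙ Aₙ z⁻ⁿ` (in integral powers of `z`), as the family `n ↦ Aₙ`. -/
abbrev FormalSeries (V : Type*) [AddCommGroup V] [Module ℂ V] : Type _ :=
  ℤ → Module.End ℂ V

/-- `A'(z) = A(z)†`, where `A(z)† = ∑ₙ Aₙ† zⁿ`: the coefficient of `zⁿ` in `A'` is `Aₙ†`. -/
def FormalSeries.IsDagger {V : Type*} [AddCommGroup V] [Module ℂ V]
    (B : V →ₗ⋆[ℂ] V →ₗ[ℂ] ℂ) (A A' : FormalSeries V) : Prop :=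
  ∀ n, IsAdjoint B (A n) (A' (-n))

/-- The product `p(z) A(z)` for a trigonometric polynomial `p(z) = ∑ₖ pₖ zᵏ`. -/
noncomputable def FormalSeries.polyMul {V : Type*} [AddCommGroup V] [Module ℂ V]
    (p : LaurentPolynomial ℂ) (A : FormalSeries V) : FormalSeries V :=
  fun n => p.coeff.sum fun k a => a • A (n + k)

/-- For `p(z) = ∑ₖ pₖ zᵏ`, the trigonometric polynomial `∑ₖ (conj pₖ) z⁻ᵏ`
(the complex conjugate of `p` on the unit circle). -/
noncomputable def trigConj (p : LaurentPolynomial ℂ) : LaurentPolynomial ℂ :=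
  p.coeff.sum fun k a => LaurentPolynomial.C (starRingEnd ℂ a) * LaurentPolynomial.T (-k)

/-- The value `p(-1)`. -/
noncomputable def trigEvalNegOne (p : LaurentPolynomial ℂ) : ℂ :=
  LaurentPolynomial.eval₂ (RingHom.id ℂ) (-1 : ℂˣ) p

/-! ### The `N = 2` super-Virasoro algebra and its representations -/

/-- Four families of elements `L m`, `J m`, `G1 k`, `G2 k` of an algebra. For the fermionic
families the integer `k` stands for the half-integral mode `r = k + 1/2`:
`G1 k = G¹_{k+1/2}` and `G2 k = G²_{k+1/2}`. -/
structure N2Modes (A : Type*) where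
  L : ℤ → A
  J : ℤ → A
  G1 : ℤ → A
  G2 : ℤ → A

/-- The `N = 2` super-Virasoro (anti)commutation relations with central charge `c`. -/
structure N2Modes.IsN2 {A : Type*} [Ring A] [Algebra ℂ A] (X : N2Modes A) (c : ℂ) : Prop where
  L_L : ∀ m n : ℤ, X.L m * X.L n - X.L n * X.L m =
    ((m : ℂ) - n) • X.L (m + n) +
      if m + n = 0 then algebraMap ℂ A (c * ((m : ℂ) ^ 3 - m) / 12) else 0
  L_J : ∀ m n : ℤ, X.L m * X.J n - X.J n * X.L m = (-(n : ℂ)) • X.J (m + n)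
  J_J : ∀ m n : ℤ, X.J m * X.J n - X.J n * X.J m =
    if m + n = 0 then algebraMap ℂ A (c / 3 * m) else 0
  L_G1 : ∀ m k : ℤ, X.L m * X.G1 k - X.G1 k * X.L m =
    ((m : ℂ) / 2 - (k + 1 / 2)) • X.G1 (m + k)
  L_G2 : ∀ m k : ℤ, X.L m * X.G2 k - X.G2 k * X.L m =
    ((m : ℂ) / 2 - (k + 1 / 2)) • X.G2 (m + k)
  G1_G1 : ∀ k l : ℤ, X.G1 k * X.G1 l + X.G1 l * X.G1 k =
    (2 : ℂ) • X.L (k + l + 1) +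
      if k + l + 1 = 0 then algebraMap ℂ A (c / 3 * (((k : ℂ) + 1 / 2) ^ 2 - 1 / 4)) else 0
  G2_G2 : ∀ k l : ℤ, X.G2 k * X.G2 l + X.G2 l * X.G2 k =
    (2 : ℂ) • X.L (k + l + 1) +
      if k + l + 1 = 0 then algebraMap ℂ A (c / 3 * (((k : ℂ) + 1 / 2) ^ 2 - 1 / 4)) else 0
  G1_G2 : ∀ k l : ℤ, X.G1 k * X.G2 l + X.G2 l * X.G1 k =
    (Complex.I * ((k : ℂ) - l)) • X.J (k + l + 1)
  G1_J : ∀ k n : ℤ, X.G1 k * X.J n - X.J n * X.G1 k = (-Complex.I) • X.G2 (k + n)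
  G2_J : ∀ k n : ℤ, X.G2 k * X.J n - X.J n * X.G2 k = Complex.I • X.G1 (k + n)

/-- A representation with central charge `c` of the `N = 2` super-Virasoro algebra on the vector
superspace `V = parity 0 ⊕ parity 1`: the `L m`, `J m` act as even operators, the `G1 k`, `G2 k`
as odd operators, and they satisfy the `N = 2` relations. -/
structure IsN2Rep {V : Type*} [AddCommGroup V] [Module ℂ V] (parity : ZMod 2 → Submodule ℂ V)
    (X : N2Modes (Module.End ℂ V)) (c : ℂ) : Prop where
  isInternal : DirectSum.IsInternal parity
  isN2 : X.IsN2 c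
  even_L : ∀ m i, ∀ x ∈ parity i, X.L m x ∈ parity i
  even_J : ∀ m i, ∀ x ∈ parity i, X.J m x ∈ parity i
  odd_G1 : ∀ k i, ∀ x ∈ parity i, X.G1 k x ∈ parity (i + 1)
  odd_G2 : ∀ k i, ∀ x ∈ parity i, X.G2 k x ∈ parity (i + 1)

/-- `Ω` is a lowest weight vector of lowest weight `(h, q)`. -/
structure IsLowestWeightVector {V : Type*} [AddCommGroup V] [Module ℂ V]
    (X : N2Modes (Module.End ℂ V)) (Ω : V) (h q : ℂ) : Prop where
  ne_zero : Ω ≠ 0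
  L_zero : X.L 0 Ω = h • Ω
  J_zero : X.J 0 Ω = q • Ω
  L_pos : ∀ m : ℤ, 0 < m → X.L m Ω = 0
  J_pos : ∀ m : ℤ, 0 < m → X.J m Ω = 0
  G1_pos : ∀ k : ℤ, 0 ≤ k → X.G1 k Ω = 0
  G2_pos : ∀ k : ℤ, 0 ≤ k → X.G2 k Ω = 0

/-- `Ω` is a cyclic vector: the only invariant subspace containing `Ω` is the whole space. -/
def IsCyclicVector {V : Type*} [AddCommGroup V] [Module ℂ V]
    (X : N2Modes (Module.End ℂ V)) (Ω : V) : Prop :=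
  ∀ W : Submodule ℂ V, Ω ∈ W →
    (∀ m, ∀ x ∈ W, X.L m x ∈ W ∧ X.J m x ∈ W ∧ X.G1 m x ∈ W ∧ X.G2 m x ∈ W) → W = ⊤

/-! ### Vertex operator superalgebras -/

/-- The coefficient `a₍ₙ₎` of `Y(a, z) = ∑ₙ a₍ₙ₎ z⁻ⁿ⁻¹`. -/
noncomputable def nthProd {V : Type*} [AddCommGroup V] [Module ℂ V]
    (Y : V →ₗ[ℂ] VertexOperator ℂ V) (a : V) (n : ℤ) : Module.End ℂ V :=
  VertexOperator.ncoeff (Y a) n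

/-- Vertex superalgebras: `V = parity 0 ⊕ parity 1` with state-field correspondence `Y`, vacuum
vector `Ω` and infinitesimal translation operator `T`. The field property of `Y(a, z)` is part of
the type `VertexOperator ℂ V`. -/
structure IsVertexSuperalgebra {V : Type*} [AddCommGroup V] [Module ℂ V]
    (parity : ZMod 2 → Submodule ℂ V) (Y : V →ₗ[ℂ] VertexOperator ℂ V) (Ω : V)
    (T : Module.End ℂ V) : Prop where
  isInternal : DirectSum.IsInternal parity
  vacuum_even : Ω ∈ parity 0
  translation_even : ∀ i, ∀ x ∈ parity i, T x ∈ parity i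
  parity_nthProd : ∀ i j, ∀ a ∈ parity i, ∀ b ∈ parity j, ∀ n, nthProd Y a n b ∈ parity (i + j)
  vacuum : ∀ n, nthProd Y Ω n = if n = -1 then 1 else 0
  creation : ∀ a, nthProd Y a (-1) Ω = a
  creation_nonneg : ∀ a n, 0 ≤ n → nthProd Y a n Ω = 0
  translation_vacuum : T Ω = 0
  /-- `[T, Y(a, z)] = ∂_z Y(a, z)`. -/
  translation : ∀ a n, T * nthProd Y a n - nthProd Y a n * T = (-(n : ℂ)) • nthProd Y a (n - 1)
  /-- `(z - w)^N [Y(a, z), Y(b, w)] = 0` for `N` large, where `[·,·]` is the supercommutator: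
  the coefficient of `z^(-m-1) w^(-n-1)`. -/
  locality : ∀ i j, ∀ a ∈ parity i, ∀ b ∈ parity j, ∃ N : ℕ, ∀ m n : ℤ,
    ∑ k ∈ Finset.range (N + 1), ((-1 : ℂ) ^ k * (N.choose k : ℂ)) •
      (nthProd Y a (m + N - k) * nthProd Y b (n + k) -
        ((-1 : ℂ) ^ (i.val * j.val)) • (nthProd Y b (n + k) * nthProd Y a (m + N - k))) = 0

/-- The data of a vertex operator superalgebra on `V`: grading by parity, state-field
correspondence, vacuum vector and conformal vector. -/
structure VOSAData (V : Type*) [AddCommGroup V] [Module ℂ V] where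
  parity : ZMod 2 → Submodule ℂ V
  Y : V →ₗ[ℂ] VertexOperator ℂ V
  vacuum : V
  conformal : V

namespace VOSAData

variable {V : Type*} [AddCommGroup V] [Module ℂ V] {W : Type*} [AddCommGroup W] [Module ℂ W]

/-- The operators `L_m` with `Y(ν, z) = ∑ₘ L_m z⁻ᵐ⁻²`, where `ν` is the conformal vector. -/
noncomputable def L (S : VOSAData V) (m : ℤ) : Module.End ℂ V :=
  nthProd S.Y S.conformal (m + 1)

/-- The space of vectors of conformal weight `d`. -/
noncomputable def weightSpace (S : VOSAData V) (d : ℂ) : Submodule ℂ V :=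
  Module.End.eigenspace (S.L 0) d

/-- The data `S` are those of a vertex operator superalgebra of central charge `c`.
(Diagonalizability of `L_0` follows from `even_eq`, `odd_eq` and `V = V₀ ⊕ V₁`; the sums in
`even_eq` and `odd_eq` are direct because eigenspaces are independent.) -/
structure IsVOSA (S : VOSAData V) (c : ℂ) : Prop where
  isVertexSuperalgebra : IsVertexSuperalgebra S.parity S.Y S.vacuum (S.L (-1))
  conformal_even : S.conformal ∈ S.parity 0
  virasoro : ∀ m n : ℤ, S.L m * S.L n - S.L n * S.L m =
    ((m : ℂ) - n) • S.L (m + n) +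
      if m + n = 0 then (c * ((m : ℂ) ^ 3 - m) / 12) • (1 : Module.End ℂ V) else 0
  even_eq : S.parity 0 = ⨆ n : ℤ, S.weightSpace n
  odd_eq : S.parity 1 = ⨆ n : ℤ, S.weightSpace ((n : ℂ) - 1 / 2)
  finiteDimensional : ∀ k : ℤ, FiniteDimensional ℂ (S.weightSpace ((k : ℂ) / 2))
  bounded_below : ∃ N : ℤ, ∀ k : ℤ, (k : ℝ) / 2 < N → S.weightSpace ((k : ℂ) / 2) = ⊥

/-- There are no non-trivial ideals. -/
def IsSimple (S : VOSAData V) : Prop :=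
  ∀ I : Submodule ℂ V, (∀ a, ∀ b ∈ I, ∀ n, nthProd S.Y a n b ∈ I) → I = ⊥ ∨ I = ⊤

/-- `θ` is an antilinear VOSA involution. -/
structure IsAntilinearInvolution (S : VOSAData V) (θ : V →ₗ⋆[ℂ] V) : Prop where
  involutive : ∀ a, θ (θ a) = a
  map_vacuum : θ S.vacuum = S.vacuum
  map_conformal : θ S.conformal = S.conformal
  map_nthProd : ∀ a n b, θ (nthProd S.Y a n b) = nthProd S.Y (θ a) n (θ b)

/-- `B` makes `S` a unitary VOSA: `B` is a normalized scalar product which is invariant, i.e. for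
some antilinear VOSA involution `θ`,
`(Y(θ(a), z) b | c) = (b | Y(e^{z L₁} (-1)^{2 L₀² + L₀} z^{-2 L₀} a, z⁻¹) c)`.
This is written for `a` of conformal weight `k / 2`, comparing coefficients of `z⁻ⁿ⁻¹`; the sum
over `l` comes from the exponential series and is finite, because `L₁` lowers the weight by `1`
and the weights are bounded below. -/
structure IsUnitary (S : VOSAData V) (B : V →ₗ⋆[ℂ] V →ₗ[ℂ] ℂ) : Prop where
  isScalarProduct : IsScalarProduct B
  normalized : B S.vacuum S.vacuum = 1
  invariant : ∃ θ : V →ₗ⋆[ℂ] V, S.IsAntilinearInvolution θ ∧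
    ∀ k : ℤ, ∀ a ∈ S.weightSpace ((k : ℂ) / 2), ∀ (n : ℤ) (b c : V),
      B (nthProd S.Y (θ a) n b) c =
        (-1 : ℂ) ^ (k * (k + 1) / 2) *
          ∑ᶠ l : ℕ, ((l.factorial : ℂ)⁻¹) *
            B b (nthProd S.Y ((S.L 1 ^ l) a) (k - l - n - 2) c)

/-- `φ` is an isomorphism of VOSAs. -/
structure IsIso (S : VOSAData V) (S' : VOSAData W) (φ : V ≃ₗ[ℂ] W) : Prop where
  map_parity : ∀ i, (S.parity i).map φ.toLinearMap = S'.parity i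
  map_vacuum : φ S.vacuum = S'.vacuum
  map_conformal : φ S.conformal = S'.conformal
  map_nthProd : ∀ a n b, φ (nthProd S.Y a n b) = nthProd S'.Y (φ a) n (φ b)

end VOSAData

/-- The operators `X` are the modes of the fields of the vectors
`ν = L_{-2} Ω`, `j = J_{-1} Ω`, `τ¹ = G¹_{-3/2} Ω`, `τ² = G²_{-3/2} Ω`:
`Y(ν, z) = ∑ L_m z⁻ᵐ⁻²`, `Y(j, z) = ∑ J_m z⁻ᵐ⁻¹` and `Y(τⁱ, z) = ∑ Gⁱ_r z^(-r-3/2)`. -/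
structure IsN2StateField {V : Type*} [AddCommGroup V] [Module ℂ V]
    (X : N2Modes (Module.End ℂ V)) (Ω : V) (Y : V →ₗ[ℂ] VertexOperator ℂ V) : Prop where
  L_eq : ∀ m, nthProd Y (X.L (-2) Ω) (m + 1) = X.L m
  J_eq : ∀ m, nthProd Y (X.J (-1) Ω) m = X.J m
  G1_eq : ∀ k, nthProd Y (X.G1 (-2) Ω) (k + 1) = X.G1 k
  G2_eq : ∀ k, nthProd Y (X.G2 (-2) Ω) (k + 1) = X.G2 k

/-! ### The `N = 2` super-Virasoro VOSA `V^c(N2)` -/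

/-- Generators of the `N = 2` super-Virasoro algebra, indexed as in `N2Modes`. -/
inductive N2Gen
  | L (m : ℤ)
  | J (m : ℤ)
  | G1 (k : ℤ)
  | G2 (k : ℤ)

/-- The parity of a generator. -/
def N2Gen.parity : N2Gen → ZMod 2
  | .L _ => 0
  | .J _ => 0
  | .G1 _ => 1
  | .G2 _ => 1

/-- The generators as elements of the free associative algebra. -/
noncomputable def N2Modes.free : N2Modes (FreeAlgebra ℂ N2Gen) where
  L m := FreeAlgebra.ι ℂ (.L m)
  J m := FreeAlgebra.ι ℂ (.J m)
  G1 k := FreeAlgebra.ι ℂ (.G1 k)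
  G2 k := FreeAlgebra.ι ℂ (.G2 k)

section
open N2Modes

/-- The `N = 2` relations with central charge `c` in the free associative algebra. -/
inductive N2Rel (c : ℂ) : FreeAlgebra ℂ N2Gen → FreeAlgebra ℂ N2Gen → Prop
  | L_L (m n : ℤ) : N2Rel c (free.L m * free.L n - free.L n * free.L m)
      (((m : ℂ) - n) • free.L (m + n) +
        if m + n = 0 then algebraMap ℂ _ (c * ((m : ℂ) ^ 3 - m) / 12) else 0)
  | L_J (m n : ℤ) : N2Rel c (free.L m * free.J n - free.J n * free.L m)
      ((-(n : ℂ)) • free.J (m + n))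
  | J_J (m n : ℤ) : N2Rel c (free.J m * free.J n - free.J n * free.J m)
      (if m + n = 0 then algebraMap ℂ _ (c / 3 * m) else 0)
  | L_G1 (m k : ℤ) : N2Rel c (free.L m * free.G1 k - free.G1 k * free.L m)
      (((m : ℂ) / 2 - (k + 1 / 2)) • free.G1 (m + k))
  | L_G2 (m k : ℤ) : N2Rel c (free.L m * free.G2 k - free.G2 k * free.L m)
      (((m : ℂ) / 2 - (k + 1 / 2)) • free.G2 (m + k))
  | G1_G1 (k l : ℤ) : N2Rel c (free.G1 k * free.G1 l + free.G1 l * free.G1 k)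
      ((2 : ℂ) • free.L (k + l + 1) +
        if k + l + 1 = 0 then algebraMap ℂ _ (c / 3 * (((k : ℂ) + 1 / 2) ^ 2 - 1 / 4)) else 0)
  | G2_G2 (k l : ℤ) : N2Rel c (free.G2 k * free.G2 l + free.G2 l * free.G2 k)
      ((2 : ℂ) • free.L (k + l + 1) +
        if k + l + 1 = 0 then algebraMap ℂ _ (c / 3 * (((k : ℂ) + 1 / 2) ^ 2 - 1 / 4)) else 0)
  | G1_G2 (k l : ℤ) : N2Rel c (free.G1 k * free.G2 l + free.G2 l * free.G1 k)
      ((Complex.I * ((k : ℂ) - l)) • free.J (k + l + 1))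
  | G1_J (k n : ℤ) : N2Rel c (free.G1 k * free.J n - free.J n * free.G1 k)
      ((-Complex.I) • free.G2 (k + n))
  | G2_J (k n : ℤ) : N2Rel c (free.G2 k * free.J n - free.J n * free.G2 k)
      (Complex.I • free.G1 (k + n))

end

/-- The universal enveloping algebra of the `N = 2` super-Virasoro algebra, with the central
element specialized to `c`. -/
def N2Env (c : ℂ) : Type := RingQuot (N2Rel c)

noncomputable instance (c : ℂ) : Ring (N2Env c) := inferInstanceAs (Ring (RingQuot (N2Rel c)))

noncomputable instance (c : ℂ) : Algebra ℂ (N2Env c) :=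
  inferInstanceAs (Algebra ℂ (RingQuot (N2Rel c)))

/-- The quotient map from the free associative algebra. -/
noncomputable def N2Env.mk (c : ℂ) : FreeAlgebra ℂ N2Gen →ₐ[ℂ] N2Env c :=
  RingQuot.mkAlgHom ℂ (N2Rel c)

theorem N2Env.mk_rel {c : ℂ} {x y : FreeAlgebra ℂ N2Gen} (h : N2Rel c x y) :
    N2Env.mk c x = N2Env.mk c y :=
  RingQuot.mkAlgHom_rel ℂ h

/-- The image of a generator in the enveloping algebra. -/
noncomputable def N2Env.gen (c : ℂ) (g : N2Gen) : N2Env c :=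
  N2Env.mk c (FreeAlgebra.ι ℂ g)

/-- The modes in the enveloping algebra. -/
noncomputable def N2Env.modes (c : ℂ) : N2Modes (N2Env c) where
  L m := N2Env.gen c (.L m)
  J m := N2Env.gen c (.J m)
  G1 k := N2Env.gen c (.G1 k)
  G2 k := N2Env.gen c (.G2 k)

theorem N2Env.modes_isN2 (c : ℂ) : (N2Env.modes c).IsN2 c where
  L_L m n := by
    simpa [N2Modes.free, N2Env.modes, N2Env.gen, apply_ite] using N2Env.mk_rel (N2Rel.L_L (c := c) m n)
  L_J m n := by
    simpa [N2Modes.free, N2Env.modes, N2Env.gen, apply_ite] using N2Env.mk_rel (N2Rel.L_J (c := c) m n)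
  J_J m n := by
    simpa [N2Modes.free, N2Env.modes, N2Env.gen, apply_ite] using N2Env.mk_rel (N2Rel.J_J (c := c) m n)
  L_G1 m n := by
    simpa [N2Modes.free, N2Env.modes, N2Env.gen, apply_ite] using N2Env.mk_rel (N2Rel.L_G1 (c := c) m n)
  L_G2 m n := by
    simpa [N2Modes.free, N2Env.modes, N2Env.gen, apply_ite] using N2Env.mk_rel (N2Rel.L_G2 (c := c) m n)
  G1_G1 m n := by
    simpa [N2Modes.free, N2Env.modes, N2Env.gen, apply_ite] using N2Env.mk_rel (N2Rel.G1_G1 (c := c) m n)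
  G2_G2 m n := by
    simpa [N2Modes.free, N2Env.modes, N2Env.gen, apply_ite] using N2Env.mk_rel (N2Rel.G2_G2 (c := c) m n)
  G1_G2 m n := by
    simpa [N2Modes.free, N2Env.modes, N2Env.gen, apply_ite] using N2Env.mk_rel (N2Rel.G1_G2 (c := c) m n)
  G1_J m n := by
    simpa [N2Modes.free, N2Env.modes, N2Env.gen, apply_ite] using N2Env.mk_rel (N2Rel.G1_J (c := c) m n)
  G2_J m n := by
    simpa [N2Modes.free, N2Env.modes, N2Env.gen, apply_ite] using N2Env.mk_rel (N2Rel.G2_J (c := c) m n)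

/-- The left ideal defining the Verma module of central charge `c` and lowest weight `(0, 0)`. -/
noncomputable def N2VermaIdeal (c : ℂ) : Submodule (N2Env c) (N2Env c) :=
  Submodule.span (N2Env c)
    ({x | ∃ m : ℤ, 0 ≤ m ∧ (x = (N2Env.modes c).L m ∨ x = (N2Env.modes c).J m)} ∪
      {x | ∃ k : ℤ, 0 ≤ k ∧ (x = (N2Env.modes c).G1 k ∨ x = (N2Env.modes c).G2 k)})

/-- The sum of all proper left ideals containing `N2VermaIdeal c`; it corresponds to the sum of
all proper submodules of the Verma module, which is its largest proper submodule. -/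
noncomputable def N2MaxIdeal (c : ℂ) : Submodule (N2Env c) (N2Env c) :=
  sSup {K | N2VermaIdeal c ≤ K ∧ K ≠ ⊤}

/-- The irreducible lowest weight module of central charge `c` and lowest weight `(0, 0)`. -/
abbrev N2Simple (c : ℂ) : Type := N2Env c ⧸ N2MaxIdeal c

namespace N2Simple

/-- The lowest weight vector. -/
noncomputable def vacuum (c : ℂ) : N2Simple c := Submodule.Quotient.mk 1

/-- The action of the `N = 2` super-Virasoro algebra. -/
noncomputable def modes (c : ℂ) : N2Modes (Module.End ℂ (N2Simple c)) where
  L m := Algebra.lsmul ℂ ℂ (N2Simple c) ((N2Env.modes c).L m)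
  J m := Algebra.lsmul ℂ ℂ (N2Simple c) ((N2Env.modes c).J m)
  G1 k := Algebra.lsmul ℂ ℂ (N2Simple c) ((N2Env.modes c).G1 k)
  G2 k := Algebra.lsmul ℂ ℂ (N2Simple c) ((N2Env.modes c).G2 k)

/-- The grading by parity for which the lowest weight vector is even: the span of the
`g₁ ⋯ gₛ Ω`, for words `g₁ ⋯ gₛ` in the generators of the given parity. -/
noncomputable def parity (c : ℂ) (i : ZMod 2) : Submodule ℂ (N2Simple c) :=
  Submodule.span ℂ {x | ∃ w : List N2Gen, (w.map N2Gen.parity).sum = i ∧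
    x = (w.map (N2Env.gen c)).prod • vacuum c}

open Classical in
/-- The state-field correspondence of `V^c(N2)`: the vertex superalgebra structure on the
irreducible module for which the vacuum is the lowest weight vector, translation is `L_{-1}` and
the fields of `L_{-2} Ω`, `J_{-1} Ω`, `Gⁱ_{-3/2} Ω` are the `N = 2` fields. As these fields generate
the module from the vacuum, they determine it. -/
noncomputable def stateField (c : ℂ) : N2Simple c →ₗ[ℂ] VertexOperator ℂ (N2Simple c) :=
  if h : ∃ Y : N2Simple c →ₗ[ℂ] VertexOperator ℂ (N2Simple c),
      IsVertexSuperalgebra (parity c) Y (vacuum c) ((modes c).L (-1)) ∧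
        IsN2StateField (modes c) (vacuum c) Y
  then h.choose else 0

end N2Simple

/-- The `N = 2` super-Virasoro VOSA `V^c(N2)`. -/
noncomputable def superVirasoroN2 (c : ℂ) : VOSAData (N2Simple c) where
  parity := N2Simple.parity c
  Y := N2Simple.stateField c
  vacuum := N2Simple.vacuum c
  conformal := (N2Simple.modes c).L (-2) (N2Simple.vacuum c)

/-! Unitarity. Applied to `p(z) = 1 + z`, the symmetry hypotheses say that for neighbouring modes of
one field the failures to have the expected adjoint cancel (`adjDefect_add_adjDefect`). Up to sign,
the failure of a mode is therefore that of a mode arbitrarily far out in the same field, and far-out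
modes annihilate any given vector (`exists_op_eq_zero`). Together with the compatibility of the
relations with adjoints (`IsN2.comm_adj`) this propagates the absence of failures from `Ω` to the
cyclic module (`adjDefect_eq_zero_op`). At `Ω` itself, the lowest modes give `(G_{-1/2} Ω | G_{-1/2}
Ω) = (Ω | L_{-1} Ω) = 0`, so positivity forces `G_{-1/2} Ω = 0` and hence `L_{-1} Ω = 0`. Then `(Ω |
L_0 x) = -(Ω | L_1 x)`, and induction on the weight makes `Ω` orthogonal to all positive weights
(`eq_zero_of_L_one`), which removes the failures at `Ω` (`isVacuumModule_and_isInvariantForm`).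

Vertex superalgebra. Translation covariant fields that are local relative to the generating fields
and regular on the vacuum are determined by the state they create (`eq_zero_of_mem_vertexFields`),
and they are closed under products by Dong's lemma (`IsProd.isLocal`). As words in the modes span
the module, each homogeneous vector is the state of exactly one such field, which gives `Y`
(`exists_isVacuumVOSA`). Word counting yields the weight spaces.

Identification. An invariant scalar product makes the module irreducible: a submodule without `Ω` is
orthogonal to `Ω`, hence to everything. The annihilator of the vacuum in any irreducible vacuum
module is the same maximal left ideal (`mem_N2MaxIdeal_iff`), so all these modules are isomorphic,
and by uniqueness of fields a module isomorphism respects all products (`IsVacuumVOSA.map_nthProd`).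
Comparing the module with its complex conjugate, with `J` replaced by `-J`, produces the antilinear
involution (`exists_conjugation`).

Invariance of the form. The formula is first proved with `b = Ω`, by generating `d` from the vacuum
with `J_{-1}` and `G^i_{-1/2}` (`vacuumInvariance`), and then extended to all `b` by locality
(`form_nthProd`).

Isometry. A unitary structure on `V^c(N2)` comes with an unknown involution. It fixes `ν`,
positivity forces it to send `j` to `-j`, and on `τ¹, τ²` it acts with the matrix of a rotation
through an imaginary angle. Rotating by half that angle gives modes for which the form is invariant
(`exists_rotate_isInvariantForm`). Such a rotation does not change the vertex superalgebra, and a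
normalized invariant form is unique (`IsInvariantForm.eq`), so matching the original modes with the
rotated ones is an isometry. -/

/-! ### Binomial coefficients with complex upper entry -/

/-- The binomial coefficient `x (x - 1) ⋯ (x - k + 1) / k!`. -/
noncomputable def cbinom (x : ℂ) : ℕ → ℂ
  | 0 => 1
  | k + 1 => cbinom x k * (x - k) / (k + 1)

@[simp] theorem cbinom_zero (x : ℂ) : cbinom x 0 = 1 := rfl

theorem cbinom_succ_mul (x : ℂ) (k : ℕ) :
    cbinom x (k + 1) * (k + 1) = cbinom x k * (x - k) := by
  have : (k : ℂ) + 1 ≠ 0 := Nat.cast_add_one_ne_zero k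
  simp only [cbinom]
  field_simp

@[simp] theorem cbinom_one (x : ℂ) : cbinom x 1 = x := by
  simp [cbinom]

theorem cbinom_add_one_mul (x : ℂ) (k : ℕ) :
    cbinom (x + 1) (k + 1) * (k + 1) = (x + 1) * cbinom x k := by
  induction k with
  | zero => simp [cbinom]
  | succ k ih =>
    have h1 := cbinom_succ_mul x k
    have h2 := cbinom_succ_mul (x + 1) (k + 1)
    have : (k : ℂ) + 1 ≠ 0 := Nat.cast_add_one_ne_zero k
    push_cast at h2 ⊢
    apply mul_right_cancel₀ this
    linear_combination (k + 1 : ℂ) * h2 + (x - k) * ih - (x + 1) * h1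

theorem cbinom_add_one (x : ℂ) (k : ℕ) :
    cbinom (x + 1) (k + 1) = cbinom x (k + 1) + cbinom x k := by
  have : (k : ℂ) + 1 ≠ 0 := Nat.cast_add_one_ne_zero k
  apply mul_right_cancel₀ this
  linear_combination cbinom_add_one_mul x k - cbinom_succ_mul x k

theorem cbinom_sub_one_mul (x : ℂ) (k : ℕ) :
    x * cbinom (x - 1) k = (x - k) * cbinom x k := by
  have h := cbinom_add_one_mul (x - 1) k
  rw [sub_add_cancel] at h
  linear_combination cbinom_succ_mul x k - h

theorem cbinom_natCast_of_lt {m k : ℕ} (h : m < k) : cbinom m k = 0 := by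
  induction k, h using Nat.le_induction with
  | base => simp [cbinom]
  | succ k _ ih => simp [cbinom, ih]

theorem cbinom_natCast_self (k : ℕ) : cbinom k k = 1 := by
  induction k with
  | zero => rfl
  | succ k ih =>
    have := cbinom_add_one_mul k k
    rw [ih] at this
    have h : (k : ℂ) + 1 ≠ 0 := Nat.cast_add_one_ne_zero k
    apply mul_right_cancel₀ h
    push_cast
    linear_combination this

theorem cbinom_zero_succ (k : ℕ) : cbinom 0 (k + 1) = 0 := by
  exact_mod_cast cbinom_natCast_of_lt (Nat.succ_pos k)

theorem cbinom_neg_one (k : ℕ) : cbinom (-1) k = (-1) ^ k := by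
  induction k with
  | zero => rfl
  | succ k ih =>
    have h : (k : ℂ) + 1 ≠ 0 := Nat.cast_add_one_ne_zero k
    simp only [cbinom, ih]
    field_simp
    ring

/-! ### Formal distributions in several variables -/

namespace FormalDist

/-! ### Series in two variables and multiplication by `z - w`. -/

section TwoVariables

variable {M : Type*} [AddCommGroup M] [Module ℂ M] {M' : Type*} [AddCommGroup M'] [Module ℂ M']

/-- Multiplication by `z - w` of `∑ F m n z⁻ᵐ⁻¹ w⁻ⁿ⁻¹`. -/
def subMul (M : Type*) [AddCommGroup M] [Module ℂ M] : Module.End ℂ (ℤ → ℤ → M) where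
  toFun F m n := F (m + 1) n - F m (n + 1)
  map_add' F G := by ext m n; simp only [Pi.add_apply]; abel
  map_smul' a F := by ext m n; simp [smul_sub]

@[simp] theorem subMul_apply (F : ℤ → ℤ → M) (m n : ℤ) :
    subMul M F m n = F (m + 1) n - F m (n + 1) := rfl

theorem subMul_pow_succ (N : ℕ) (F : ℤ → ℤ → M) (m n : ℤ) :
    (subMul M ^ (N + 1)) F m n = (subMul M ^ N) F (m + 1) n - (subMul M ^ N) F m (n + 1) := by
  rw [pow_succ']; rfl

theorem subMul_pow_map (f : M →ₗ[ℂ] M') (N : ℕ) (F : ℤ → ℤ → M) :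
    (subMul M' ^ N) (fun m n => f (F m n)) = fun m n => f ((subMul M ^ N) F m n) := by
  induction N with
  | zero => rfl
  | succ N ih => ext m n; rw [subMul_pow_succ, ih, subMul_pow_succ, map_sub]

theorem subMul_pow_eq_zero_of_le {N N' : ℕ} (h : N ≤ N') {F : ℤ → ℤ → M}
    (hF : (subMul M ^ N) F = 0) : (subMul M ^ N') F = 0 := by
  obtain ⟨k, rfl⟩ := Nat.exists_eq_add_of_le' h
  rw [pow_add, Module.End.mul_apply, hF, map_zero]

/-- Pascal's rule with signs: the induction step in the binomial expansion of `(z - w)^N`. -/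
theorem sum_range_neg_one_pow_choose_succ (N : ℕ) (c : ℕ → M) :
    ∑ k ∈ Finset.range (N + 2), ((-1 : ℂ) ^ k * ((N + 1).choose k : ℂ)) • c k =
      ∑ k ∈ Finset.range (N + 1), ((-1 : ℂ) ^ k * (N.choose k : ℂ)) • c k -
        ∑ k ∈ Finset.range (N + 1), ((-1 : ℂ) ^ k * (N.choose k : ℂ)) • c (k + 1) := by
  have h : ∑ k ∈ Finset.range (N + 1), ((-1 : ℂ) ^ k * (N.choose k : ℂ)) • c k =
      ∑ k ∈ Finset.range (N + 2), ((-1 : ℂ) ^ k * (N.choose k : ℂ)) • c k := by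
    rw [Finset.sum_range_succ _ (N + 1)]
    simp
  rw [h, Finset.sum_range_succ', Finset.sum_range_succ' _ (N + 1), add_sub_right_comm,
    ← Finset.sum_sub_distrib]
  simp only [Nat.choose_zero_right]
  congr 1
  refine Finset.sum_congr rfl fun k _ => ?_
  rw [Nat.choose_succ_succ, Nat.cast_add, pow_succ]
  module

theorem subMul_pow_apply (N : ℕ) (F : ℤ → ℤ → M) (m n : ℤ) :
    (subMul M ^ N) F m n =
      ∑ k ∈ Finset.range (N + 1), ((-1 : ℂ) ^ k * (N.choose k : ℂ)) • F (m + N - k) (n + k) := by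
  induction N generalizing m n with
  | zero => simp
  | succ N ih =>
    rw [subMul_pow_succ, ih, ih, sum_range_neg_one_pow_choose_succ]
    push_cast
    congr 1 <;> refine Finset.sum_congr rfl fun k _ => ?_ <;> congr 2 <;> ring

/-- The coefficients of large index in the second variable vanish. -/
theorem subMul_pow_eq_zero_of_le_right {F : ℤ → ℤ → M} {K : ℤ} (h : ∀ m n, K ≤ n → F m n = 0)
    (N : ℕ) : ∀ m n, K ≤ n → (subMul M ^ N) F m n = 0 := by
  induction N with
  | zero => exact h
  | succ N ih =>
    intro m n hn
    rw [subMul_pow_succ, ih _ _ hn, ih _ _ (by lia), sub_zero]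

theorem subMul_pow_eq_zero_of_le_left {F : ℤ → ℤ → M} {K : ℤ} (h : ∀ m n, K ≤ m → F m n = 0)
    (N : ℕ) : ∀ m n, K ≤ m → (subMul M ^ N) F m n = 0 := by
  induction N with
  | zero => exact h
  | succ N ih =>
    intro m n hm
    rw [subMul_pow_succ, ih _ _ hm, ih _ _ (by lia), sub_zero]

/-- Multiplication by `z - w` is injective on series bounded in one variable. -/
theorem eq_zero_of_subMul_pow_eq_zero {F : ℤ → ℤ → M} {K : ℤ} (h : ∀ m n, K ≤ n → F m n = 0)
    {N : ℕ} (hN : (subMul M ^ N) F = 0) : F = 0 := by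
  induction N with
  | zero => exact hN
  | succ N ih =>
    apply ih
    have h' := subMul_pow_eq_zero_of_le_right h N
    -- A series killed by one factor `z - w` is constant along antidiagonals, and each antidiagonal
    -- enters the region where the series vanishes; `k` bounds the number of steps needed.
    have key : ∀ (k : ℕ) (m n : ℤ), K ≤ n + k → (subMul M ^ N) F m n = 0 := by
      intro k
      induction k with
      | zero => intro m n hn; exact h' m n (by simpa using hn)
      | succ k ihk =>
        intro m n hn
        have e := subMul_pow_succ N F (m - 1) n
        rw [hN, sub_add_cancel, ihk (m - 1) (n + 1) (by push_cast at hn; lia), sub_zero] at e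
        exact e.symm
    ext m n
    exact key (K - n).toNat m n (by lia)

/-- The action of a derivation `[T, ·]` with `[T, A(z)] = ∂A(z)` on products. -/
def transl (F : ℤ → ℤ → M) (m n : ℤ) : M := (-(m : ℂ)) • F (m - 1) n + (-(n : ℂ)) • F m (n - 1)

/-- `transl` is the derivation `∂_z + ∂_w`, which annihilates `z - w`. -/
theorem subMul_pow_transl (N : ℕ) (F : ℤ → ℤ → M) :
    (subMul M ^ N) (transl F) = transl ((subMul M ^ N) F) := by
  induction N with
  | zero => rfl
  | succ N ih =>
    ext m n
    rw [subMul_pow_succ, ih]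
    simp only [transl, subMul_pow_succ, add_sub_cancel_right, sub_add_cancel]
    have e1 : m + 1 - 1 = m - 1 + 1 := by ring
    have e2 : n + 1 - 1 = n - 1 + 1 := by ring
    push_cast
    module

/-- A distribution annihilated by a power of `z - w` is determined by its residues. -/
theorem eq_sum_residues {N : ℕ} {F : ℤ → ℤ → M} (hF : (subMul M ^ N) F = 0) (m n : ℤ) :
    F m n = ∑ j ∈ Finset.range N, cbinom m j • (subMul M ^ j) F 0 (m + n - j) := by
  induction N generalizing F m n with
  | zero => simpa using congr_fun₂ hF m n
  | succ N ih =>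
    set G : ℤ → ℤ → M := fun m n =>
      ∑ j ∈ Finset.range (N + 1), cbinom m j • (subMul M ^ j) F 0 (m + n - j) with hG
    have hF' : (subMul M ^ N) (subMul M F) = 0 := by
      rw [← Module.End.mul_apply, ← pow_succ, hF]
    -- By Pascal's rule for `cbinom`, `(z - w) G` is the residue expansion of `(z - w) F`, to which
    -- the induction hypothesis applies. Agreement at `m = 0` then spreads along antidiagonals.
    have step : ∀ m n, F (m + 1) n - F m (n + 1) = G (m + 1) n - G m (n + 1) := by
      intro m n
      have h1 := ih hF' m n
      rw [subMul_apply] at h1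
      rw [h1, hG]
      simp only [Finset.sum_range_succ' _ N]
      have e0 : m + 1 + n - ((0 : ℕ) : ℤ) = m + (n + 1) - ((0 : ℕ) : ℤ) := by push_cast; ring
      rw [cbinom_zero, cbinom_zero, e0, add_sub_add_right_eq_sub, ← Finset.sum_sub_distrib]
      refine Finset.sum_congr rfl fun j _ => ?_
      have e1 : m + 1 + n - ((j + 1 : ℕ) : ℤ) = m + n - j := by push_cast; ring
      have e2 : m + (n + 1) - ((j + 1 : ℕ) : ℤ) = m + n - j := by push_cast; ring
      rw [e1, e2, ← sub_smul]
      push_cast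
      rw [cbinom_add_one, add_sub_cancel_left, ← Module.End.mul_apply, ← pow_succ]
    have base : ∀ n, F 0 n = G 0 n := by
      intro n
      simp only [hG, Finset.sum_range_succ' _ N, Int.cast_zero, cbinom_zero_succ, zero_smul]
      simp
    change F m n = G m n
    induction m using Int.induction_on generalizing n with
    | zero => exact base n
    | succ i ihi => simpa [ihi] using step i n
    | pred i ihi =>
      have := step (-(i : ℤ) - 1) (n - 1)
      rw [sub_add_cancel, sub_add_cancel, ihi] at this
      exact (sub_right_inj.mp this)

end TwoVariables

/-- The common combinatorial core of the two halves of Dong's lemma. -/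
theorem pow_apply_eq_zero_of_recursion {E E' : Type*} [AddCommGroup E'] [Module ℂ E']
    {S : Set E} {f : E → E} {g : Module.End ℂ E'} {s : ℕ → E → E'} {K q : ℕ} {Z : E → Prop}
    (hS : ∀ G ∈ S, f G ∈ S)
    (h0 : ∀ G ∈ S, s 0 (f G) = g (s 0 G))
    (hs : ∀ k, k + 1 < K → ∀ G ∈ S, s (k + 1) (f G) = s k G + g (s (k + 1) G))
    (hZ : ∀ k < K, ∀ G ∈ S, Z G → (g ^ q) (s k G) = 0)
    (p : ℕ) : ∀ k < K, ∀ G ∈ S, Z (f^[p] G) → (g ^ (q + p + k)) (s k G) = 0 := by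
  -- In both applications `f` is multiplication by `z - u`, `g` is multiplication by `w - u`, and
  -- `hs` expresses `z - u = (z - w) + (w - u)`. Removing one `f` either costs one `g` or lowers
  -- `k`, whence the exponent `q + p + k`.
  induction p with
  | zero =>
    intro k hk G hG h
    rw [add_zero, add_comm, pow_add, Module.End.mul_apply, hZ k hk G hG h, map_zero]
  | succ p ih =>
    intro k
    induction k with
    | zero =>
      intro hk G hG h
      have := ih 0 hk (f G) (hS G hG) h
      rwa [h0 G hG, ← Module.End.mul_apply, ← pow_succ] at this
    | succ k ihk =>
      intro hk G hG h
      have h1 := ih (k + 1) hk (f G) (hS G hG) h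
      have h2 := ihk (by lia) G hG h
      rw [hs k hk G hG, map_add, ← Module.End.mul_apply, ← pow_succ,
        show q + p + (k + 1) = q + (p + 1) + k by ring, h2, zero_add] at h1
      exact h1

/-! ### Series in three variables, where `z - u = (z - w) + (w - u)`. -/

section ThreeVariables

variable (M : Type*) [AddCommGroup M] [Module ℂ M]

/-- Multiplication by `z - w` of `∑ F m n l z⁻ᵐ⁻¹ w⁻ⁿ⁻¹ u⁻ˡ⁻¹`. -/
def mulZW : Module.End ℂ (ℤ → ℤ → ℤ → M) where
  toFun F m n l := F (m + 1) n l - F m (n + 1) l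
  map_add' F G := by ext m n; simp only [Pi.add_apply]; abel
  map_smul' a F := by ext m n; simp [smul_sub]

/-- Multiplication by `w - u`. -/
def mulWU : Module.End ℂ (ℤ → ℤ → ℤ → M) where
  toFun F m n l := F m (n + 1) l - F m n (l + 1)
  map_add' F G := by ext m n; simp only [Pi.add_apply]; abel
  map_smul' a F := by ext m n; simp [smul_sub]

/-- Multiplication by `z - u`. -/
def mulZU : Module.End ℂ (ℤ → ℤ → ℤ → M) where
  toFun F m n l := F (m + 1) n l - F m n (l + 1)
  map_add' F G := by ext m n; simp only [Pi.add_apply]; abel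
  map_smul' a F := by ext m n; simp [smul_sub]

variable {M}

theorem mulZU_eq : mulZU M = mulZW M + mulWU M := by
  ext F m n l
  simp [mulZU, mulZW, mulWU]

theorem mulWU_comm : Commute (mulZW M) (mulWU M) := by
  ext F m n l
  simp only [Module.End.mul_apply, mulZW, mulWU, LinearMap.coe_mk, AddHom.coe_mk]
  abel

theorem mulZU_comm : Commute (mulZU M) (mulWU M) := by
  rw [mulZU_eq]
  exact mulWU_comm.add_left (Commute.refl _)

theorem mulZU_comm' : Commute (mulZU M) (mulZW M) := by
  rw [mulZU_eq]
  exact (Commute.refl _).add_left mulWU_comm.symm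

theorem mulWU_pow_apply (N : ℕ) (F : ℤ → ℤ → ℤ → M) (m : ℤ) :
    (mulWU M ^ N) F m = (subMul M ^ N) (F m) := by
  induction N with
  | zero => rfl
  | succ N ih => ext n l; rw [pow_succ', pow_succ', Module.End.mul_apply, Module.End.mul_apply, ← ih]; rfl

theorem mulZU_pow_apply (N : ℕ) (F : ℤ → ℤ → ℤ → M) (m n l : ℤ) :
    (mulZU M ^ N) F m n l = (subMul M ^ N) (fun m l => F m n l) m l := by
  induction N generalizing m n l with
  | zero => rfl
  | succ N ih =>
    rw [pow_succ', pow_succ', Module.End.mul_apply, Module.End.mul_apply]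
    simp only [mulZU, LinearMap.coe_mk, AddHom.coe_mk, subMul_apply] at ih ⊢
    rw [ih, ih]

theorem mulZW_pow_apply (N : ℕ) (F : ℤ → ℤ → ℤ → M) (m n l : ℤ) :
    (mulZW M ^ N) F m n l = (subMul M ^ N) (fun m n => F m n l) m n := by
  induction N generalizing m n l with
  | zero => rfl
  | succ N ih =>
    rw [pow_succ', pow_succ', Module.End.mul_apply, Module.End.mul_apply]
    simp only [mulZW, LinearMap.coe_mk, AddHom.coe_mk, subMul_apply] at ih ⊢
    rw [ih, ih]

end ThreeVariables

/-! ### Restriction to the diagonal -/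

section Diagonal

variable {M : Type*} [AddCommGroup M] [Module ℂ M]

/-- Series with finitely many negative powers in both variables. -/
def IsBdd (F : ℤ → ℤ → M) : Prop := ∃ K : ℤ, ∀ m n, K ≤ m ∨ K ≤ n → F m n = 0

set_option linter.unusedSectionVars false in
theorem IsBdd.sub {F G : ℤ → ℤ → M} (hF : IsBdd F) (hG : IsBdd G) :
    IsBdd fun m n => F m n - G m n := by
  obtain ⟨K, hK⟩ := hF
  obtain ⟨K', hK'⟩ := hG
  refine ⟨max K K', fun m n hmn => ?_⟩
  simp only [hK m n (by lia), hK' m n (by lia), sub_zero]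

theorem IsBdd.subMul {F : ℤ → ℤ → M} (h : IsBdd F) : IsBdd (subMul M F) := by
  obtain ⟨K, hK⟩ := h
  refine ⟨K, fun m n hmn => ?_⟩
  rw [subMul_apply, hK (m + 1) n (by lia), hK m (n + 1) (by lia), sub_zero]

/-- The coefficients of `(∂_z^k F / k!)|_{z = w}`. -/
noncomputable def diag (k : ℕ) (F : ℤ → ℤ → M) (t : ℤ) : M :=
  ∑ᶠ m : ℤ, cbinom (-m - 1) k • F m (t - k - 1 - m)

/-- An antidiagonal meets the region of possibly non-zero coefficients in a finite set. This makes
the `finsum` in `diag` a genuine sum that may be split and reindexed. -/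
theorem IsBdd.finite_support {F : ℤ → ℤ → M} (h : IsBdd F) (c : ℤ → ℂ) (t : ℤ) :
    (Function.support fun m => c m • F m (t - m)).Finite := by
  obtain ⟨K, hK⟩ := h
  refine (Set.finite_Icc (t - K) K).subset fun m hm => ?_
  by_contra hm'
  simp only [Set.mem_Icc, not_and_or, not_le] at hm'
  exact hm (by simp [hK m (t - m) (by lia)])

/-- The factor `z - w` vanishes on the diagonal: the two sums along the antidiagonal differ by a
shift of the index. -/
theorem diag_subMul_zero {F : ℤ → ℤ → M} (h : IsBdd F) (t : ℤ) :
    diag 0 (subMul M F) t = 0 := by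
  have e : ∀ m : ℤ, cbinom (-m - 1) 0 • subMul M F m (t - (0 : ℕ) - 1 - m) =
      (1 : ℂ) • F (m + 1) (t - (m + 1)) - (1 : ℂ) • F m (t - m) := by
    intro m
    rw [subMul_apply, cbinom_zero, smul_sub]
    congr 3 <;> push_cast <;> ring
  rw [diag, finsum_congr e]
  have h1 := h.finite_support (fun _ => 1) t
  have h2 : (∑ᶠ m : ℤ, (1 : ℂ) • F (m + 1) (t - (m + 1))) = ∑ᶠ m : ℤ, (1 : ℂ) • F m (t - m) :=
    finsum_comp_equiv (Equiv.addRight (1 : ℤ)) (f := fun m => (1 : ℂ) • F m (t - m))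
  rw [finsum_sub_distrib _ h1, h2, sub_self]
  exact h1.preimage (f := fun m : ℤ => m + 1) (add_left_injective 1).injOn

/-- Leibniz rule: on the diagonal the factor `z - w` contributes only through its first derivative.
In coefficients this is Pascal's rule. -/
theorem diag_subMul_succ {F : ℤ → ℤ → M} (h : IsBdd F) (k : ℕ) (t : ℤ) :
    diag (k + 1) (subMul M F) t = diag k F t := by
  have e : ∀ m : ℤ, cbinom (-m - 1) (k + 1) • subMul M F m (t - (k + 1 : ℕ) - 1 - m) =
      cbinom (-(m + 1 : ℤ)) (k + 1) • F (m + 1) (t - k - 1 - (m + 1)) -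
        cbinom (-m - 1) (k + 1) • F m (t - k - 1 - m) := by
    intro m
    rw [subMul_apply, smul_sub]
    congr 2
    · push_cast; congr 1; ring
    · congr 1; push_cast; ring
    · congr 1; push_cast; ring
  rw [diag, finsum_congr e]
  have h1 := h.finite_support (fun m => cbinom (-m) (k + 1)) (t - k - 1)
  have h1' := h.finite_support (fun m => cbinom (-m - 1) (k + 1)) (t - k - 1)
  have h2 : (∑ᶠ m : ℤ, cbinom (-(m + 1 : ℤ)) (k + 1) • F (m + 1) (t - k - 1 - (m + 1))) =
      ∑ᶠ m : ℤ, cbinom (-m) (k + 1) • F m (t - k - 1 - m) :=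
    finsum_comp_equiv (Equiv.addRight (1 : ℤ))
      (f := fun m => cbinom (-m) (k + 1) • F m (t - k - 1 - m))
  rw [finsum_sub_distrib _ h1', h2, ← finsum_sub_distrib h1 h1', diag]
  · refine finsum_congr fun m => ?_
    have := cbinom_add_one (-m - 1) k
    rw [sub_add_cancel] at this
    rw [this]
    module
  · exact h1.preimage (f := fun m : ℤ => m + 1) (add_left_injective 1).injOn

theorem diag_sub {F G : ℤ → ℤ → M} (hF : IsBdd F) (hG : IsBdd G) (k : ℕ) (t : ℤ) :
    diag k (fun m n => F m n - G m n) t = diag k F t - diag k G t := by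
  simp only [diag, smul_sub]
  exact finsum_sub_distrib (hF.finite_support (fun m => cbinom (-m - 1) k) _)
    (hG.finite_support (fun m => cbinom (-m - 1) k) _)

theorem diag_shift (F : ℤ → ℤ → M) (k : ℕ) (t : ℤ) :
    diag k (fun m n => F m (n + 1)) t = diag k F (t + 1) := by
  simp only [diag]
  refine finsum_congr fun m => ?_
  congr 2
  ring

theorem diag_map {M' : Type*} [AddCommGroup M'] [Module ℂ M'] {F : ℤ → ℤ → M} (hF : IsBdd F)
    (f : M →ₗ[ℂ] M') (k : ℕ) (t : ℤ) :
    f (diag k F t) = diag k (fun m n => f (F m n)) t := by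
  have := f.toAddMonoidHom.map_finsum (hF.finite_support (fun m => cbinom (-m - 1) k) (t - k - 1))
  simpa [diag] using this

/-- Chain rule: the derivative of a restriction to the diagonal is the restriction of `∂_z + ∂_w`,
and the latter commutes with `∂_z^k`. -/
theorem diag_transl {F : ℤ → ℤ → M} (h : IsBdd F) (k : ℕ) (t : ℤ) :
    diag k (transl F) t = (-(t : ℂ)) • diag k F (t - 1) := by
  have e : ∀ m : ℤ, cbinom (-m - 1) k • transl F m (t - k - 1 - m) =
      (-((m : ℂ) * cbinom (-m - 1) k)) • F (m - 1) (t - k - 2 - (m - 1)) +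
        (-(((t : ℂ) - k - 1 - m) * cbinom (-m - 1) k)) • F m (t - k - 2 - m) := by
    intro m
    simp only [transl, smul_add, smul_smul]
    have e1 : t - k - 2 - (m - 1) = t - k - 1 - m := by ring
    have e2 : t - k - 1 - m - 1 = t - k - 2 - m := by ring
    rw [e1, e2]
    push_cast
    congr 2 <;> ring
  rw [diag, finsum_congr e]
  have h1 := h.finite_support (fun m => -((m + 1 : ℂ) * cbinom (-(m + 1) - 1) k)) (t - k - 2)
  have h1' := h.finite_support
    (fun m => -(((t : ℂ) - k - 1 - m) * cbinom (-m - 1) k)) (t - k - 2)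
  have h2 : (∑ᶠ m : ℤ, (-((m : ℂ) * cbinom (-m - 1) k)) • F (m - 1) (t - k - 2 - (m - 1))) =
      ∑ᶠ m : ℤ, (-((m + 1 : ℂ) * cbinom (-(m + 1) - 1) k)) • F m (t - k - 2 - m) := by
    rw [← finsum_comp_equiv (Equiv.addRight (1 : ℤ))]
    refine finsum_congr fun m => ?_
    simp only [Equiv.coe_addRight]
    push_cast
    rw [add_sub_cancel_right]
  rw [finsum_add_distrib _ h1', h2, ← finsum_add_distrib h1 h1', diag, smul_finsum]
  · refine finsum_congr fun m => ?_
    have := cbinom_sub_one_mul (-m - 1) k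
    have e1 : t - 1 - k - 1 - m = t - k - 2 - m := by ring
    have e2 : (-((m : ℂ) + 1) - 1) = -m - 1 - 1 := by ring
    rw [e1, smul_smul, ← add_smul, e2]
    congr 1
    linear_combination this
  · refine (h1.preimage (f := fun m : ℤ => m - 1) (sub_left_injective).injOn).subset fun m hm => ?_
    simpa [show -1 + (1 - (m : ℂ)) - 1 = -m - 1 by ring] using hm

end Diagonal

end FormalDist

/-! ### Fields, locality, uniqueness and Dong's lemma -/

namespace FormalSeries

open FormalDist

variable {V : Type*} [AddCommGroup V] [Module ℂ V]

/-- `A(z) v` is a Laurent series for every vector `v`. -/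
def IsField (A : FormalSeries V) : Prop := ∀ v, ∃ K : ℤ, ∀ n, K ≤ n → A n v = 0

/-- The coefficients of `A(z) B(w) - ε B(w) A(z)`. -/
def bracket (ε : ℂ) (A B : FormalSeries V) (m n : ℤ) : Module.End ℂ V :=
  A m * B n - ε • (B n * A m)

/-- `(z - w)^N (A(z) B(w) - ε B(w) A(z)) = 0` for large `N`. -/
def IsLocal (ε : ℂ) (A B : FormalSeries V) : Prop :=
  ∃ N : ℕ, (subMul _ ^ N) (bracket ε A B) = 0

theorem bracket_add_left (ε : ℂ) (A A' B : FormalSeries V) :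
    bracket ε (A + A') B = bracket ε A B + bracket ε A' B := by
  ext m n : 2
  simp only [bracket, Pi.add_apply, add_mul, mul_add, smul_add]
  abel

theorem bracket_smul_left (ε a : ℂ) (A B : FormalSeries V) :
    bracket ε (a • A) B = a • bracket ε A B := by
  ext m n : 2
  simp only [bracket, Pi.smul_apply, smul_mul_assoc, mul_smul_comm, smul_sub, smul_comm a]

theorem IsLocal.add {ε : ℂ} {A A' B : FormalSeries V} (h : IsLocal ε A B) (h' : IsLocal ε A' B) :
    IsLocal ε (A + A') B := by
  obtain ⟨N, hN⟩ := h
  obtain ⟨N', hN'⟩ := h'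
  refine ⟨max N N', ?_⟩
  rw [bracket_add_left, map_add, subMul_pow_eq_zero_of_le (le_max_left _ _) hN,
    subMul_pow_eq_zero_of_le (le_max_right _ _) hN', add_zero]

theorem IsLocal.smul {ε : ℂ} (a : ℂ) {A B : FormalSeries V} (h : IsLocal ε A B) :
    IsLocal ε (a • A) B := by
  obtain ⟨N, hN⟩ := h
  exact ⟨N, by rw [bracket_smul_left, map_smul, hN, smul_zero]⟩

theorem IsLocal.zero {ε : ℂ} {B : FormalSeries V} : IsLocal ε 0 B :=
  ⟨0, by ext m n : 2; simp [bracket]⟩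

theorem subMul_pow_swap {M : Type*} [AddCommGroup M] [Module ℂ M] (N : ℕ) (F : ℤ → ℤ → M)
    (m n : ℤ) : (subMul M ^ N) (fun m n => F n m) m n = (-1 : ℂ) ^ N • (subMul M ^ N) F n m := by
  induction N generalizing m n with
  | zero => simp
  | succ N ih =>
    rw [subMul_pow_succ, ih, ih, subMul_pow_succ, pow_succ]
    module

theorem IsLocal.symm {ε : ℂ} (hε : ε * ε = 1) {A B : FormalSeries V} (h : IsLocal ε A B) :
    IsLocal ε B A := by
  obtain ⟨N, hN⟩ := h
  refine ⟨N, ?_⟩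
  have e : bracket ε B A = (-ε) • fun m n => bracket ε A B n m := by
    ext m n : 2
    simp only [bracket, Pi.smul_apply, smul_sub, smul_smul, neg_mul, hε]
    module
  rw [e, map_smul]
  ext m n : 2
  rw [Pi.smul_apply, Pi.smul_apply, subMul_pow_swap, hN]
  simp

theorem IsLocal.sub_mul_apply {ε : ℂ} {A B : FormalSeries V} {N : ℕ}
    (h : (subMul _ ^ N) (bracket ε A B) = 0) (m n : ℤ) :
    (subMul _ ^ N) (fun m n => A m * B n) m n =
      ε • (subMul _ ^ N) (fun m n => B n * A m) m n := by
  have e : bracket ε A B = (fun m n => A m * B n) - ε • fun m n => B n * A m := rfl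
  rw [e, map_sub, map_smul] at h
  have := congr_fun₂ h m n
  simpa [sub_eq_zero] using this

/-- Uniqueness: a distribution that is local with respect to a generating family of fields
vanishes if it annihilates the vacuum. -/
theorem eq_zero_of_isLocal {ι : Type*} {g : ι → FormalSeries V} (hg : ∀ i, IsField (g i)) {Ω : V}
    (hcyc : ∀ W : Submodule ℂ V, Ω ∈ W → (∀ i n, ∀ x ∈ W, g i n x ∈ W) → W = ⊤)
    {ε : ι → ℂ} {D : FormalSeries V} (hD : ∀ i, IsLocal (ε i) D (g i)) (hΩ : ∀ n, D n Ω = 0) :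
    D = 0 := by
  -- For `x` in the common kernel, locality turns `(z - w)^N D(z) g(w) x` into a multiple of `(z -
  -- w)^N g(w) D(z) x = 0`. Since `g(w) x` is bounded, the factor `(z - w)^N` can be cancelled, so
  -- `g(w) x` lies in the kernel too.
  have key : (⨅ n, LinearMap.ker (D n)) = ⊤ := by
    refine hcyc _ (by simpa using hΩ) fun i n x hx => ?_
    simp only [Submodule.mem_iInf, LinearMap.mem_ker] at hx ⊢
    obtain ⟨N, hN⟩ := hD i
    obtain ⟨K, hK⟩ := hg i x
    have h0 : (subMul V ^ N) (fun m n => D m (g i n x)) = 0 := by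
      have h1 := subMul_pow_map (LinearMap.applyₗ (R := ℂ) x) N (fun m n => D m * g i n)
      have h2 := subMul_pow_map (LinearMap.applyₗ (R := ℂ) x) N (fun m n => g i n * D m)
      simp only [LinearMap.applyₗ_apply_apply, Module.End.mul_apply] at h1 h2
      rw [h1]
      ext m n
      rw [IsLocal.sub_mul_apply hN, LinearMap.smul_apply, ← congr_fun₂ h2 m n]
      simp only [hx, map_zero]
      rw [show (fun (_ _ : ℤ) => (0 : V)) = 0 from rfl, map_zero]
      simp
    have := eq_zero_of_subMul_pow_eq_zero (K := K) (fun m n hn => by simp [hK n hn]) h0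
    exact fun m => congr_fun₂ this m n
  ext n x
  have : x ∈ ⨅ n, LinearMap.ker (D n) := key ▸ Submodule.mem_top
  simp only [Submodule.mem_iInf, LinearMap.mem_ker] at this
  simpa using this n

/-! #### Products of fields -/

/-- Boundedness in `w` comes from `B(w) v`; boundedness in `z` comes from `A(z) v`, after locality
has exchanged the two fields. This is what permits setting `z = w`. -/
theorem isBdd_subMul_pow_mul {A B : FormalSeries V} (hA : IsField A) (hB : IsField B) {ε : ℂ}
    {N : ℕ} (hN : (subMul _ ^ N) (bracket ε A B) = 0) (v : V) :
    IsBdd fun m n => (subMul _ ^ N) (fun m n => A m * B n) m n v := by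
  obtain ⟨K, hK⟩ := hA v
  obtain ⟨K', hK'⟩ := hB v
  have h1 := subMul_pow_map (LinearMap.applyₗ (R := ℂ) v) N (fun m n => A m * B n)
  have h2 := subMul_pow_map (LinearMap.applyₗ (R := ℂ) v) N (fun m n => B n * A m)
  simp only [LinearMap.applyₗ_apply_apply, Module.End.mul_apply] at h1 h2
  refine ⟨max K K', fun m n h => ?_⟩
  beta_reduce
  rcases h with h | h
  · rw [IsLocal.sub_mul_apply hN, LinearMap.smul_apply, ← congr_fun₂ h2 m n,
      subMul_pow_eq_zero_of_le_left (K := K) _ N m n (by lia), smul_zero]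
    intro m n hm
    rw [hK m hm, map_zero]
  · rw [← congr_fun₂ h1 m n]
    exact subMul_pow_eq_zero_of_le_right (K := K')
      (fun m n hn => by rw [hK' n hn, map_zero]) N m n (by lia)

/-- `C` is the product `A₍ₙ₎B` with `n = N - 1 - k`, where `A` and `B` are local of order `N`:
the coefficient of `(z - w)^k` in `(z - w)^N A(z) B(w)`. -/
def IsProd (N k : ℕ) (A B C : FormalSeries V) : Prop :=
  ∀ t v, C t v = diag k (fun m n => (subMul _ ^ N) (fun m n => A m * B n) m n v) t

section Products

variable {A B C : FormalSeries V} {ε : ℂ} {N k : ℕ}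

theorem exists_isProd (hA : IsField A) (hB : IsField B)
    (hN : (subMul _ ^ N) (bracket ε A B) = 0) (k : ℕ) : ∃ C, IsProd N k A B C := by
  have hb := isBdd_subMul_pow_mul hA hB hN
  refine ⟨fun t => ⟨⟨fun v => diag k (fun m n => (subMul _ ^ N) (fun m n => A m * B n) m n v) t,
    fun v w => ?_⟩, fun a v => ?_⟩, fun t v => rfl⟩
  · simp only [map_add, diag, smul_add]
    exact finsum_add_distrib ((hb v).finite_support (fun m => cbinom (-m - 1) k) _)
      ((hb w).finite_support (fun m => cbinom (-m - 1) k) _)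
  · simp only [map_smul, diag, smul_finsum, RingHom.id_apply]
    exact finsum_congr fun m => smul_comm _ _ _

theorem IsProd.isField (h : IsProd N k A B C) (hA : IsField A) (hB : IsField B)
    (hN : (subMul _ ^ N) (bracket ε A B) = 0) : IsField C := by
  intro v
  obtain ⟨K, hK⟩ := isBdd_subMul_pow_mul hA hB hN v
  refine ⟨K + K + k + 1, fun t ht => ?_⟩
  rw [h t v, diag, finsum_eq_zero_of_forall_eq_zero]
  intro m
  simp only [hK m (t - k - 1 - m) (by lia), smul_zero]

theorem IsProd.mem_of_forall (h : IsProd N k A B C) {v : V} {W : Submodule ℂ V}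
    (hW : ∀ m n, A m (B n v) ∈ W) (t : ℤ) : C t v ∈ W := by
  rw [h t v, diag]
  refine finsum_induction (· ∈ W) W.zero_mem (fun _ _ => W.add_mem) fun m => ?_
  refine W.smul_mem _ ?_
  rw [subMul_pow_apply, LinearMap.sum_apply]
  exact W.sum_mem fun i _ => W.smul_mem _ (hW _ _)

/-- Leibniz rule for the commutator with `T`. -/
theorem comm_mul_eq_transl {T : Module.End ℂ V}
    (hTA : ∀ n, T * A n - A n * T = (-(n : ℂ)) • A (n - 1))
    (hTB : ∀ n, T * B n - B n * T = (-(n : ℂ)) • B (n - 1)) (m n : ℤ) :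
    T * (A m * B n) - (A m * B n) * T = transl (fun m n => A m * B n) m n := by
  simp only [transl]
  rw [← smul_mul_assoc, ← mul_smul_comm, ← hTA, ← hTB]
  noncomm_ring

theorem comm_subMul_pow_eq_transl {T : Module.End ℂ V} {F : ℤ → ℤ → Module.End ℂ V}
    (h : ∀ m n, T * F m n - F m n * T = transl F m n) (N : ℕ) (m n : ℤ) :
    T * (subMul _ ^ N) F m n - (subMul _ ^ N) F m n * T = transl ((subMul _ ^ N) F) m n := by
  have := subMul_pow_map (LinearMap.mulLeft ℂ T - LinearMap.mulRight ℂ T) N F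
  simp only [LinearMap.sub_apply, LinearMap.mulLeft_apply, LinearMap.mulRight_apply] at this
  rw [← congr_fun₂ this m n, funext₂ h, ← subMul_pow_transl]

theorem IsProd.translation (h : IsProd N k A B C) (hA : IsField A) (hB : IsField B)
    (hN : (subMul _ ^ N) (bracket ε A B) = 0) {T : Module.End ℂ V}
    (hTA : ∀ n, T * A n - A n * T = (-(n : ℂ)) • A (n - 1))
    (hTB : ∀ n, T * B n - B n * T = (-(n : ℂ)) • B (n - 1)) (t : ℤ) :
    T * C t - C t * T = (-(t : ℂ)) • C (t - 1) := by
  have hb := isBdd_subMul_pow_mul hA hB hN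
  ext v
  have key := comm_subMul_pow_eq_transl (comm_mul_eq_transl hTA hTB) N
  rw [LinearMap.sub_apply, LinearMap.smul_apply, Module.End.mul_apply, Module.End.mul_apply, h, h,
    h, diag_map (hb v), ← diag_sub, ← diag_transl (hb v)]
  · congr 1
    ext m n
    have := congr($(key m n) v)
    simpa [transl] using this
  · obtain ⟨K, hK⟩ := hb v
    exact ⟨K, fun m n hmn => by simp only [hK m n hmn, map_zero]⟩
  · exact hb _

/-- On the vacuum, `(z - w)^N A(z) B(w)` has no negative powers of `w`, and by locality none of `z`.
Its Taylor coefficients along the diagonal are then regular, and the value at the origin can be read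
off. -/
theorem IsProd.creation (h : IsProd N k A B C)
    (hN : (subMul _ ^ N) (bracket ε A B) = 0) {Ω : V} (hAΩ : ∀ n, 0 ≤ n → A n Ω = 0)
    (hBΩ : ∀ n, 0 ≤ n → B n Ω = 0) :
    (∀ t, 0 ≤ t → C t Ω = 0) ∧ C (-1) Ω = A (N - k - 1) (B (-1) Ω) := by
  have h1 := subMul_pow_map (LinearMap.applyₗ (R := ℂ) Ω) N (fun m n => A m * B n)
  have h2 := subMul_pow_map (LinearMap.applyₗ (R := ℂ) Ω) N (fun m n => B n * A m)
  simp only [LinearMap.applyₗ_apply_apply, Module.End.mul_apply] at h1 h2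
  have hz : ∀ m n : ℤ, 0 ≤ n → (subMul _ ^ N) (fun m n => A m * B n) m n Ω = 0 := by
    intro m n hn
    rw [← congr_fun₂ h1 m n]
    exact subMul_pow_eq_zero_of_le_right (K := 0)
      (fun m n hn => by rw [hBΩ n hn, map_zero]) N m n hn
  have hz' : ∀ m n : ℤ, 0 ≤ m → (subMul _ ^ N) (fun m n => A m * B n) m n Ω = 0 := by
    intro m n hm
    rw [IsLocal.sub_mul_apply hN, LinearMap.smul_apply, ← congr_fun₂ h2 m n,
      subMul_pow_eq_zero_of_le_left (K := 0) (fun m n hm => by rw [hAΩ m hm, map_zero]) N m n hm,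
      smul_zero]
  have hc : ∀ m : ℤ, m < 0 → -(k : ℤ) ≤ m → cbinom (-m - 1) k = 0 := by
    intro m hm hk
    obtain ⟨i, hi⟩ := Int.eq_ofNat_of_zero_le (a := -m - 1) (by lia)
    have : (-m - 1 : ℂ) = i := by exact_mod_cast hi
    rw [this]
    exact cbinom_natCast_of_lt (by lia)
  constructor
  · intro t ht
    rw [h t Ω, diag, finsum_eq_zero_of_forall_eq_zero]
    intro m
    by_cases hm : 0 ≤ m
    · rw [hz' _ _ hm, smul_zero]
    by_cases hk : -(k : ℤ) ≤ m
    · rw [hc m (by lia) hk, zero_smul]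
    · rw [hz _ _ (by lia), smul_zero]
  -- Regularity excludes `m ≥ 0` and `m < -k - 1`, and the binomial coefficient vanishes for `-k ≤ m
  -- < 0`; only `m = -k - 1` is left.
  · rw [h (-1) Ω, diag, finsum_eq_single _ (-(k : ℤ) - 1)]
    · have e : (-((-(k : ℤ) - 1 : ℤ) : ℂ) - 1) = k := by push_cast; ring
      rw [e, cbinom_natCast_self, one_smul, show (-1 : ℤ) - k - 1 - (-k - 1) = -1 by ring,
        ← congr_fun₂ h1 (-(k : ℤ) - 1) (-1), subMul_pow_apply, Finset.sum_eq_single 0]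
      · simp only [pow_zero, Nat.choose_zero_right, Nat.cast_one, one_mul, one_smul,
          Nat.cast_zero, add_zero, sub_zero]
        congr 2
        ring
      · intro i _ hi
        rw [hBΩ _ (by lia), map_zero, smul_zero]
      · simp
    · intro m hm
      by_cases hm0 : 0 ≤ m
      · rw [hz' _ _ hm0, smul_zero]
      by_cases hk : -(k : ℤ) ≤ m
      · rw [hc m (by lia) hk, zero_smul]
      · rw [hz _ _ (by lia), smul_zero]

end Products

/-! #### Dong's lemma -/

section Dong

variable {A B C D : FormalSeries V} {ε ε₁ ε₂ : ℂ} {N k p q : ℕ}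

/-- `[A(z) B(w), C(u)]` is `A(z) [B(w), C(u)] + ε₂ [A(z), C(u)] B(w)`; the first term is killed by
`(w - u)^q`, the second by `(z - u)^p`. -/
theorem mulWU_pow_mulZU_pow_eq_zero (hp : (subMul _ ^ p) (bracket ε₁ A C) = 0)
    (hq : (subMul _ ^ q) (bracket ε₂ B C) = 0) :
    (mulWU _ ^ q) ((mulZU _ ^ p)
      (fun m n l => (A m * B n) * C l - (ε₁ * ε₂) • (C l * (A m * B n)))) = 0 := by
  set F₁ : ℤ → ℤ → ℤ → Module.End ℂ V := fun m n l => A m * bracket ε₂ B C n l with hF₁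
  set F₂ : ℤ → ℤ → ℤ → Module.End ℂ V := fun m n l => bracket ε₁ A C m l * B n with hF₂
  have e : (fun m n l => (A m * B n) * C l - (ε₁ * ε₂) • (C l * (A m * B n))) =
      F₁ + ε₂ • F₂ := by
    ext m n l : 3
    simp only [hF₁, hF₂, bracket, Pi.add_apply, Pi.smul_apply, mul_sub, sub_mul, mul_smul_comm,
      smul_mul_assoc, mul_assoc]
    module
  have h₁ : (mulWU _ ^ q) F₁ = 0 := by
    ext m n l : 3
    have := subMul_pow_map (LinearMap.mulLeft ℂ (A m)) q (bracket ε₂ B C)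
    rw [mulWU_pow_apply]
    simp only [LinearMap.mulLeft_apply, hq] at this
    rw [hF₁, congr_fun₂ this n l]
    simp
  have h₂ : (mulZU _ ^ p) F₂ = 0 := by
    ext m n l : 3
    have := subMul_pow_map (LinearMap.mulRight ℂ (B n)) p (bracket ε₁ A C)
    rw [mulZU_pow_apply]
    simp only [LinearMap.mulRight_apply, hp] at this
    rw [hF₂, congr_fun₂ this m l]
    simp
  rw [e, map_add, map_add, map_smul, map_smul, h₂, map_zero, smul_zero, add_zero,
    ← Module.End.mul_apply, ← (mulZU_comm.pow_pow p q).eq, Module.End.mul_apply, h₁, map_zero]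

theorem mulWU_pow_mulZU_pow_swap_eq_zero (hp : (subMul _ ^ p) (bracket ε₁ A C) = 0)
    (hq : (subMul _ ^ q) (bracket ε₂ B C) = 0) :
    (mulWU _ ^ q) ((mulZU _ ^ p)
      (fun m n l => (B n * A m) * C l - (ε₁ * ε₂) • (C l * (B n * A m)))) = 0 := by
  set F₁ : ℤ → ℤ → ℤ → Module.End ℂ V := fun m n l => bracket ε₂ B C n l * A m with hF₁
  set F₂ : ℤ → ℤ → ℤ → Module.End ℂ V := fun m n l => B n * bracket ε₁ A C m l with hF₂
  have e : (fun m n l => (B n * A m) * C l - (ε₁ * ε₂) • (C l * (B n * A m))) =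
      ε₁ • F₁ + F₂ := by
    ext m n l : 3
    simp only [hF₁, hF₂, bracket, Pi.add_apply, Pi.smul_apply, mul_sub, sub_mul, mul_smul_comm,
      smul_mul_assoc, mul_assoc]
    module
  have h₁ : (mulWU _ ^ q) F₁ = 0 := by
    ext m n l : 3
    have := subMul_pow_map (LinearMap.mulRight ℂ (A m)) q (bracket ε₂ B C)
    rw [mulWU_pow_apply]
    simp only [LinearMap.mulRight_apply, hq] at this
    rw [hF₁, congr_fun₂ this n l]
    simp
  have h₂ : (mulZU _ ^ p) F₂ = 0 := by
    ext m n l : 3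
    have := subMul_pow_map (LinearMap.mulLeft ℂ (B n)) p (bracket ε₁ A C)
    rw [mulZU_pow_apply]
    simp only [LinearMap.mulLeft_apply, hp] at this
    rw [hF₂, congr_fun₂ this m l]
    simp
  rw [e, map_add, map_add, map_smul, map_smul, h₂, map_zero, add_zero,
    ← Module.End.mul_apply, ← (mulZU_comm.pow_pow p q).eq, Module.End.mul_apply, h₁, map_zero,
    smul_zero]

/-- The residue in `z` of `(z - w)^j [A(z), B(w)]`. -/
def resProd (ε : ℂ) (j : ℕ) (A B : FormalSeries V) : FormalSeries V :=
  fun t => (subMul _ ^ j) (bracket ε A B) 0 t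

/-- Dong's lemma for the products `A₍ⱼ₎B` with `j ≥ 0`. -/
theorem IsLocal.resProd (hAB : IsLocal ε A B) (hAC : IsLocal ε₁ A C) (hBC : IsLocal ε₂ B C)
    (j : ℕ) : IsLocal (ε₁ * ε₂) (resProd ε j A B) C := by
  obtain ⟨N, hN⟩ := hAB
  obtain ⟨p, hp⟩ := hAC
  obtain ⟨q, hq⟩ := hBC
  by_cases hj : N ≤ j
  · have : FormalSeries.resProd ε j A B = 0 := by
      ext t : 1
      rw [FormalSeries.resProd, subMul_pow_eq_zero_of_le hj hN]
      rfl
    rw [this]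
    exact IsLocal.zero
  obtain ⟨N, rfl⟩ := Nat.exists_eq_add_of_lt (lt_of_not_ge hj)
  set G : ℤ → ℤ → ℤ → Module.End ℂ V := fun m n l =>
    bracket ε A B m n * C l - (ε₁ * ε₂) • (C l * bracket ε A B m n) with hG
  have hGres : ∀ (i : ℕ) (n l : ℤ), (mulZW _ ^ i) G 0 n l =
      bracket (ε₁ * ε₂) (FormalSeries.resProd ε i A B) C n l := by
    intro i n l
    rw [mulZW_pow_apply]
    exact congr_fun₂ (subMul_pow_map (LinearMap.mulRight ℂ (C l) -
      (ε₁ * ε₂) • LinearMap.mulLeft ℂ (C l)) i (bracket ε A B)) 0 n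
  have hGS : (mulZW _ ^ (j + N + 1)) G = 0 := by
    ext m n l : 3
    rw [mulZW_pow_apply]
    have := congr_fun₂ (subMul_pow_map (LinearMap.mulRight ℂ (C l) -
      (ε₁ * ε₂) • LinearMap.mulLeft ℂ (C l)) (j + N + 1) (bracket ε A B)) m n
    refine this.trans ?_
    rw [hN]
    simp
  have hGZ : (mulWU _ ^ q) ((mulZU _ ^ p) G) = 0 := by
    have e : G = (fun m n l => (A m * B n) * C l - (ε₁ * ε₂) • (C l * (A m * B n))) -
        ε • fun m n l => (B n * A m) * C l - (ε₁ * ε₂) • (C l * (B n * A m)) := by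
      ext m n l : 3
      simp only [hG, bracket, Pi.sub_apply, Pi.smul_apply, mul_sub, sub_mul, mul_smul_comm,
        smul_mul_assoc]
      module
    rw [e, map_sub, map_sub, map_smul, map_smul, mulWU_pow_mulZU_pow_eq_zero hp hq,
      mulWU_pow_mulZU_pow_swap_eq_zero hp hq, smul_zero, sub_zero]
  -- `s k` is the residue in `z` of `(z - w)^(j + N - k) G`. The order of locality is now `j + N +
  -- 1`, so at `k = 0` one more factor `z - w` already gives zero, while `k = N` is the residue that
  -- is wanted.
  have key := pow_apply_eq_zero_of_recursion (E := ℤ → ℤ → ℤ → Module.End ℂ V)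
    (S := {G | (mulZW _ ^ (j + N + 1)) G = 0}) (f := mulZU _) (g := subMul (Module.End ℂ V))
    (s := fun k G n l => (mulZW _ ^ (j + N - k)) G 0 n l) (K := j + N + 1) (q := q)
    (Z := fun G => (mulWU _ ^ q) G = 0) ?_ ?_ ?_ ?_ p N (by lia) G hGS
    (by rwa [← Module.End.pow_apply])
  · refine ⟨q + p + N, ?_⟩
    rw [← key]
    congr 1
    ext n l : 2
    rw [Nat.add_sub_cancel, hGres]
  · intro G hG
    simp only [Set.mem_ofPred_eq] at hG ⊢
    rw [← Module.End.mul_apply, ← (mulZU_comm'.pow_right _).eq, Module.End.mul_apply, hG, map_zero]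
  · intro G hG
    ext n l : 2
    simp only [Set.mem_ofPred_eq] at hG
    simp only [Nat.sub_zero]
    rw [mulZU_eq, LinearMap.add_apply, map_add, ← Module.End.mul_apply, ← pow_succ, hG, zero_add,
      ← Module.End.mul_apply, (mulWU_comm.pow_left _).eq, Module.End.mul_apply]
    rfl
  · intro k hk G hG
    ext n l : 2
    rw [mulZU_eq, LinearMap.add_apply, map_add, ← Module.End.mul_apply, ← pow_succ,
      ← Module.End.mul_apply, (mulWU_comm.pow_left _).eq, Module.End.mul_apply,
      show j + N - (k + 1) + 1 = j + N - k by lia]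
    rfl
  · intro k hk G hG hZ
    change (subMul _ ^ q) ((mulZW _ ^ (j + N - k)) G 0) = 0
    rw [← mulWU_pow_apply, ← Module.End.mul_apply, ← (mulWU_comm.pow_pow _ _).eq,
      Module.End.mul_apply, hZ, map_zero]
    rfl

/-- The variable that survives the restriction `z = w` is `w`, so the factor `w - u` passes through
it. Boundedness is part of the induction because splitting `diag` over a difference requires it. -/
theorem diag_mulWU_pow {M : Type*} [AddCommGroup M] [Module ℂ M] (k q : ℕ)
    (G : ℤ → ℤ → ℤ → M) (hG : ∀ l, IsBdd fun m n => G m n l) :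
    (∀ l, IsBdd fun m n => (mulWU M ^ q) G m n l) ∧
    (fun t l => diag k (fun m n => (mulWU M ^ q) G m n l) t) =
      (subMul M ^ q) (fun t l => diag k (fun m n => G m n l) t) := by
  induction q with
  | zero => exact ⟨hG, rfl⟩
  | succ q ih =>
    have hs : ∀ l, IsBdd fun m n => (mulWU M ^ q) G m (n + 1) l := by
      intro l
      obtain ⟨K, hK⟩ := ih.1 l
      exact ⟨K, fun m n hmn => hK m (n + 1) (by lia)⟩
    rw [pow_succ', pow_succ', Module.End.mul_apply, Module.End.mul_apply, ← ih.2]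
    refine ⟨fun l => (hs l).sub (ih.1 (l + 1)), ?_⟩
    ext t l
    rw [subMul_apply, ← diag_shift, ← diag_sub (hs l) (ih.1 (l + 1))]
    rfl

/-- Dong's lemma. -/
theorem IsProd.isLocal (h : IsProd N k A B D) (hA : IsField A) (hB : IsField B)
    (hN : (subMul _ ^ N) (bracket ε A B) = 0) (hAC : IsLocal ε₁ A C) (hBC : IsLocal ε₂ B C) :
    IsLocal (ε₁ * ε₂) D C := by
  have hb := isBdd_subMul_pow_mul hA hB hN
  obtain ⟨p, hp⟩ := hAC
  obtain ⟨q, hq⟩ := hBC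
  set P := (subMul _ ^ N) (fun m n => A m * B n) with hP
  set F : ℤ → ℤ → ℤ → Module.End ℂ V := fun m n l =>
    P m n * C l - (ε₁ * ε₂) • (C l * P m n) with hF
  have hFZ : (mulWU _ ^ q) ((mulZU _ ^ p) F) = 0 := by
    have e : F = (mulZW _ ^ N)
        (fun m n l => (A m * B n) * C l - (ε₁ * ε₂) • (C l * (A m * B n))) := by
      ext m n l : 3
      rw [mulZW_pow_apply]
      exact (congr_fun₂ (subMul_pow_map (LinearMap.mulRight ℂ (C l) -
        (ε₁ * ε₂) • LinearMap.mulLeft ℂ (C l)) N (fun m n => A m * B n)) m n).symm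
    rw [e, ← Module.End.mul_apply, ← Module.End.mul_apply]
    have c1 : Commute (mulWU (Module.End ℂ V) ^ q * mulZU _ ^ p) (mulZW _ ^ N) :=
      ((mulWU_comm.symm.pow_pow _ _).mul_left (mulZU_comm'.pow_pow _ _))
    rw [c1.eq, Module.End.mul_apply, Module.End.mul_apply, mulWU_pow_mulZU_pow_eq_zero hp hq,
      map_zero]
  refine ⟨q + p + k, ?_⟩
  ext t l v
  set G : ℤ → ℤ → ℤ → V := fun m n l => F m n l v with hG
  have hGb : ∀ l, IsBdd fun m n => G m n l := by
    intro l
    have := (hb (C l v)).sub (G := fun m n => (ε₁ * ε₂) • C l (P m n v)) ?_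
    · exact this
    · obtain ⟨K, hK⟩ := hb v
      exact ⟨K, fun m n hmn => by simp only [hK m n hmn, map_zero, smul_zero]⟩
  have hGZ : (mulWU _ ^ q) ((mulZU _ ^ p) G) = 0 := by
    have e1 : ∀ F : ℤ → ℤ → ℤ → Module.End ℂ V, (mulZU V ^ p) (fun m n l => F m n l v) =
        fun m n l => (mulZU _ ^ p) F m n l v := by
      intro F
      ext m n l
      rw [mulZU_pow_apply, mulZU_pow_apply]
      exact congr_fun₂ (subMul_pow_map (LinearMap.applyₗ (R := ℂ) v) p _) m l
    have e2 : ∀ F : ℤ → ℤ → ℤ → Module.End ℂ V, (mulWU V ^ q) (fun m n l => F m n l v) =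
        fun m n l => (mulWU _ ^ q) F m n l v := by
      intro F
      ext m n l
      rw [mulWU_pow_apply, mulWU_pow_apply]
      exact congr_fun₂ (subMul_pow_map (LinearMap.applyₗ (R := ℂ) v) q _) n l
    rw [hG, e1, e2, hFZ]
    rfl
  -- Now `s k` is the `k`-th Taylor coefficient along `z = w`: a factor `z - w` lowers `k` by one
  -- and kills the coefficient `k = 0`.
  have key := pow_apply_eq_zero_of_recursion (E := ℤ → ℤ → ℤ → V)
    (S := {G | ∀ l, IsBdd fun m n => G m n l}) (f := mulZU _) (g := subMul V)
    (s := fun k G t l => diag k (fun m n => G m n l) t) (K := k + 1) (q := q)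
    (Z := fun G => (mulWU _ ^ q) G = 0) ?_ ?_ ?_ ?_ p k (by lia) G hGb
    (by rwa [← Module.End.pow_apply])
  · have e : (fun t l => diag k (fun m n => G m n l) t) =
        fun t l => bracket (ε₁ * ε₂) D C t l v := by
      ext t l
      simp only [hG, hF, bracket, LinearMap.sub_apply, Module.End.mul_apply, LinearMap.smul_apply]
      rw [h t (C l v), h t v, diag_map (hb v), diag_sub (hb (C l v))]
      · congr 1
        simp only [diag, smul_finsum]
        exact finsum_congr fun m => smul_comm _ _ _
      · obtain ⟨K, hK⟩ := hb v
        exact ⟨K, fun m n hmn => by simp only [hK m n hmn, map_zero, smul_zero]⟩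
    rw [e] at key
    have e2 := congr_fun₂ (subMul_pow_map (LinearMap.applyₗ (R := ℂ) v) (q + p + k)
      (bracket (ε₁ * ε₂) D C)) t l
    exact e2.symm.trans (congr_fun₂ key t l)
  · intro G hG l
    have h1 : IsBdd fun m n => G (m + 1) n l := by
      obtain ⟨K, hK⟩ := hG l
      exact ⟨K, fun m n hmn => hK _ _ (by lia)⟩
    exact h1.sub (hG (l + 1))
  · intro G hG
    ext t l
    have h1 := congr_fun₂ (diag_mulWU_pow 0 1 G hG).2 t l
    have h1b := (diag_mulWU_pow 0 1 G hG).1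
    simp only [pow_one] at h1 h1b
    rw [← h1, ← sub_eq_zero, ← diag_sub, ← diag_subMul_zero (hG l) t]
    · congr 1
      ext m n
      simp only [mulZU_eq, mulZW, LinearMap.add_apply, Pi.add_apply, add_sub_cancel_right]
      rfl
    · rw [mulZU_eq]
      have h3 := (hG l).subMul
      obtain ⟨K, hK⟩ := h3
      obtain ⟨K', hK'⟩ := h1b l
      refine ⟨max K K', fun m n hmn => ?_⟩
      have := hK m n (by lia)
      have := hK' m n (by lia)
      simp_all [mulZW]
    · exact h1b l
  · intro k hk G hG
    ext t l
    have h1 := congr_fun₂ (diag_mulWU_pow (k + 1) 1 G hG).2 t l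
    have h1b := (diag_mulWU_pow 0 1 G hG).1
    simp only [pow_one] at h1 h1b
    rw [Pi.add_apply, Pi.add_apply, ← h1, ← sub_eq_iff_eq_add, ← diag_sub,
      ← diag_subMul_succ (hG l) k t]
    · congr 1
      ext m n
      simp only [mulZU_eq, mulZW, LinearMap.add_apply, Pi.add_apply, add_sub_cancel_right]
      rfl
    · rw [mulZU_eq]
      have h3 := (hG l).subMul
      obtain ⟨K, hK⟩ := h3
      obtain ⟨K', hK'⟩ := h1b l
      refine ⟨max K K', fun m n hmn => ?_⟩
      have := hK m n (by lia)
      have := hK' m n (by lia)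
      simp_all [mulZW]
    · exact h1b l
  · intro k hk G hG hZ
    rw [← (diag_mulWU_pow k q G hG).2]
    ext t l
    simp only [hZ]
    simp [diag]

end Dong

end FormalSeries

/-! ### Generators, signs and uniform commutation relations -/

/-- The sign `(-1)^{ij}` of the supercommutator. -/
noncomputable def superSign (i j : ZMod 2) : ℂ := (-1) ^ (i.val * j.val)

theorem superSign_mul_self (i j : ZMod 2) : superSign i j * superSign i j = 1 := by
  rw [superSign, ← mul_pow]; simp

@[simp] theorem superSign_zero_left (i : ZMod 2) : superSign 0 i = 1 := by simp [superSign]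

@[simp] theorem superSign_zero_right (i : ZMod 2) : superSign i 0 = 1 := by simp [superSign]

@[simp] theorem superSign_one_one : superSign 1 1 = -1 := by
  simp [superSign, ZMod.val_one]

theorem superSign_comm (i j : ZMod 2) : superSign i j = superSign j i := by
  rw [superSign, superSign, mul_comm]

theorem ZMod.two_cases (i : ZMod 2) : i = 0 ∨ i = 1 := by
  revert i; decide

theorem superSign_add_left (i j k : ZMod 2) :
    superSign (i + j) k = superSign i k * superSign j k := by
  have h : (1 : ZMod 2) + 1 = 0 := by decide
  rcases i.two_cases with rfl | rfl <;> rcases j.two_cases with rfl | rfl <;>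
    rcases k.two_cases with rfl | rfl <;> simp [h]

namespace N2Gen

/-- Twice the `L₀`-weight of a generator. -/
def weight : N2Gen → ℤ
  | .L m => -2 * m
  | .J m => -2 * m
  | .G1 k => -(2 * k + 1)
  | .G2 k => -(2 * k + 1)

/-- This is the reason why the parity can be recovered from the spectrum of `L_0`. -/
theorem parity_eq_weight (g : N2Gen) : g.parity = (g.weight : ZMod 2) := by
  have h2 : (2 : ZMod 2) = 0 := rfl
  cases g <;> simp [parity, weight, h2]

end N2Gen

namespace N2Modes

section

variable {A : Type*}

/-- The element of the family attached to a generator. -/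
def op (X : N2Modes A) : N2Gen → A
  | .L m => X.L m
  | .J m => X.J m
  | .G1 k => X.G1 k
  | .G2 k => X.G2 k

variable [Ring A] [Algebra ℂ A] {X : N2Modes A} {c : ℂ}

theorem IsN2.comm_aux {ε : ℂ} {P Q R : A} {b : Prop} [Decidable b] {z : ℂ} {n : ℤ}
    (h : P - ε • Q = R + if b then algebraMap ℂ A z else 0) (hb : n ≠ 0 → ¬ b) :
    ∃ β : ℂ, P = ε • Q + R + β • 1 ∧ (n ≠ 0 → β = 0) := by
  refine ⟨if b then z else 0, ?_, fun hn => if_neg (hb hn)⟩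
  rw [sub_eq_iff_eq_add.mp h]
  split_ifs
  · rw [Algebra.algebraMap_eq_smul_one]; abel
  · rw [zero_smul]; abel

/-- The supercommutator of two generators is a multiple of a generator plus a scalar. -/
theorem IsN2.comm (hX : X.IsN2 c) (g h : N2Gen) : ∃ (g' : N2Gen) (α β : ℂ),
    X.op g * X.op h = superSign g.parity h.parity • (X.op h * X.op g) + α • X.op g' + β • 1 ∧
      g'.weight = g.weight + h.weight ∧ (g.weight + h.weight ≠ 0 → β = 0) := by
  have sub1 : ∀ {P Q R : A}, P - Q = R → P - (1 : ℂ) • Q = R := by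
    intro P Q R h; rwa [one_smul]
  have add1 : ∀ {P Q R : A}, P + Q = R → P - (-1 : ℂ) • Q = R := by
    intro P Q R h; rwa [neg_one_smul, sub_neg_eq_add]
  have swap : ∀ {g h : N2Gen} (_ : ∃ (g' : N2Gen) (α β : ℂ),
      X.op g * X.op h = superSign g.parity h.parity • (X.op h * X.op g) + α • X.op g' + β • 1 ∧
      g'.weight = g.weight + h.weight ∧ (g.weight + h.weight ≠ 0 → β = 0)),
      ∃ (g' : N2Gen) (α β : ℂ),
      X.op h * X.op g = superSign h.parity g.parity • (X.op g * X.op h) + α • X.op g' + β • 1 ∧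
      g'.weight = h.weight + g.weight ∧ (h.weight + g.weight ≠ 0 → β = 0) := by
    rintro g h ⟨g', α, β, h1, h2, h3⟩
    refine ⟨g', -superSign g.parity h.parity * α, -superSign g.parity h.parity * β, ?_,
      by rw [h2, add_comm], fun hn => by rw [h3 (by rwa [add_comm]), mul_zero]⟩
    rw [h1, superSign_comm h.parity, smul_add, smul_add, smul_smul, superSign_mul_self]
    module
  have gen : ∀ {g h g' : N2Gen} {ε α z : ℂ} {b : Prop} [Decidable b],
      X.op g * X.op h - ε • (X.op h * X.op g) =
        α • X.op g' + (if b then algebraMap ℂ A z else 0) → superSign g.parity h.parity = ε →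
      (g.weight + h.weight ≠ 0 → ¬ b) →
      g'.weight = g.weight + h.weight → ∃ (g' : N2Gen) (α β : ℂ),
      X.op g * X.op h = superSign g.parity h.parity • (X.op h * X.op g) + α • X.op g' + β • 1 ∧
      g'.weight = g.weight + h.weight ∧ (g.weight + h.weight ≠ 0 → β = 0) := by
    intro g h g' ε α z b _ h1 hε h2 h3
    obtain ⟨β, h4, h5⟩ := IsN2.comm_aux h1 h2
    exact ⟨g', α, β, by rw [hε, h4], h3, h5⟩
  have gen' : ∀ {g h g' : N2Gen} {ε α : ℂ},
      X.op g * X.op h - ε • (X.op h * X.op g) = α • X.op g' →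
      superSign g.parity h.parity = ε →
      g'.weight = g.weight + h.weight → ∃ (g' : N2Gen) (α β : ℂ),
      X.op g * X.op h = superSign g.parity h.parity • (X.op h * X.op g) + α • X.op g' + β • 1 ∧
      g'.weight = g.weight + h.weight ∧ (g.weight + h.weight ≠ 0 → β = 0) := by
    intro g h g' ε α h1 hε h2
    exact ⟨g', α, 0, by rw [zero_smul, add_zero, hε, sub_eq_iff_eq_add.mp h1, add_comm], h2,
      fun _ => rfl⟩
  have LJ := fun m n => gen' (g := .L m) (h := .J n) (g' := .J (m + n))
    (sub1 (hX.L_J m n)) (by simp [N2Gen.parity]) (by simp only [N2Gen.weight]; ring)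
  have LG1 := fun m n => gen' (g := .L m) (h := .G1 n) (g' := .G1 (m + n))
    (sub1 (hX.L_G1 m n)) (by simp [N2Gen.parity]) (by simp only [N2Gen.weight]; ring)
  have LG2 := fun m n => gen' (g := .L m) (h := .G2 n) (g' := .G2 (m + n))
    (sub1 (hX.L_G2 m n)) (by simp [N2Gen.parity]) (by simp only [N2Gen.weight]; ring)
  have G1J := fun m n => gen' (g := .G1 m) (h := .J n) (g' := .G2 (m + n))
    (sub1 (hX.G1_J m n)) (by simp [N2Gen.parity]) (by simp only [N2Gen.weight]; ring)
  have G2J := fun m n => gen' (g := .G2 m) (h := .J n) (g' := .G1 (m + n))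
    (sub1 (hX.G2_J m n)) (by simp [N2Gen.parity]) (by simp only [N2Gen.weight]; ring)
  have G1G2 := fun m n => gen' (g := .G1 m) (h := .G2 n) (g' := .J (m + n + 1))
    (add1 (hX.G1_G2 m n)) (by simp [N2Gen.parity]) (by simp only [N2Gen.weight]; ring)
  cases g with
  | L m =>
    cases h with
    | L n => exact gen (g' := .L (m + n)) (sub1 (hX.L_L m n))
               (by simp [N2Gen.parity]) (by simp only [N2Gen.weight]; lia)
               (by simp only [N2Gen.weight]; ring)
    | J n => exact LJ m n
    | G1 n => exact LG1 m n
    | G2 n => exact LG2 m n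
  | J m =>
    cases h with
    | L n => exact swap (LJ n m)
    | J n => exact gen (g' := .J (m + n)) (α := 0)
               (sub1 (by rw [zero_smul, zero_add]; exact hX.J_J m n)) (by simp [N2Gen.parity])
               (by simp only [N2Gen.weight]; lia) (by simp only [N2Gen.weight]; ring)
    | G1 n => exact swap (G1J n m)
    | G2 n => exact swap (G2J n m)
  | G1 m =>
    cases h with
    | L n => exact swap (LG1 n m)
    | J n => exact G1J m n
    | G1 n => exact gen (g' := .L (m + n + 1)) (add1 (hX.G1_G1 m n)) (by simp [N2Gen.parity])
               (by simp only [N2Gen.weight]; lia) (by simp only [N2Gen.weight]; ring)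
    | G2 n => exact G1G2 m n
  | G2 m =>
    cases h with
    | L n => exact swap (LG2 n m)
    | J n => exact G2J m n
    | G1 n => exact swap (G1G2 n m)
    | G2 n => exact gen (g' := .L (m + n + 1)) (add1 (hX.G2_G2 m n)) (by simp [N2Gen.parity])
               (by simp only [N2Gen.weight]; lia) (by simp only [N2Gen.weight]; ring)

theorem IsN2.L_zero_comm (hX : X.IsN2 c) (g : N2Gen) :
    X.L 0 * X.op g = X.op g * X.L 0 + ((g.weight : ℂ) / 2) • X.op g := by
  rw [← sub_eq_iff_eq_add']
  cases g with
  | L n =>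
    have := hX.L_L 0 n
    simp only [op, N2Gen.weight] at this ⊢
    rw [this]
    simp
    module
  | J n =>
    have := hX.L_J 0 n
    simp only [op, N2Gen.weight] at this ⊢
    rw [this, zero_add]
    push_cast
    module
  | G1 n =>
    have := hX.L_G1 0 n
    simp only [op, N2Gen.weight] at this ⊢
    rw [this, zero_add]
    push_cast
    module
  | G2 n =>
    have := hX.L_G2 0 n
    simp only [op, N2Gen.weight] at this ⊢
    rw [this, zero_add]
    push_cast
    module

end

end N2Modes

/-! ### The generating fields -/

/-- Labels of the four generating fields. -/
inductive N2Field
  | T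
  | J
  | G1
  | G2

/-- The parity of a generating field. -/
def N2Field.parity : N2Field → ZMod 2
  | .T => 0
  | .J => 0
  | .G1 => 1
  | .G2 => 1

/-- The generator that is the `n`-th mode of a generating field. -/
def N2Field.mode : N2Field → ℤ → N2Gen
  | .T, n => .L (n - 1)
  | .J, n => .J n
  | .G1, n => .G1 (n - 1)
  | .G2, n => .G2 (n - 1)

theorem N2Field.parity_mode (i : N2Field) (n : ℤ) : (i.mode n).parity = i.parity := by
  cases i <;> rfl

namespace N2Modes

variable {V : Type*} [AddCommGroup V] [Module ℂ V] {X : N2Modes (Module.End ℂ V)} {c : ℂ} {Ω : V}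

/-- The modes `A₍ₙ₎` of the generating fields. -/
def fld (X : N2Modes (Module.End ℂ V)) (i : N2Field) : FormalSeries V := fun n => X.op (i.mode n)

theorem exists_mode (g : N2Gen) : ∃ i n, g = N2Field.mode i n := by
  cases g with
  | L m => exact ⟨.T, m + 1, by simp [N2Field.mode]⟩
  | J m => exact ⟨.J, m, rfl⟩
  | G1 m => exact ⟨.G1, m + 1, by simp [N2Field.mode]⟩
  | G2 m => exact ⟨.G2, m + 1, by simp [N2Field.mode]⟩

theorem _root_.IsCyclicVector.eq_top_of_op (h : IsCyclicVector X Ω) {W : Submodule ℂ V}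
    (hΩ : Ω ∈ W) (hW : ∀ g, ∀ x ∈ W, X.op g x ∈ W) : W = ⊤ :=
  h W hΩ fun m x hx => ⟨hW (.L m) x hx, hW (.J m) x hx, hW (.G1 m) x hx, hW (.G2 m) x hx⟩

theorem _root_.IsCyclicVector.eq_top_of_fld (h : IsCyclicVector X Ω) {W : Submodule ℂ V}
    (hΩ : Ω ∈ W) (hW : ∀ i n, ∀ x ∈ W, X.fld i n x ∈ W) : W = ⊤ :=
  h.eq_top_of_op hΩ fun g x hx => by
    obtain ⟨i, n, rfl⟩ := exists_mode g
    exact hW i n x hx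

theorem _root_.IsLowestWeightVector.op_eq_zero (h : IsLowestWeightVector X Ω 0 0) {g : N2Gen}
    (hg : g.weight ≤ 0) : X.op g Ω = 0 := by
  cases g with
  | L m =>
    rcases (show 0 ≤ m by simp only [N2Gen.weight] at hg; lia).eq_or_lt with rfl | hm
    · simpa [op] using h.L_zero
    · exact h.L_pos m hm
  | J m =>
    rcases (show 0 ≤ m by simp only [N2Gen.weight] at hg; lia).eq_or_lt with rfl | hm
    · simpa [op] using h.J_zero
    · exact h.J_pos m hm
  | G1 m => exact h.G1_pos m (by simp only [N2Gen.weight] at hg; lia)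
  | G2 m => exact h.G2_pos m (by simp only [N2Gen.weight] at hg; lia)

/-- Modes of sufficiently negative weight annihilate a given vector. -/
theorem exists_op_eq_zero (hX : X.IsN2 c) (hΩ : IsLowestWeightVector X Ω 0 0)
    (hcyc : IsCyclicVector X Ω) (v : V) : ∃ K : ℕ, ∀ g : N2Gen, g.weight ≤ -K → X.op g v = 0 := by
  let W : Submodule ℂ V :=
    { carrier := {v | ∃ K : ℕ, ∀ g : N2Gen, g.weight ≤ -K → X.op g v = 0}
      add_mem' := by
        rintro v w ⟨K, hK⟩ ⟨K', hK'⟩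
        exact ⟨K + K', fun g hg => by
          rw [map_add, hK g (by push_cast at hg; lia), hK' g (by push_cast at hg; lia), add_zero]⟩
      zero_mem' := ⟨0, fun g _ => map_zero _⟩
      smul_mem' := by
        rintro a v ⟨K, hK⟩
        exact ⟨K, fun g hg => by rw [map_smul, hK g hg, smul_zero]⟩ }
  have : W = ⊤ := by
    refine hcyc.eq_top_of_op ⟨0, fun g hg => hΩ.op_eq_zero (by simpa using hg)⟩ ?_
    rintro h v ⟨K, hK⟩
    -- The margin `|weight h|` keeps the generator in the commutator at or below weight `-K`; the
    -- additional `1` makes the total weight non-zero, so that there is no central term.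
    refine ⟨K + h.weight.natAbs + 1, fun g hg => ?_⟩
    obtain ⟨g', α, β, h1, h2, h3⟩ := hX.comm g h
    rw [← Module.End.mul_apply, h1, h3 (by omega)]
    simp [hK g (by omega), hK g' (by omega)]
  have hv : v ∈ W := by rw [this]; trivial
  exact hv

theorem fld_isField (hX : X.IsN2 c) (hΩ : IsLowestWeightVector X Ω 0 0)
    (hcyc : IsCyclicVector X Ω) (i : N2Field) : (X.fld i).IsField := by
  intro v
  obtain ⟨K, hK⟩ := exists_op_eq_zero hX hΩ hcyc v
  refine ⟨K + 1, fun n hn => hK _ ?_⟩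
  cases i <;> simp only [N2Field.mode, N2Gen.weight] <;> lia

open FormalDist FormalSeries

/-- Along an antidiagonal `m + n` is fixed, and multiplication by `(z - w)^4` takes a fourth finite
difference in `m`, which kills cubic polynomials. The Virasoro central term is the case of degree
three. -/
theorem isLocal_of_cubic {ε : ℂ} {A B : FormalSeries V} (u : ℕ → ℤ → Module.End ℂ V)
    (h : ∀ m n, bracket ε A B m n = ∑ i ∈ Finset.range 4, (m : ℂ) ^ i • u i (m + n)) :
    IsLocal ε A B := by
  refine ⟨4, ?_⟩
  ext m n : 2
  rw [subMul_pow_apply]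
  have e : ∀ k : ℤ, m + (4 : ℕ) - k + (n + k) = m + n + 4 := fun k => by push_cast; ring
  simp only [h, e, Finset.sum_range_succ, Finset.sum_range_zero]
  simp only [Nat.choose, Nat.cast_ofNat]
  push_cast
  rw [Pi.zero_apply, Pi.zero_apply]
  module

theorem isLocal_of_linear {ε : ℂ} {A B : FormalSeries V} {u : ℤ → Module.End ℂ V} (a b d : ℂ)
    (h : ∀ m n, bracket ε A B m n = (a * m + b * n + d) • u (m + n)) : IsLocal ε A B := by
  refine isLocal_of_cubic (fun i s => match i with
    | 0 => (b * s + d) • u s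
    | 1 => (a - b) • u s
    | _ => 0) fun m n => ?_
  rw [h]
  simp only [Finset.sum_range_succ, Finset.sum_range_zero]
  push_cast
  module

theorem fld_isLocal (hX : X.IsN2 c) (i j : N2Field) :
    IsLocal (superSign i.parity j.parity) (X.fld i) (X.fld j) := by
  have swap : ∀ {i j : N2Field}, IsLocal (superSign i.parity j.parity) (X.fld i) (X.fld j) →
      IsLocal (superSign j.parity i.parity) (X.fld j) (X.fld i) := fun {i j} h => by
    rw [superSign_comm]; exact h.symm (superSign_mul_self _ _)
  have TT : IsLocal (superSign 0 0) (X.fld .T) (X.fld .T) := by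
    refine isLocal_of_cubic (fun i s => match i with
      | 0 => (-(s : ℂ)) • X.L (s - 2)
      | 1 => (2 : ℂ) • X.L (s - 2) + if s - 2 = 0 then (c / 12 * 2) • 1 else 0
      | 2 => if s - 2 = 0 then (c / 12 * -3) • 1 else 0
      | _ => if s - 2 = 0 then (c / 12) • 1 else 0) fun m n => ?_
    have := hX.L_L (m - 1) (n - 1)
    simp only [bracket, fld, op, N2Field.mode, superSign_zero_left, one_smul, this,
      Finset.sum_range_succ, Finset.sum_range_zero, Algebra.algebraMap_eq_smul_one]
    rw [show m - 1 + (n - 1) = m + n - 2 by ring]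
    split_ifs <;> push_cast <;> module
  have TJ : IsLocal (superSign 0 0) (X.fld .T) (X.fld .J) := by
    refine isLocal_of_linear (u := fun s => X.J (s - 1)) 0 (-1) 0 fun m n => ?_
    have := hX.L_J (m - 1) n
    simp only [bracket, fld, op, N2Field.mode, superSign_zero_left, one_smul, this]
    rw [show m - 1 + n = m + n - 1 by ring]
    module
  have TG1 : IsLocal (superSign 0 1) (X.fld .T) (X.fld .G1) := by
    refine isLocal_of_linear (u := fun s => X.G1 (s - 2)) (1 / 2) (-1) 0 fun m n => ?_
    have := hX.L_G1 (m - 1) (n - 1)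
    simp only [bracket, fld, op, N2Field.mode, superSign_zero_left, one_smul, this]
    rw [show m - 1 + (n - 1) = m + n - 2 by ring]
    push_cast
    module
  have TG2 : IsLocal (superSign 0 1) (X.fld .T) (X.fld .G2) := by
    refine isLocal_of_linear (u := fun s => X.G2 (s - 2)) (1 / 2) (-1) 0 fun m n => ?_
    have := hX.L_G2 (m - 1) (n - 1)
    simp only [bracket, fld, op, N2Field.mode, superSign_zero_left, one_smul, this]
    rw [show m - 1 + (n - 1) = m + n - 2 by ring]
    push_cast
    module
  have JJ : IsLocal (superSign 0 0) (X.fld .J) (X.fld .J) := by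
    refine isLocal_of_linear (u := fun s => if s = 0 then (c / 3) • 1 else 0) 1 0 0 fun m n => ?_
    have := hX.J_J m n
    simp only [bracket, fld, op, N2Field.mode, superSign_zero_left, one_smul, this,
      Algebra.algebraMap_eq_smul_one]
    split_ifs <;> module
  have G1J : IsLocal (superSign 1 0) (X.fld .G1) (X.fld .J) := by
    refine isLocal_of_linear (u := fun s => X.G2 (s - 1)) 0 0 (-Complex.I) fun m n => ?_
    have := hX.G1_J (m - 1) n
    simp only [bracket, fld, op, N2Field.mode, superSign_zero_right, one_smul, this]
    rw [show m - 1 + n = m + n - 1 by ring]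
    module
  have G2J : IsLocal (superSign 1 0) (X.fld .G2) (X.fld .J) := by
    refine isLocal_of_linear (u := fun s => X.G1 (s - 1)) 0 0 Complex.I fun m n => ?_
    have := hX.G2_J (m - 1) n
    simp only [bracket, fld, op, N2Field.mode, superSign_zero_right, one_smul, this]
    rw [show m - 1 + n = m + n - 1 by ring]
    module
  have G1G2 : IsLocal (superSign 1 1) (X.fld .G1) (X.fld .G2) := by
    refine isLocal_of_linear (u := fun s => X.J (s - 1)) Complex.I (-Complex.I) 0 fun m n => ?_
    have := hX.G1_G2 (m - 1) (n - 1)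
    simp only [bracket, fld, op, N2Field.mode, superSign_one_one, neg_one_smul, sub_neg_eq_add,
      this]
    rw [show m - 1 + (n - 1) + 1 = m + n - 1 by ring]
    push_cast
    module
  have G1G1 : IsLocal (superSign 1 1) (X.fld .G1) (X.fld .G1) := by
    refine isLocal_of_cubic (fun i s => match i with
      | 0 => (2 : ℂ) • X.L (s - 1)
      | 1 => if s - 1 = 0 then (c / 3 * -1) • 1 else 0
      | 2 => if s - 1 = 0 then (c / 3) • 1 else 0
      | _ => 0) fun m n => ?_
    have := hX.G1_G1 (m - 1) (n - 1)
    simp only [bracket, fld, op, N2Field.mode, superSign_one_one, neg_one_smul, sub_neg_eq_add,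
      this, Finset.sum_range_succ, Finset.sum_range_zero, Algebra.algebraMap_eq_smul_one]
    rw [show m - 1 + (n - 1) + 1 = m + n - 1 by ring]
    split_ifs <;> push_cast <;> module
  have G2G2 : IsLocal (superSign 1 1) (X.fld .G2) (X.fld .G2) := by
    refine isLocal_of_cubic (fun i s => match i with
      | 0 => (2 : ℂ) • X.L (s - 1)
      | 1 => if s - 1 = 0 then (c / 3 * -1) • 1 else 0
      | 2 => if s - 1 = 0 then (c / 3) • 1 else 0
      | _ => 0) fun m n => ?_
    have := hX.G2_G2 (m - 1) (n - 1)
    simp only [bracket, fld, op, N2Field.mode, superSign_one_one, neg_one_smul, sub_neg_eq_add,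
      this, Finset.sum_range_succ, Finset.sum_range_zero, Algebra.algebraMap_eq_smul_one]
    rw [show m - 1 + (n - 1) + 1 = m + n - 1 by ring]
    split_ifs <;> push_cast <;> module
  cases i <;> cases j
  exacts [TT, TJ, TG1, TG2, swap TJ, JJ, swap G1J, swap G2J, swap TG1, G1J, G1G1, G1G2,
    swap TG2, G2J, swap G1G2, G2G2]

theorem fld_translation (hX : X.IsN2 c) (i : N2Field) (n : ℤ) :
    X.L (-1) * X.fld i n - X.fld i n * X.L (-1) = (-(n : ℂ)) • X.fld i (n - 1) := by
  cases i with
  | T =>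
    have := hX.L_L (-1) (n - 1)
    simp only [fld, op, N2Field.mode, this]
    rw [show -1 + (n - 1) = n - 1 - 1 by ring,
      show c * (((-1 : ℤ) : ℂ) ^ 3 - ((-1 : ℤ) : ℂ)) / 12 = 0 by push_cast; ring, map_zero, ite_self]
    push_cast
    module
  | J =>
    have := hX.L_J (-1) n
    simp only [fld, op, N2Field.mode, this]
    rw [show -1 + n = n - 1 by ring]
  | G1 =>
    have := hX.L_G1 (-1) (n - 1)
    simp only [fld, op, N2Field.mode, this]
    rw [show -1 + (n - 1) = n - 1 - 1 by ring]
    push_cast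
    module
  | G2 =>
    have := hX.L_G2 (-1) (n - 1)
    simp only [fld, op, N2Field.mode, this]
    rw [show -1 + (n - 1) = n - 1 - 1 by ring]
    push_cast
    module

end N2Modes

/-! ### Lowest weight modules: words and weights -/

namespace N2Modes

open Polynomial

variable {V : Type*} [AddCommGroup V] [Module ℂ V] {X : N2Modes (Module.End ℂ V)} {c : ℂ} {Ω : V}

/-- The vector `g₁ ⋯ gₛ Ω` for a word `g₁ ⋯ gₛ` in the generators. -/
def word (X : N2Modes (Module.End ℂ V)) (Ω : V) (w : List N2Gen) : V := (w.map X.op).prod Ω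

@[simp] theorem word_nil : X.word Ω [] = Ω := rfl

@[simp] theorem word_cons (g : N2Gen) (w : List N2Gen) :
    X.word Ω (g :: w) = X.op g (X.word Ω w) := by
  simp [word]

/-- Twice the `L₀`-weight of a word. -/
def wordWeight (w : List N2Gen) : ℤ := (w.map N2Gen.weight).sum

@[simp] theorem wordWeight_nil : wordWeight [] = 0 := rfl

@[simp] theorem wordWeight_cons (g : N2Gen) (w : List N2Gen) :
    wordWeight (g :: w) = g.weight + wordWeight w := by
  simp [wordWeight]

/-- The words in generators with property `cr` span, if all other generators annihilate `Ω`. -/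
theorem span_word_eq_top (hX : X.IsN2 c) (hcyc : IsCyclicVector X Ω) {cr : N2Gen → Prop}
    (hcr : ∀ g, ¬ cr g → X.op g Ω = 0) :
    Submodule.span ℂ {x | ∃ w : List N2Gen, (∀ g ∈ w, cr g) ∧ X.word Ω w = x} = ⊤ := by
  set W := Submodule.span ℂ {x | ∃ w : List N2Gen, (∀ g ∈ w, cr g) ∧ X.word Ω w = x} with hW
  have hcrW : ∀ g, cr g → ∀ x ∈ W, X.op g x ∈ W := by
    intro g hg x hx
    induction hx using Submodule.span_induction with
    | mem x hx =>
      obtain ⟨w, hw, rfl⟩ := hx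
      refine Submodule.subset_span ⟨g :: w, ?_, word_cons g w⟩
      simpa [hg] using hw
    | zero => simp
    | add x y _ _ h1 h2 => rw [map_add]; exact W.add_mem h1 h2
    | smul a x _ h => rw [map_smul]; exact W.smul_mem a h
  -- Move `g` to the right past the first letter: the commutator terms involve only a shorter word,
  -- with a possibly different generator, and at `Ω` a generator without `cr` acts by zero.
  have hw : ∀ w : List N2Gen, (∀ g ∈ w, cr g) → ∀ g, X.op g (X.word Ω w) ∈ W := by
    intro w
    induction w with
    | nil =>
      intro _ g
      by_cases hg : cr g
      · exact hcrW g hg _ (Submodule.subset_span ⟨[], by simp, rfl⟩)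
      · rw [word_nil, hcr g hg]; exact W.zero_mem
    | cons h w ih =>
      intro hw g
      have hw' : ∀ g ∈ w, cr g := fun g hg => hw g (List.mem_cons_of_mem _ hg)
      obtain ⟨g', α, β, e, -, -⟩ := hX.comm g h
      rw [word_cons, ← Module.End.mul_apply, e]
      simp only [LinearMap.add_apply, LinearMap.smul_apply, Module.End.mul_apply,
        Module.End.one_apply]
      exact W.add_mem (W.add_mem (W.smul_mem _ (hcrW h (hw h (by simp)) _ (ih hw' g)))
        (W.smul_mem _ (ih hw' g'))) (W.smul_mem _ (Submodule.subset_span ⟨w, hw', rfl⟩))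
  refine hcyc.eq_top_of_op (Submodule.subset_span ⟨[], by simp, rfl⟩) fun g x hx => ?_
  induction hx using Submodule.span_induction with
  | mem x hx =>
    obtain ⟨w, hw', rfl⟩ := hx
    exact hw w hw' g
  | zero => simp
  | add x y _ _ h1 h2 => rw [map_add]; exact W.add_mem h1 h2
  | smul a x _ h => rw [map_smul]; exact W.smul_mem a h

theorem op_mem_eigenspace (hX : X.IsN2 c) (g : N2Gen) {μ : ℂ} {x : V}
    (hx : x ∈ (X.L 0).eigenspace μ) : X.op g x ∈ (X.L 0).eigenspace (μ + g.weight / 2) := by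
  rw [Module.End.mem_eigenspace_iff] at hx ⊢
  rw [← Module.End.mul_apply, hX.L_zero_comm g]
  simp only [LinearMap.add_apply, LinearMap.smul_apply, Module.End.mul_apply, hx, map_smul]
  module

theorem word_mem_eigenspace (hX : X.IsN2 c) (hΩ : X.L 0 Ω = 0) (w : List N2Gen) :
    X.word Ω w ∈ (X.L 0).eigenspace (wordWeight w / 2) := by
  induction w with
  | nil => simp [hΩ]
  | cons g w ih =>
    have := op_mem_eigenspace hX g ih
    rw [word_cons, wordWeight_cons]
    convert this using 2
    push_cast
    ring

/-- The span of the words of weight `μ` in generators with property `cr`. -/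
def wordSpan (X : N2Modes (Module.End ℂ V)) (Ω : V) (cr : N2Gen → Prop) (μ : ℂ) :
    Submodule ℂ V :=
  Submodule.span ℂ {x | ∃ w : List N2Gen, (∀ g ∈ w, cr g) ∧ (wordWeight w : ℂ) / 2 = μ ∧
    X.word Ω w = x}

theorem aeval_apply_of_mem_eigenspace {f : Module.End ℂ V} {μ : ℂ} {x : V}
    (hx : x ∈ f.eigenspace μ) (p : ℂ[X]) : aeval f p x = p.eval μ • x := by
  rw [Module.End.mem_eigenspace_iff] at hx
  by_cases h : x = 0
  · simp [h]
  · exact Module.End.aeval_apply_of_hasEigenvector ⟨Module.End.mem_eigenspace_iff.mpr hx, h⟩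

/-- A polynomial in `L₀` maps a given vector into a given weight space, acting on that weight
space by a non-zero scalar. -/
theorem exists_aeval_mem_wordSpan (hX : X.IsN2 c) (hcyc : IsCyclicVector X Ω) (hΩ : X.L 0 Ω = 0)
    {cr : N2Gen → Prop} (hcr : ∀ g, ¬ cr g → X.op g Ω = 0) (μ : ℂ) (x : V) :
    ∃ p : ℂ[X], p.eval μ ≠ 0 ∧ aeval (X.L 0) p x ∈ wordSpan X Ω cr μ := by
  have hL : ∀ y ∈ wordSpan X Ω cr μ, ∀ p : ℂ[X], aeval (X.L 0) p y = p.eval μ • y := by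
    intro y hy p
    have hy' : y ∈ (X.L 0).eigenspace μ := by
      refine Submodule.span_le.mpr ?_ hy
      rintro _ ⟨w, -, h, rfl⟩
      exact h ▸ word_mem_eigenspace hX hΩ w
    exact aeval_apply_of_mem_eigenspace hy' p
  have hx : x ∈ Submodule.span ℂ {x | ∃ w : List N2Gen, (∀ g ∈ w, cr g) ∧ X.word Ω w = x} := by
    rw [span_word_eq_top hX hcyc hcr]; trivial
  induction hx using Submodule.span_induction with
  | mem x hx =>
    obtain ⟨w, hw, rfl⟩ := hx
    by_cases h : (wordWeight w : ℂ) / 2 = μ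
    · exact ⟨1, by simp, by
        rw [map_one, Module.End.one_apply]; exact Submodule.subset_span ⟨w, hw, h, rfl⟩⟩
    -- This linear factor kills a word of the wrong weight. Products of such factors serve for sums,
    -- without any need to know that `L_0` is diagonalizable.
    · refine ⟨Polynomial.X - C ((wordWeight w : ℂ) / 2), by simpa [sub_eq_zero] using Ne.symm h, ?_⟩
      have := word_mem_eigenspace hX hΩ w
      rw [Module.End.mem_eigenspace_iff] at this
      simp [this, Module.algebraMap_end_apply]
  | zero => exact ⟨1, by simp, by simp⟩
  | add x y _ _ hx hy =>
    obtain ⟨p, hp, hp'⟩ := hx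
    obtain ⟨q, hq, hq'⟩ := hy
    refine ⟨p * q, by simp [hp, hq], ?_⟩
    rw [map_add]
    refine Submodule.add_mem _ ?_ ?_
    · rw [mul_comm, map_mul, Module.End.mul_apply, hL _ hp']
      exact Submodule.smul_mem _ _ hp'
    · rw [map_mul, Module.End.mul_apply, hL _ hq']
      exact Submodule.smul_mem _ _ hq'
  | smul a x _ hx =>
    obtain ⟨p, hp, hp'⟩ := hx
    exact ⟨p, hp, by rw [map_smul]; exact Submodule.smul_mem _ _ hp'⟩

/-- A suitable polynomial in `L_0` moves an eigenvector into the span of words of its weight, but on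
the eigenvector it is a non-zero scalar, so the vector was there already. -/
theorem eigenspace_eq_wordSpan (hX : X.IsN2 c) (hcyc : IsCyclicVector X Ω) (hΩ : X.L 0 Ω = 0)
    {cr : N2Gen → Prop} (hcr : ∀ g, ¬ cr g → X.op g Ω = 0) (μ : ℂ) :
    (X.L 0).eigenspace μ = wordSpan X Ω cr μ := by
  apply le_antisymm
  · intro x hx
    obtain ⟨p, hp, hp'⟩ := exists_aeval_mem_wordSpan hX hcyc hΩ hcr μ x
    rw [aeval_apply_of_mem_eigenspace hx] at hp'
    exact ((wordSpan X Ω cr μ).smul_mem_iff hp).mp hp'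
  · refine Submodule.span_le.mpr ?_
    rintro _ ⟨w, -, h, rfl⟩
    exact h ▸ word_mem_eigenspace hX hΩ w

theorem _root_.IsLowestWeightVector.L_zero' (h : IsLowestWeightVector X Ω 0 0) : X.L 0 Ω = 0 := by
  simpa using h.L_zero

theorem wordWeight_nonneg {w : List N2Gen} (hw : ∀ g ∈ w, 0 < g.weight) :
    (w.length : ℤ) ≤ wordWeight w := by
  induction w with
  | nil => simp
  | cons g w ih =>
    have h1 := ih fun g hg => hw g (List.mem_cons_of_mem _ hg)
    have h2 := hw g (by simp)
    simp only [wordWeight_cons, List.length_cons]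
    push_cast
    lia

theorem weight_le_wordWeight {w : List N2Gen} (hw : ∀ g ∈ w, 0 < g.weight) {g : N2Gen}
    (hg : g ∈ w) : g.weight ≤ wordWeight w := by
  induction w with
  | nil => simp at hg
  | cons h w ih =>
    have hw' : ∀ g ∈ w, 0 < g.weight := fun g hg => hw g (List.mem_cons_of_mem _ hg)
    have h2 := hw h (by simp)
    have h3 := wordWeight_nonneg hw'
    rw [wordWeight_cons]
    rcases List.mem_cons.mp hg with rfl | hg
    · lia
    · have := ih hw' hg
      lia

/-- All letters have weight at least `1`, so `k` bounds both the length of the word and the weight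
of each letter. -/
theorem finite_setOf_word (k : ℤ) :
    {w : List N2Gen | (∀ g ∈ w, 0 < g.weight) ∧ wordWeight w = k}.Finite := by
  set s : Set N2Gen := {g | 0 < g.weight ∧ g.weight ≤ k} with hs
  have hfin : s.Finite := by
    refine (((Set.finite_Icc (-k) k).image N2Gen.L).union <|
      ((Set.finite_Icc (-k) k).image N2Gen.J).union <|
      ((Set.finite_Icc (-k) k).image N2Gen.G1).union <|
      ((Set.finite_Icc (-k) k).image N2Gen.G2)).subset ?_
    rintro (m | m | m | m) ⟨h1, h2⟩ <;> simp only [N2Gen.weight] at h1 h2 <;>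
      simp only [Set.mem_union, Set.mem_image, Set.mem_Icc, N2Gen.L.injEq, N2Gen.J.injEq,
        N2Gen.G1.injEq, N2Gen.G2.injEq, reduceCtorEq, and_false, exists_false, or_false, false_or,
        exists_eq_right] <;> lia
  have : Finite s := hfin
  refine ((List.finite_length_le s k.toNat).image (List.map Subtype.val)).subset ?_
  rintro w ⟨hw, rfl⟩
  refine ⟨w.attach.map fun g => ⟨g.1, hw g.1 g.2, weight_le_wordWeight hw g.2⟩, ?_, ?_⟩
  · have := wordWeight_nonneg hw
    simp
    lia
  · simp [Function.comp_def]

theorem finiteDimensional_eigenspace (hX : X.IsN2 c) (hΩ : IsLowestWeightVector X Ω 0 0)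
    (hcyc : IsCyclicVector X Ω) (k : ℤ) :
    FiniteDimensional ℂ ((X.L 0).eigenspace ((k : ℂ) / 2)) := by
  rw [eigenspace_eq_wordSpan hX hcyc hΩ.L_zero' (cr := fun g => 0 < g.weight)
    (fun g hg => hΩ.op_eq_zero (not_lt.mp hg))]
  refine FiniteDimensional.span_of_finite ℂ
    (((finite_setOf_word k).image (X.word Ω)).subset ?_)
  rintro _ ⟨w, hw, h, rfl⟩
  refine ⟨w, ⟨hw, ?_⟩, rfl⟩
  have h' : (wordWeight w : ℂ) = k := by linear_combination 2 * h
  exact_mod_cast h'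

theorem eigenspace_eq_bot (hX : X.IsN2 c) (hΩ : IsLowestWeightVector X Ω 0 0)
    (hcyc : IsCyclicVector X Ω) {μ : ℂ} (hμ : ∀ k : ℕ, μ ≠ (k : ℂ) / 2) :
    (X.L 0).eigenspace μ = ⊥ := by
  rw [eigenspace_eq_wordSpan hX hcyc hΩ.L_zero' (cr := fun g => 0 < g.weight)
    (fun g hg => hΩ.op_eq_zero (not_lt.mp hg)), eq_bot_iff]
  refine Submodule.span_le.mpr ?_
  rintro _ ⟨w, hw, h, rfl⟩
  obtain ⟨k, hk⟩ := Int.eq_ofNat_of_zero_le ((Int.natCast_nonneg _).trans (wordWeight_nonneg hw))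
  exact absurd (by rw [← h, hk]; simp) (hμ k)

theorem eigenspace_zero_eq (hX : X.IsN2 c) (hΩ : IsLowestWeightVector X Ω 0 0)
    (hcyc : IsCyclicVector X Ω) : (X.L 0).eigenspace 0 = Submodule.span ℂ {Ω} := by
  rw [eigenspace_eq_wordSpan hX hcyc hΩ.L_zero' (cr := fun g => 0 < g.weight)
    (fun g hg => hΩ.op_eq_zero (not_lt.mp hg)), wordSpan]
  congr 1
  ext x
  simp only [Set.mem_ofPred_eq, Set.mem_singleton_iff]
  constructor
  · rintro ⟨w, hw, h, rfl⟩
    have h0 : wordWeight w = 0 := by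
      have : (wordWeight w : ℂ) = 0 := by linear_combination 2 * h
      exact_mod_cast this
    have := wordWeight_nonneg hw
    rw [List.length_eq_zero_iff.mp (show w.length = 0 by lia), word_nil]
  · rintro rfl
    exact ⟨[], by simp, by simp, rfl⟩

/-! #### Parity and weights -/

/-- The parity of a word. -/
def wordParity (w : List N2Gen) : ZMod 2 := (w.map N2Gen.parity).sum

theorem wordParity_eq (w : List N2Gen) : wordParity w = (wordWeight w : ZMod 2) := by
  induction w with
  | nil => rfl
  | cons g w ih =>
    rw [wordWeight_cons, Int.cast_add, ← ih, ← N2Gen.parity_eq_weight]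
    simp [wordParity]

/-- The span of all words of parity `i`. -/
def paritySpan (X : N2Modes (Module.End ℂ V)) (Ω : V) (i : ZMod 2) : Submodule ℂ V :=
  Submodule.span ℂ {x | ∃ w : List N2Gen, wordParity w = i ∧ X.word Ω w = x}

theorem op_mem_parity {parity : ZMod 2 → Submodule ℂ V} (h : IsN2Rep parity X c) (g : N2Gen)
    {i : ZMod 2} {x : V} (hx : x ∈ parity i) : X.op g x ∈ parity (g.parity + i) := by
  rw [add_comm]
  cases g with
  | L m => rw [N2Gen.parity, add_zero]; exact h.even_L m i x hx
  | J m => rw [N2Gen.parity, add_zero]; exact h.even_J m i x hx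
  | G1 m => exact h.odd_G1 m i x hx
  | G2 m => exact h.odd_G2 m i x hx

theorem word_mem_parity {parity : ZMod 2 → Submodule ℂ V} (h : IsN2Rep parity X c)
    (hΩ : Ω ∈ parity 0) (w : List N2Gen) : X.word Ω w ∈ parity (wordParity w) := by
  induction w with
  | nil => exact hΩ
  | cons g w ih =>
    rw [word_cons]
    simpa [wordParity] using op_mem_parity h g ih

theorem op_mem_paritySpan (g : N2Gen) {i : ZMod 2} {x : V} (hx : x ∈ paritySpan X Ω i) :
    X.op g x ∈ paritySpan X Ω (g.parity + i) := by
  induction hx using Submodule.span_induction with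
  | mem x hx =>
    obtain ⟨w, rfl, rfl⟩ := hx
    exact Submodule.subset_span ⟨g :: w, by simp [wordParity], word_cons g w⟩
  | zero => simp
  | add x y _ _ h1 h2 => rw [map_add]; exact Submodule.add_mem _ h1 h2
  | smul a x _ h => rw [map_smul]; exact Submodule.smul_mem _ a h

theorem paritySpan_sup_eq_top (hcyc : IsCyclicVector X Ω) :
    paritySpan X Ω 0 ⊔ paritySpan X Ω 1 = ⊤ := by
  refine hcyc.eq_top_of_op
    (Submodule.mem_sup_left (Submodule.subset_span ⟨[], rfl, rfl⟩)) fun g x hx => ?_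
  obtain ⟨y, hy, z, hz, rfl⟩ := Submodule.mem_sup.mp hx
  have h := op_mem_paritySpan g hy
  have h' := op_mem_paritySpan g hz
  have e : (1 : ZMod 2) + 1 = 0 := by decide
  rw [map_add]
  rcases g.parity.two_cases with hg | hg <;> rw [hg] at h h' <;> simp only [zero_add, add_zero, e] at h h'
  · exact Submodule.add_mem_sup h h'
  · rw [add_comm]
    exact Submodule.add_mem_sup h' h

/-- Submodules that contain the words of the respective parity and are disjoint are spanned by
these words. -/
theorem eq_paritySpan (hcyc : IsCyclicVector X Ω) {P : ZMod 2 → Submodule ℂ V}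
    (hP : ∀ i, paritySpan X Ω i ≤ P i) (hd : Disjoint (P 0) (P 1)) (i : ZMod 2) :
    P i = paritySpan X Ω i := by
  refine le_antisymm (fun x hx => ?_) (hP i)
  have : x ∈ paritySpan X Ω 0 ⊔ paritySpan X Ω 1 := by rw [paritySpan_sup_eq_top hcyc]; trivial
  obtain ⟨y, hy, z, hz, rfl⟩ := Submodule.mem_sup.mp this
  rw [Submodule.disjoint_def] at hd
  rcases i.two_cases with rfl | rfl
  · have hz0 : z = 0 := hd z (by simpa using (P 0).sub_mem hx (hP 0 hy)) (hP 1 hz)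
    rwa [hz0, add_zero]
  · have hy0 : y = 0 := hd y (hP 0 hy) (by simpa using (P 1).sub_mem hx (hP 1 hz))
    rwa [hy0, zero_add]

theorem isInternal_iff_isCompl (P : ZMod 2 → Submodule ℂ V) :
    DirectSum.IsInternal P ↔ IsCompl (P 0) (P 1) :=
  DirectSum.isInternal_submodule_iff_isCompl P (by decide) (by
    ext i; simpa using i.two_cases)

theorem parity_eq_paritySpan {parity : ZMod 2 → Submodule ℂ V} (h : IsN2Rep parity X c)
    (hΩ : Ω ∈ parity 0) (hcyc : IsCyclicVector X Ω) (i : ZMod 2) :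
    parity i = paritySpan X Ω i := by
  refine eq_paritySpan hcyc (fun i => Submodule.span_le.mpr ?_)
    ((isInternal_iff_isCompl _).mp h.isInternal).disjoint i
  rintro _ ⟨w, rfl, rfl⟩
  exact word_mem_parity h hΩ w

/-- Words have integral or half-integral weight according to their parity, and eigenspaces for
disjoint sets of eigenvalues are independent; `eq_paritySpan` then gives equality. -/
theorem paritySpan_eq_iSup (hX : X.IsN2 c) (hΩ : X.L 0 Ω = 0) (hcyc : IsCyclicVector X Ω) :
    paritySpan X Ω 0 = ⨆ n : ℤ, (X.L 0).eigenspace (n : ℂ) ∧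
    paritySpan X Ω 1 = ⨆ n : ℤ, (X.L 0).eigenspace ((n : ℂ) - 1 / 2) := by
  set P : ZMod 2 → Submodule ℂ V := fun i => if i = 0 then ⨆ n : ℤ, (X.L 0).eigenspace (n : ℂ)
    else ⨆ n : ℤ, (X.L 0).eigenspace ((n : ℂ) - 1 / 2) with hP
  have key : ∀ i, P i = paritySpan X Ω i := by
    refine eq_paritySpan hcyc (fun i => Submodule.span_le.mpr ?_) ?_
    · rintro _ ⟨w, rfl, rfl⟩
      have hw := word_mem_eigenspace hX hΩ w
      rw [wordParity_eq]
      rcases Int.even_or_odd' (wordWeight w) with ⟨k, hk | hk⟩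
      · have e : ((wordWeight w : ℤ) : ZMod 2) = 0 := by
          rw [hk]; push_cast; rw [show (2 : ZMod 2) = 0 from rfl, zero_mul]
        rw [e]
        simp only [hP, if_true]
        refine Submodule.mem_iSup_of_mem k ?_
        convert hw using 2
        rw [hk]; push_cast; ring
      · have e : ((wordWeight w : ℤ) : ZMod 2) = 1 := by
          rw [hk]; push_cast; rw [show (2 : ZMod 2) = 0 from rfl, zero_mul, zero_add]
        rw [e]
        simp only [hP, one_ne_zero, if_false]
        refine Submodule.mem_iSup_of_mem (k + 1) ?_
        convert hw using 2
        rw [hk]; push_cast; ring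
    · have hind := Module.End.eigenspaces_iSupIndep (X.L 0)
      have h1 : Disjoint (Set.range fun n : ℤ => (n : ℂ))
          (Set.range fun n : ℤ => (n : ℂ) - 1 / 2) := by
        rw [Set.disjoint_left]
        rintro _ ⟨m, rfl⟩ ⟨n, hn⟩
        have : ((2 * n - 1 : ℤ) : ℂ) = ((2 * m : ℤ) : ℂ) := by
          push_cast
          linear_combination 2 * hn
        have := Int.cast_injective this
        lia
      have := hind.disjoint_biSup_biSup h1
      rw [iSup_range, iSup_range] at this
      simpa [hP] using this
  exact ⟨by rw [← key 0]; simp [hP], by rw [← key 1]; simp [hP]⟩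

end N2Modes

/-! ### Trigonometric polynomials -/

namespace FormalSeries

variable {V : Type*} [AddCommGroup V] [Module ℂ V]

theorem polyMul_add (p q : LaurentPolynomial ℂ) (A : FormalSeries V) :
    polyMul (p + q) A = polyMul p A + polyMul q A := by
  ext n : 1
  simp only [polyMul, Pi.add_apply]
  rw [AddMonoidAlgebra.coeff_add]
  exact Finsupp.sum_add_index' (by simp) (by intros; rw [add_smul])

theorem polyMul_T (k : ℤ) (A : FormalSeries V) (n : ℤ) :
    polyMul (LaurentPolynomial.T k) A n = A (n + k) := by
  rw [polyMul, LaurentPolynomial.T, AddMonoidAlgebra.coeff_single, Finsupp.sum_single_index]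
  · rw [one_smul]
  · rw [zero_smul]

end FormalSeries

theorem trigConj_add (p q : LaurentPolynomial ℂ) : trigConj (p + q) = trigConj p + trigConj q := by
  simp only [trigConj]
  rw [AddMonoidAlgebra.coeff_add]
  exact Finsupp.sum_add_index' (by simp) (by intros; rw [map_add, map_add, add_mul])

theorem trigConj_T (k : ℤ) : trigConj (LaurentPolynomial.T k) = LaurentPolynomial.T (-k) := by
  rw [trigConj, LaurentPolynomial.T, AddMonoidAlgebra.coeff_single, Finsupp.sum_single_index]
  · rw [map_one, map_one, one_mul]
  · simp

theorem trigEvalNegOne_T_zero_add_T_one :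
    trigEvalNegOne (LaurentPolynomial.T 0 + LaurentPolynomial.T 1) = 0 := by
  simp [trigEvalNegOne]

/-! ### The formal adjoint of a generator -/

/-- The generator that is the adjoint in unitary representations. -/
def N2Gen.adj : N2Gen → N2Gen
  | .L m => .L (-m)
  | .J m => .J (-m)
  | .G1 k => .G1 (-k - 1)
  | .G2 k => .G2 (-k - 1)

@[simp] theorem N2Gen.weight_adj (g : N2Gen) : g.adj.weight = -g.weight := by
  cases g <;> simp only [N2Gen.adj, N2Gen.weight] <;> ring

theorem superSign_conj (i j : ZMod 2) : starRingEnd ℂ (superSign i j) = superSign i j := by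
  simp [superSign]

namespace N2Modes

/-- The commutation relations are compatible with taking adjoints. -/
theorem IsN2.comm_adj {A : Type*} [Ring A] [Algebra ℂ A] {X : N2Modes A} {c : ℝ}
    (hX : X.IsN2 c) (g h : N2Gen) : ∃ (g' : N2Gen) (α β : ℂ),
    X.op g * X.op h - superSign g.parity h.parity • (X.op h * X.op g) =
      α • X.op g' + β • 1 ∧
    X.op h.adj * X.op g.adj - superSign g.parity h.parity • (X.op g.adj * X.op h.adj) =
      starRingEnd ℂ α • X.op g'.adj + starRingEnd ℂ β • 1 := by
  have swap : ∀ {g h : N2Gen} (_ : ∃ (g' : N2Gen) (α β : ℂ),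
      X.op g * X.op h - superSign g.parity h.parity • (X.op h * X.op g) =
        α • X.op g' + β • 1 ∧
      X.op h.adj * X.op g.adj - superSign g.parity h.parity • (X.op g.adj * X.op h.adj) =
        starRingEnd ℂ α • X.op g'.adj + starRingEnd ℂ β • 1),
      ∃ (g' : N2Gen) (α β : ℂ),
      X.op h * X.op g - superSign h.parity g.parity • (X.op g * X.op h) =
        α • X.op g' + β • 1 ∧
      X.op g.adj * X.op h.adj - superSign h.parity g.parity • (X.op h.adj * X.op g.adj) =
        starRingEnd ℂ α • X.op g'.adj + starRingEnd ℂ β • 1 := by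
    rintro g h ⟨g', α, β, h1, h2⟩
    refine ⟨g', -superSign g.parity h.parity * α, -superSign g.parity h.parity * β, ?_, ?_⟩
    · rw [sub_eq_iff_eq_add] at h1
      rw [h1, superSign_comm h.parity]
      simp only [smul_add, smul_smul, superSign_mul_self]
      module
    · rw [sub_eq_iff_eq_add] at h2
      rw [h2, superSign_comm h.parity]
      simp only [smul_add, smul_smul, superSign_mul_self, map_mul, map_neg, superSign_conj]
      module
  have gen : ∀ {g h : N2Gen} (g' : N2Gen) (ε α α' z z' : ℂ) {b b' : Prop} [Decidable b]
      [Decidable b'],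
      superSign g.parity h.parity = ε →
      X.op g * X.op h - ε • (X.op h * X.op g) =
        α • X.op g' + (if b then algebraMap ℂ A z else 0) →
      X.op h.adj * X.op g.adj - ε • (X.op g.adj * X.op h.adj) =
        α' • X.op g'.adj + (if b' then algebraMap ℂ A z' else 0) →
      (b' ↔ b) → starRingEnd ℂ α = α' → (b → starRingEnd ℂ z = z') →
      ∃ (g' : N2Gen) (α β : ℂ),
      X.op g * X.op h - superSign g.parity h.parity • (X.op h * X.op g) =
        α • X.op g' + β • 1 ∧
      X.op h.adj * X.op g.adj - superSign g.parity h.parity • (X.op g.adj * X.op h.adj) =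
        starRingEnd ℂ α • X.op g'.adj + starRingEnd ℂ β • 1 := by
    intro g h g' ε α α' z z' b b' _ _ hε h1 h2 hb hα hz
    refine ⟨g', α, if b then z else 0, ?_, ?_⟩
    · rw [hε, h1]
      split_ifs <;> simp [Algebra.algebraMap_eq_smul_one]
    · rw [hε, h2, hα]
      simp only [hb]
      split_ifs with h
      · rw [← hz h, Algebra.algebraMap_eq_smul_one]
      · simp
  have gen' : ∀ {g h : N2Gen} (g' : N2Gen) (ε α α' : ℂ),
      superSign g.parity h.parity = ε →
      X.op g * X.op h - ε • (X.op h * X.op g) = α • X.op g' →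
      X.op h.adj * X.op g.adj - ε • (X.op g.adj * X.op h.adj) = α' • X.op g'.adj →
      starRingEnd ℂ α = α' →
      ∃ (g' : N2Gen) (α β : ℂ),
      X.op g * X.op h - superSign g.parity h.parity • (X.op h * X.op g) =
        α • X.op g' + β • 1 ∧
      X.op h.adj * X.op g.adj - superSign g.parity h.parity • (X.op g.adj * X.op h.adj) =
        starRingEnd ℂ α • X.op g'.adj + starRingEnd ℂ β • 1 := by
    intro g h g' ε α α' hε h1 h2 hα
    exact ⟨g', α, 0, by rw [hε, h1, zero_smul, add_zero],
      by rw [hε, h2, hα, map_zero, zero_smul, add_zero]⟩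
  have even : ∀ {P Q R : A}, P - Q = R → P - (1 : ℂ) • Q = R := by
    intro P Q R h; rwa [one_smul]
  have even' : ∀ {P Q R : A}, P - Q = R → Q - (1 : ℂ) • P = -R := by
    intro P Q R h; rw [one_smul, ← h]; abel
  have odd : ∀ {P Q R : A}, P + Q = R → P - (-1 : ℂ) • Q = R := by
    intro P Q R h; rwa [neg_one_smul, sub_neg_eq_add]
  have odd' : ∀ {P Q R : A}, P + Q = R → Q - (-1 : ℂ) • P = R := by
    intro P Q R h; rw [neg_one_smul, sub_neg_eq_add, add_comm, h]
  have LL := fun m n => gen (g := .L m) (h := .L n) (.L (m + n)) 1 (m - n) (m - n)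
    _ _ (by simp [N2Gen.parity]) (even (hX.L_L m n))
    ((even (hX.L_L (-n) (-m))).trans (by
      rw [show X.op (N2Gen.L (m + n)).adj = X.L (-n + -m) by rw [N2Gen.adj, op]; congr 1; ring]
      push_cast; congr 2; ring)) (by lia) (by simp)
    (by intro h
        have : (n : ℂ) = -m := by exact_mod_cast (eq_neg_of_add_eq_zero_right h)
        simp [this, Complex.conj_ofNat])
  have LJ := fun m n => gen' (g := .L m) (h := .J n) (.J (m + n)) 1 _ _
    (by simp [N2Gen.parity]) (even (hX.L_J m n))
    ((even' (hX.L_J (-m) (-n))).trans (by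
      rw [show X.op (N2Gen.J (m + n)).adj = X.J (-m + -n) by rw [N2Gen.adj, op]; congr 1; ring,
        ← neg_smul])) (by simp)
  have LG1 := fun m n => gen' (g := .L m) (h := .G1 n) (.G1 (m + n)) 1 _ _
    (by simp [N2Gen.parity]) (even (hX.L_G1 m n))
    ((even' (hX.L_G1 (-m) (-n - 1))).trans (by
      rw [show X.op (N2Gen.G1 (m + n)).adj = X.G1 (-m + (-n - 1)) by
        rw [N2Gen.adj, op]; congr 1; ring, ← neg_smul])) (by simp [Complex.conj_ofNat]; ring)
  have LG2 := fun m n => gen' (g := .L m) (h := .G2 n) (.G2 (m + n)) 1 _ _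
    (by simp [N2Gen.parity]) (even (hX.L_G2 m n))
    ((even' (hX.L_G2 (-m) (-n - 1))).trans (by
      rw [show X.op (N2Gen.G2 (m + n)).adj = X.G2 (-m + (-n - 1)) by
        rw [N2Gen.adj, op]; congr 1; ring, ← neg_smul])) (by simp [Complex.conj_ofNat]; ring)
  have G1J := fun m n => gen' (g := .G1 m) (h := .J n) (.G2 (m + n)) 1 _ _
    (by simp [N2Gen.parity]) (even (hX.G1_J m n))
    ((even' (hX.G1_J (-m - 1) (-n))).trans (by
      rw [show X.op (N2Gen.G2 (m + n)).adj = X.G2 (-m - 1 + -n) by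
        rw [N2Gen.adj, op]; congr 1; ring, ← neg_smul])) (by simp)
  have G2J := fun m n => gen' (g := .G2 m) (h := .J n) (.G1 (m + n)) 1 _ _
    (by simp [N2Gen.parity]) (even (hX.G2_J m n))
    ((even' (hX.G2_J (-m - 1) (-n))).trans (by
      rw [show X.op (N2Gen.G1 (m + n)).adj = X.G1 (-m - 1 + -n) by
        rw [N2Gen.adj, op]; congr 1; ring, ← neg_smul])) (by simp)
  have G1G2 := fun m n => gen' (g := .G1 m) (h := .G2 n) (.J (m + n + 1)) (-1) _ _
    (by simp [N2Gen.parity]) (odd (hX.G1_G2 m n))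
    ((odd' (hX.G1_G2 (-m - 1) (-n - 1))).trans (by
      rw [show X.op (N2Gen.J (m + n + 1)).adj = X.J (-m - 1 + (-n - 1) + 1) by
        rw [N2Gen.adj, op]; congr 1; ring])) (by simp; ring)
  have JJ := fun m n => gen (g := .J m) (h := .J n) (.J (m + n)) 1 0 0
    _ _ (by simp [N2Gen.parity]) (even ((hX.J_J m n).trans (by rw [zero_smul, zero_add])))
    (even ((hX.J_J (-n) (-m)).trans (by rw [zero_smul, zero_add]))) (by lia) (by simp)
    (by intro h
        have : (n : ℂ) = -m := by exact_mod_cast (eq_neg_of_add_eq_zero_right h)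
        simp [this, Complex.conj_ofNat])
  have G1G1 := fun m n => gen (g := .G1 m) (h := .G1 n) (.L (m + n + 1)) (-1) 2 2
    _ _ (by simp [N2Gen.parity]) (odd (hX.G1_G1 m n))
    ((odd (hX.G1_G1 (-n - 1) (-m - 1))).trans (by
      rw [show X.op (N2Gen.L (m + n + 1)).adj = X.L (-n - 1 + (-m - 1) + 1) by
        rw [N2Gen.adj, op]; congr 1; ring])) (by lia) (by simp [Complex.conj_ofNat])
    (by intro h
        have : (n : ℂ) = -m - 1 := by exact_mod_cast (show n = -m - 1 by lia)
        simp [this, Complex.conj_ofNat])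
  have G2G2 := fun m n => gen (g := .G2 m) (h := .G2 n) (.L (m + n + 1)) (-1) 2 2
    _ _ (by simp [N2Gen.parity]) (odd (hX.G2_G2 m n))
    ((odd (hX.G2_G2 (-n - 1) (-m - 1))).trans (by
      rw [show X.op (N2Gen.L (m + n + 1)).adj = X.L (-n - 1 + (-m - 1) + 1) by
        rw [N2Gen.adj, op]; congr 1; ring])) (by lia) (by simp [Complex.conj_ofNat])
    (by intro h
        have : (n : ℂ) = -m - 1 := by exact_mod_cast (show n = -m - 1 by lia)
        simp [this, Complex.conj_ofNat])
  cases g with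
  | L m =>
    cases h with
    | L n => exact LL m n
    | J n => exact LJ m n
    | G1 n => exact LG1 m n
    | G2 n => exact LG2 m n
  | J m =>
    cases h with
    | L n => exact swap (LJ n m)
    | J n => exact JJ m n
    | G1 n => exact swap (G1J n m)
    | G2 n => exact swap (G2J n m)
  | G1 m =>
    cases h with
    | L n => exact swap (LG1 n m)
    | J n => exact G1J m n
    | G1 n => exact G1G1 m n
    | G2 n => exact G1G2 m n
  | G2 m =>
    cases h with
    | L n => exact swap (LG2 n m)
    | J n => exact G2J m n
    | G1 n => exact swap (G1G2 n m)
    | G2 n => exact G2G2 m n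

end N2Modes

/-! ### Vacuum modules and invariant forms -/

namespace N2Modes

variable {V : Type*} [AddCommGroup V] [Module ℂ V] {X : N2Modes (Module.End ℂ V)} {Ω : V}

/-- A cyclic module of lowest weight `(0, 0)` in which `L_{-1} Ω = G¹_{-1/2} Ω = G²_{-1/2} Ω = 0`. -/
structure IsVacuumModule (X : N2Modes (Module.End ℂ V)) (Ω : V) (c : ℂ) : Prop where
  isN2 : X.IsN2 c
  lowest : IsLowestWeightVector X Ω 0 0
  cyclic : IsCyclicVector X Ω
  L_vac : X.L (-1) Ω = 0
  G1_vac : X.G1 (-1) Ω = 0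
  G2_vac : X.G2 (-1) Ω = 0

/-- The relations `L_m† = L_{-m}`, `J_m† = J_{-m}`, `G_r† = G_{-r}`. -/
def IsInvariantForm (X : N2Modes (Module.End ℂ V)) (B : V →ₗ⋆[ℂ] V →ₗ[ℂ] ℂ) : Prop :=
  ∀ g x y, B (X.op g x) y = B x (X.op g.adj y)

/-- The failure of `i.mode n` and its formal adjoint to be adjoint to each other. -/
def adjDefect (X : N2Modes (Module.End ℂ V)) (B : V →ₗ⋆[ℂ] V →ₗ[ℂ] ℂ) (i : N2Field) (n : ℤ)
    (x y : V) : ℂ :=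
  B (X.fld i n x) y - B x (X.op (i.mode n).adj y)

/-- The defects alternate along a field. Hence a defect can be computed from a mode that is far
enough out to annihilate the vectors at hand. -/
theorem adjDefect_shift {B : V →ₗ⋆[ℂ] V →ₗ[ℂ] ℂ}
    (hD : ∀ i n x y, adjDefect X B i n x y + adjDefect X B i (n + 1) x y = 0) (i : N2Field)
    (n : ℤ) (N : ℕ) (x y : V) :
    adjDefect X B i n x y = (-1) ^ N * adjDefect X B i (n + N) x y := by
  induction N with
  | zero => simp
  | succ N ih =>
    rw [ih, pow_succ, eq_neg_of_add_eq_zero_left (hD i (n + N) x y)]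
    push_cast
    rw [add_assoc]
    ring

theorem weight_mode (i : N2Field) (n : ℤ) :
    -2 * n ≤ (i.mode n).weight ∧ (i.mode n).weight ≤ -2 * n + 2 := by
  cases i <;> simp only [N2Field.mode, N2Gen.weight] <;> lia

variable {B : V →ₗ⋆[ℂ] V →ₗ[ℂ] ℂ} {c : ℝ}

/-- The vectors on which all generators have the expected adjoints form a submodule for the
`N = 2` algebra. -/
theorem adjDefect_eq_zero_op (hX : X.IsN2 c) (hΩ : IsLowestWeightVector X Ω 0 0)
    (hcyc : IsCyclicVector X Ω)
    (hD : ∀ i n x y, adjDefect X B i n x y + adjDefect X B i (n + 1) x y = 0) {x : V}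
    (hx : ∀ g y, B (X.op g x) y = B x (X.op g.adj y)) (h g : N2Gen) (y : V) :
    B (X.op g (X.op h x)) y = B (X.op h x) (X.op g.adj y) := by
  obtain ⟨i, n, rfl⟩ := exists_mode h
  obtain ⟨K₁, hK₁⟩ := exists_op_eq_zero hX hΩ hcyc x
  obtain ⟨K₂, hK₂⟩ := exists_op_eq_zero hX hΩ hcyc (X.op g x)
  -- Replace `h` by a mode `h'` of the same field that annihilates both `x` and `g x`; the defects
  -- of the two modes agree up to a sign.
  obtain ⟨N, h₁, h₂⟩ : ∃ N : ℕ, (i.mode (n + N)).weight ≤ -K₁ ∧ (i.mode (n + N)).weight ≤ -K₂ := by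
    refine ⟨K₁ + K₂ + n.natAbs + 2, ?_, ?_⟩ <;>
    · refine (weight_mode _ _).2.trans ?_
      lia
  have hs : ∀ u v, B (X.op (i.mode n) u) v - B u (X.op (i.mode n).adj v) =
      (-1) ^ N * (B (X.op (i.mode (n + N)) u) v - B u (X.op (i.mode (n + N)).adj v)) :=
    adjDefect_shift hD i n N
  generalize i.mode (n + N) = h' at h₁ h₂ hs
  generalize i.mode n = h at hs ⊢
  have e₁ := hK₁ h' h₁
  have e₂ := hK₂ h' h₂
  -- The supercommutator of `g` and `h'` kills `x`. By the adjoint relation and the assumption on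
  -- `x`, the supercommutator of `h'†` and `g†` applied to `y` is orthogonal to `x`; and `(x | h'†
  -- g† y) = (h' x | g† y) = 0`.
  have key : B x (X.op g.adj (X.op h'.adj y)) = 0 := by
    obtain ⟨g', α, β, h1, h2⟩ := hX.comm_adj g h'
    have h1' := DFunLike.congr_fun h1 x
    have h2' := DFunLike.congr_fun h2 y
    simp only [LinearMap.sub_apply, Module.End.mul_apply, LinearMap.smul_apply,
      LinearMap.add_apply, Module.End.one_apply] at h1' h2'
    have h1'' := congrArg (fun v => B v y) h1'
    have h2'' := congrArg (B x) h2'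
    simp only [map_sub, map_add, map_smul, map_smulₛₗ, LinearMap.add_apply,
      LinearMap.smul_apply, e₁, e₂, map_zero, LinearMap.zero_apply, smul_zero, sub_zero,
      hx g'] at h1'' h2''
    rw [← h1'', ← hx h', e₁, map_zero, LinearMap.zero_apply, zero_sub] at h2''
    have := congrArg (fun z => superSign g.parity h'.parity * z) h2''
    simpa [← mul_assoc, superSign_mul_self] using this
  -- By `key`, `h'` and therefore `h` has no defect at `(g x, y)`. What remains is to compare the
  -- supercommutator of `g` and `h` on `x` with its adjoint on `y`.
  obtain ⟨g', α, β, h1, h2⟩ := hX.comm_adj g h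
  have h1' := DFunLike.congr_fun h1 x
  have h2' := DFunLike.congr_fun h2 y
  simp only [LinearMap.sub_apply, Module.End.mul_apply, LinearMap.smul_apply,
    LinearMap.add_apply, Module.End.one_apply] at h1' h2'
  have h1'' := congrArg (fun v => B v y) h1'
  have h2'' := congrArg (B x) h2'
  simp only [map_sub, map_add, map_smul, map_smulₛₗ, LinearMap.sub_apply, LinearMap.add_apply,
    LinearMap.smul_apply, hx g', superSign_conj] at h1'' h2''
  have h3 := hs (X.op g x) y
  rw [e₂, map_zero, LinearMap.zero_apply, hx g, hx g, key, sub_zero, mul_zero, sub_eq_zero] at h3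
  rw [← h2'', h3, sub_left_inj] at h1''
  rw [h1'', hx h]

/-- If the failures of adjointness alternate, they vanish as soon as they vanish at the vacuum. -/
theorem isInvariantForm_of_adjDefect (hX : X.IsN2 c) (hΩ : IsLowestWeightVector X Ω 0 0)
    (hcyc : IsCyclicVector X Ω)
    (hD : ∀ i n x y, adjDefect X B i n x y + adjDefect X B i (n + 1) x y = 0)
    (h : ∀ g y, B (X.op g Ω) y = B Ω (X.op g.adj y)) : IsInvariantForm X B := by
  let W : Submodule ℂ V :=
    { carrier := {x | ∀ g y, B (X.op g x) y = B x (X.op g.adj y)}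
      zero_mem' := by simp
      add_mem' := by
        intro a b ha hb g y
        simp [ha g y, hb g y]
      smul_mem' := by
        intro a x hx g y
        simp [hx g y] }
  have hW : W = ⊤ := hcyc.eq_top_of_op h fun g x hx g' y =>
    adjDefect_eq_zero_op hX hΩ hcyc hD hx g g' y
  intro g x y
  exact (hW ▸ Submodule.mem_top : x ∈ W) g y

/-- The generators of positive weight other than `L_{-1}` and `Gⁱ_{-1/2}`. -/
def IsCreation (g : N2Gen) : Prop :=
  0 < g.weight ∧ g ≠ .L (-1) ∧ g ≠ .G1 (-1) ∧ g ≠ .G2 (-1)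

theorem op_vacuum_eq_zero {c : ℂ} (h : IsVacuumModule X Ω c) (g : N2Gen) (hg : ¬ IsCreation g) :
    X.op g Ω = 0 := by
  by_cases hw : 0 < g.weight
  · simp only [IsCreation, hw, true_and, not_and_or, not_not] at hg
    rcases hg with rfl | rfl | rfl
    exacts [h.L_vac, h.G1_vac, h.G2_vac]
  · exact h.lowest.op_eq_zero (not_lt.1 hw)

/-- The space of vectors of weight `1` is spanned by `J_{-1} Ω`. -/
theorem eigenspace_one_le {c : ℂ} (h : IsVacuumModule X Ω c) :
    (X.L 0).eigenspace 1 ≤ Submodule.span ℂ {X.J (-1) Ω} := by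
  rw [eigenspace_eq_wordSpan h.isN2 h.cyclic h.lowest.L_zero' (op_vacuum_eq_zero h), wordSpan,
    Submodule.span_le]
  rintro _ ⟨w, hw, hw2, rfl⟩
  apply Submodule.subset_span
  have h2 : wordWeight w = 2 := by
    have : (wordWeight w : ℂ) = 2 := by linear_combination 2 * hw2
    exact_mod_cast this
  have h1 : ∀ g ∈ w, 2 ≤ g.weight := by
    intro g hg
    obtain ⟨h0, ha, hb, hc⟩ := hw g hg
    cases g <;> simp only [N2Gen.weight, ne_eq, N2Gen.L.injEq, N2Gen.G1.injEq,
      N2Gen.G2.injEq] at * <;> lia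
  match w, h1, h2 with
  | [], _, h2 => simp at h2
  | [g], h1, h2 =>
    obtain ⟨h0, ha, hb, hc⟩ := hw g (by simp)
    cases g with
    | L m => simp [N2Gen.weight] at h2 ha; lia
    | J m =>
      obtain rfl : m = -1 := by simp [N2Gen.weight] at h2; lia
      rfl
    | G1 m => simp [N2Gen.weight] at h2; lia
    | G2 m => simp [N2Gen.weight] at h2; lia
  | g :: g' :: l, h1, h2 =>
    have h3 := h1 g (by simp)
    have h4 := h1 g' (by simp)
    have h5 := wordWeight_nonneg (w := l) (fun a ha => (hw a (by simp [ha])).1)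
    simp only [wordWeight_cons] at h2
    lia

/-- A functional on a vacuum module that intertwines `L_1` and `-L_0` vanishes in positive
weights. -/
theorem eq_zero_of_L_one {c : ℂ} (h : IsVacuumModule X Ω c) {f : V →ₗ[ℂ] ℂ}
    (hf : ∀ x, f (X.L 0 x) = -f (X.L 1 x)) :
    ∀ k : ℕ, 0 < k → ∀ x ∈ (X.L 0).eigenspace ((k : ℂ) / 2), f x = 0 := by
  intro k
  induction k using Nat.strong_induction_on with
  | _ k ih =>
    intro hk x hx
    have h1 := hf x
    rw [Module.End.mem_eigenspace_iff.1 hx, map_smul, smul_eq_mul] at h1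
    -- `L_1` lowers the weight by one. Weight `1` needs a separate argument because `f` need not
    -- vanish in weight `0`: there `x` is a multiple of `J_{-1} Ω`, and `L_1 J_{-1} Ω = J_0 Ω = 0`.
    have h2 : f (X.L 1 x) = 0 := by
      have h3 := op_mem_eigenspace h.isN2 (.L 1) hx
      change X.L 1 x ∈ _ at h3
      match k, hk with
      | 1, _ =>
        rw [eigenspace_eq_bot h.isN2 h.lowest h.cyclic] at h3
        · rw [(Submodule.mem_bot ℂ).1 h3, map_zero]
        · intro k hk
          have : (-1 : ℂ) = (k : ℂ) := by
            simp only [N2Gen.weight] at hk; push_cast at hk; linear_combination 2 * hk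
          have : (-1 : ℤ) = k := by exact_mod_cast this
          lia
      | 2, _ =>
        have h4 : x ∈ (X.L 0).eigenspace 1 := by
          convert hx using 2; norm_num
        obtain ⟨a, rfl⟩ := Submodule.mem_span_singleton.1 (eigenspace_one_le h h4)
        have := DFunLike.congr_fun (h.isN2.L_J 1 (-1)) Ω
        simp only [LinearMap.sub_apply, Module.End.mul_apply, LinearMap.smul_apply,
          h.lowest.L_pos 1 (by norm_num), map_zero, sub_zero] at this
        rw [map_smul, this]
        simp [h.lowest.J_zero]
      | k + 3, _ =>
        refine ih (k + 1) (by lia) (by lia) _ ?_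
        convert h3 using 2
        simp only [N2Gen.weight]
        push_cast
        ring
    rw [h2, neg_zero, mul_eq_zero] at h1
    refine h1.resolve_left ?_
    have : (k : ℂ) ≠ 0 := by exact_mod_cast hk.ne'
    simpa using this

theorem exists_weight_eigenspace {c : ℂ} (hX : X.IsN2 c) (hΩ : IsLowestWeightVector X Ω 0 0)
    (hcyc : IsCyclicVector X Ω) :
    ⨆ k : ℕ, (X.L 0).eigenspace ((k : ℂ) / 2) = ⊤ := by
  rw [eq_top_iff, ← span_word_eq_top hX hcyc (cr := fun g => 0 < g.weight)
    (fun g hg => hΩ.op_eq_zero (not_lt.1 hg)), Submodule.span_le]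
  rintro _ ⟨w, hw, rfl⟩
  have h1 := wordWeight_nonneg hw
  have h2 := word_mem_eigenspace hX hΩ.L_zero' w
  lift wordWeight w to ℕ using by lia with k
  exact Submodule.mem_iSup_of_mem k h2

/-- If all `L_n + L_{n+1}`, `Gⁱ_r + Gⁱ_{r+1}` and `J_n` have the expected adjoints, then so do all
the generators. -/
theorem isVacuumModule_and_isInvariantForm (hX : X.IsN2 c) (hΩ : IsLowestWeightVector X Ω 0 0)
    (hcyc : IsCyclicVector X Ω) (hB : IsScalarProduct B)
    (hD : ∀ i n x y, adjDefect X B i n x y + adjDefect X B i (n + 1) x y = 0) :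
    IsVacuumModule X Ω c ∧ IsInvariantForm X B := by
  have hG : ∀ (G : ℤ → Module.End ℂ V), (∀ k : ℤ, 0 ≤ k → G k Ω = 0) →
      (∀ k l : ℤ, G k * G l + G l * G k = (2 : ℂ) • X.L (k + l + 1) +
        if k + l + 1 = 0 then algebraMap ℂ _ (c / 3 * (((k : ℂ) + 1 / 2) ^ 2 - 1 / 4)) else 0) →
      (∀ x y, B (G (-1) x) y - B x (G 0 y) + (B (G 0 x) y - B x (G (-1) y)) = 0) →
      G (-1) Ω = 0 ∧ X.L (-1) Ω = 0 := by
    intro G h1 h2 h3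
    have hL : G (-1) (G (-1) Ω) = X.L (-1) Ω := by
      have := DFunLike.congr_fun (h2 (-1) (-1)) Ω
      simp only [LinearMap.add_apply, Module.End.mul_apply, LinearMap.smul_apply] at this
      norm_num at this
      rw [← two_smul ℂ] at this
      exact (IsUnit.smul_left_cancel (isUnit_iff_ne_zero.2 (two_ne_zero' ℂ))).1 this
    have hL0 : G 0 (G (-1) Ω) = 0 := by
      have := DFunLike.congr_fun (h2 0 (-1)) Ω
      simp only [LinearMap.add_apply, Module.End.mul_apply, LinearMap.smul_apply] at this
      norm_num [h1 0 le_rfl, hΩ.L_zero'] at this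
      exact this
    -- The modes involved are `L_0` and `L_1`, which annihilate `Ω`; what is left is `(Ω | L_{-1} Ω)
    -- = 0`.
    have h4 := hD .T 1 Ω Ω
    simp only [adjDefect, fld, N2Field.mode, op, N2Gen.adj] at h4
    norm_num [hΩ.L_zero', hΩ.L_pos 1] at h4
    -- Here `G (-1)` and `G 0` are `G_{-1/2}` and `G_{1/2}`. The relation reduces the squared norm
    -- of `G_{-1/2} Ω` to `(Ω | L_{-1} Ω)`, which is zero.
    have h5 := h3 Ω (G (-1) Ω)
    rw [hL0, h1 0 le_rfl, hL, h4] at h5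
    simp only [map_zero, LinearMap.zero_apply, sub_zero, add_zero] at h5
    have h6 : G (-1) Ω = 0 := by
      by_contra hne
      have := hB.pos _ hne
      rw [h5] at this
      simp at this
    exact ⟨h6, by rw [← hL, h6, map_zero]⟩
  obtain ⟨g1, hL⟩ := hG X.G1 hΩ.G1_pos hX.G1_G1 (fun x y => by
    simpa [adjDefect, fld, N2Field.mode, op, N2Gen.adj] using hD .G1 0 x y)
  obtain ⟨g2, -⟩ := hG X.G2 hΩ.G2_pos hX.G2_G2 (fun x y => by
    simpa [adjDefect, fld, N2Field.mode, op, N2Gen.adj] using hD .G2 0 x y)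
  have hvac : IsVacuumModule X Ω c := ⟨hX, hΩ, hcyc, hL, g1, g2⟩
  refine ⟨hvac, isInvariantForm_of_adjDefect hX hΩ hcyc hD ?_⟩
  -- The defects of `L_{-1}` and `L_0` at `Ω`, both of which kill `Ω`, give `(Ω | L_0 x) = -(Ω | L_1
  -- x)`.
  have hf := eq_zero_of_L_one (c := c) hvac (f := B Ω) (fun x => by
    have := hD .T 0 Ω x
    simp only [adjDefect, fld, N2Field.mode, op, N2Gen.adj] at this
    norm_num [hΩ.L_zero', hL] at this
    linear_combination -this)
  have hpos : ∀ g : N2Gen, 0 < g.weight → ∀ y, B Ω (X.op g y) = 0 := by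
    intro g hg y
    have hy : y ∈ (⨆ k : ℕ, (X.L 0).eigenspace ((k : ℂ) / 2)) := by
      rw [exists_weight_eigenspace hX hΩ hcyc]; trivial
    induction hy using Submodule.iSup_induction' with
    | mem k x hx =>
      have h1 := op_mem_eigenspace hX g hx
      lift g.weight to ℕ using hg.le with m
      refine hf (k + m) (by lia) _ ?_
      convert h1 using 2
      push_cast; ring
    | zero => simp
    | add x y _ _ hx hy => simp [hx, hy]
  intro g y
  obtain ⟨i, n, rfl⟩ := exists_mode g
  -- The shift makes the weight negative: the shifted mode kills `Ω`, and its formal adjoint has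
  -- positive weight, so it maps into the orthogonal complement of `Ω`.
  have h1 := adjDefect_shift hD i n (n.natAbs + 2) Ω y
  have h2 := (weight_mode i (n + (n.natAbs + 2 : ℕ))).2
  have h3 : (i.mode (n + (n.natAbs + 2 : ℕ))).weight < 0 := by lia
  have h4 : 0 < (i.mode (n + (n.natAbs + 2 : ℕ))).adj.weight := by
    rw [N2Gen.weight_adj]; lia
  rw [adjDefect, adjDefect, fld, fld, hΩ.op_eq_zero h3.le, hpos _ h4, map_zero,
    LinearMap.zero_apply, sub_zero, mul_zero, sub_eq_zero] at h1
  exact h1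

end N2Modes

/-- The hypothesis is tested on `p(z) = 1 + z`, for which `p̄(z) = 1 + z⁻¹`. -/
theorem FormalSeries.adjoint_add_of_polyMul {V : Type*} [AddCommGroup V] [Module ℂ V]
    {B : V →ₗ⋆[ℂ] V →ₗ[ℂ] ℂ} {A A' : FormalSeries V}
    (h : ∀ p : LaurentPolynomial ℂ, trigEvalNegOne p = 0 →
      FormalSeries.IsDagger B (FormalSeries.polyMul p A)
        (FormalSeries.polyMul (trigConj p) A')) (n : ℤ) (x y : V) :
    B (A n x) y - B x (A' (-n) y) + (B (A (n + 1) x) y - B x (A' (-n - 1) y)) = 0 := by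
  have := h _ trigEvalNegOne_T_zero_add_T_one n x y
  simp only [trigConj_add, trigConj_T, polyMul_add, Pi.add_apply, polyMul_T, LinearMap.add_apply,
    map_add, add_zero, neg_zero] at this
  rw [← sub_eq_add_neg (-n)] at this
  linear_combination this

/-! ### The fields of a vacuum module -/

namespace N2Modes

open FormalDist FormalSeries

variable {V : Type*} [AddCommGroup V] [Module ℂ V] {X : N2Modes (Module.End ℂ V)} {Ω : V} {c : ℂ}

theorem disjoint_paritySpan (hX : X.IsN2 c) (hΩ : X.L 0 Ω = 0) (hcyc : IsCyclicVector X Ω) :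
    Disjoint (paritySpan X Ω 0) (paritySpan X Ω 1) := by
  obtain ⟨h0, h1⟩ := paritySpan_eq_iSup hX hΩ hcyc
  rw [h0, h1]
  have := (Module.End.eigenspaces_iSupIndep (X.L 0)).disjoint_biSup_biSup
    (s := Set.range fun n : ℤ => (n : ℂ)) (t := Set.range fun n : ℤ => (n : ℂ) - 1 / 2) ?_
  · simpa only [iSup_range] using this
  · rw [Set.disjoint_left]
    rintro _ ⟨m, rfl⟩ ⟨n, hn⟩
    have h2 : (2 * n - 1 : ℂ) = 2 * m := by simp only at hn; linear_combination 2 * hn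
    have h3 : 2 * n - 1 = 2 * m := by exact_mod_cast h2
    lia

theorem isCompl_paritySpan (hX : X.IsN2 c) (hΩ : X.L 0 Ω = 0) (hcyc : IsCyclicVector X Ω) :
    IsCompl (paritySpan X Ω 0) (paritySpan X Ω 1) :=
  ⟨disjoint_paritySpan hX hΩ hcyc, codisjoint_iff.2 (paritySpan_sup_eq_top hcyc)⟩

/-- The translation covariant fields of parity `i` on a vacuum module that are local with respect
to the generating fields and create a state from the vacuum. -/
def vertexFields (X : N2Modes (Module.End ℂ V)) (Ω : V) (i : ZMod 2) :
    Submodule ℂ (FormalSeries V) where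
  carrier := {A | IsField A ∧
    (∀ j n, ∀ x ∈ paritySpan X Ω j, A n x ∈ paritySpan X Ω (i + j)) ∧
    (∀ f : N2Field, IsLocal (superSign i f.parity) A (X.fld f)) ∧
    (∀ n, X.L (-1) * A n - A n * X.L (-1) = (-(n : ℂ)) • A (n - 1)) ∧
    ∀ n, 0 ≤ n → A n Ω = 0}
  zero_mem' := ⟨fun v => ⟨0, by simp⟩, by simp, fun _ => IsLocal.zero, by simp, by simp⟩
  add_mem' := by
    rintro A B ⟨h1, h2, h3, h4, h5⟩ ⟨k1, k2, k3, k4, k5⟩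
    refine ⟨fun v => ?_, fun j n x hx => add_mem (h2 j n x hx) (k2 j n x hx),
      fun f => (h3 f).add (k3 f), fun n => ?_, fun n hn => ?_⟩
    · obtain ⟨K, hK⟩ := h1 v
      obtain ⟨K', hK'⟩ := k1 v
      exact ⟨max K K', fun n hn => by
        simp [hK n (le_of_max_le_left hn), hK' n (le_of_max_le_right hn)]⟩
    · simp only [Pi.add_apply, smul_add, mul_add, add_mul, ← h4, ← k4]
      abel
    · simp [h5 n hn, k5 n hn]
  smul_mem' := by
    rintro a A ⟨h1, h2, h3, h4, h5⟩
    refine ⟨fun v => ?_, fun j n x hx => Submodule.smul_mem _ _ (h2 j n x hx),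
      fun f => (h3 f).smul a, fun n => ?_, fun n hn => ?_⟩
    · obtain ⟨K, hK⟩ := h1 v
      exact ⟨K, fun n hn => by simp [hK n hn]⟩
    · rw [Pi.smul_apply, Pi.smul_apply, mul_smul_comm, smul_mul_assoc, ← smul_sub, h4, smul_comm]
    · simp [h5 n hn]

section VertexFields

variable {i j : ZMod 2} {A B : FormalSeries V}

/-- Since `L_{-1} Ω = 0`, translation covariance computes all `A n Ω` with `n < 0` from `A (-1) Ω`.
The field then annihilates the vacuum, and `eq_zero_of_isLocal` applies. -/
theorem eq_zero_of_mem_vertexFields (h : IsVacuumModule X Ω c) (hA : A ∈ vertexFields X Ω i)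
    (h0 : A (-1) Ω = 0) : A = 0 := by
  obtain ⟨-, -, h3, h4, h5⟩ := hA
  have hn : ∀ k : ℕ, A (-1 - k) Ω = 0 := by
    intro k
    induction k with
    | zero => simpa using h0
    | succ k ih =>
      have := DFunLike.congr_fun (h4 (-1 - k)) Ω
      simp only [LinearMap.sub_apply, Module.End.mul_apply, ih, h.L_vac, map_zero, sub_self,
        LinearMap.smul_apply] at this
      have h6 := (smul_eq_zero.1 this.symm).resolve_left (by
        have : ((k : ℂ) + 1) ≠ 0 := by exact_mod_cast k.succ_ne_zero
        push_cast
        intro h; apply this; linear_combination h)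
      rw [← h6]
      congr 2; push_cast; ring
  refine eq_zero_of_isLocal (g := X.fld) (fun f => fld_isField h.isN2 h.lowest h.cyclic f)
    (fun W hW h' => h.cyclic.eq_top_of_fld hW h') h3 fun n => ?_
  rcases le_or_gt 0 n with hn' | hn'
  · exact h5 n hn'
  · have := hn (-1 - n).toNat
    rwa [Int.toNat_of_nonneg (by lia), sub_sub_cancel] at this

theorem eq_of_mem_vertexFields (h : IsVacuumModule X Ω c) (hA : A ∈ vertexFields X Ω i)
    (hB : B ∈ vertexFields X Ω i) (h0 : A (-1) Ω = B (-1) Ω) : A = B :=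
  sub_eq_zero.1 <| eq_zero_of_mem_vertexFields h (sub_mem hA hB) (by simp [h0])

/-- The identity field. -/
def oneField (V : Type*) [AddCommGroup V] [Module ℂ V] : FormalSeries V :=
  fun n => if n = -1 then 1 else 0

theorem oneField_isLocal (A : FormalSeries V) : IsLocal 1 (oneField V) A := by
  refine ⟨0, ?_⟩
  ext m n : 2
  simp only [pow_zero, Module.End.one_apply, bracket, oneField]
  split_ifs <;> simp

theorem oneField_mem_vertexFields : oneField V ∈ vertexFields X Ω 0 := by
  refine ⟨fun v => ⟨0, fun n hn => ?_⟩, fun j n x hx => ?_, fun f => ?_, fun n => ?_, fun n hn => ?_⟩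
  · rw [oneField, if_neg (by lia), LinearMap.zero_apply]
  · rw [zero_add, oneField]
    split_ifs
    · exact hx
    · exact zero_mem _
  · simpa using oneField_isLocal _
  · simp only [oneField]
    split_ifs with h1 h2 h2
    · lia
    · simp
    · obtain rfl : n = 0 := by lia
      simp
    · simp
  · rw [oneField, if_neg (by lia), LinearMap.zero_apply]

theorem fld_mem_vertexFields (h : IsVacuumModule X Ω c) (f : N2Field) :
    X.fld f ∈ vertexFields X Ω f.parity := by
  refine ⟨fld_isField h.isN2 h.lowest h.cyclic f, fun j n x hx => ?_, fld_isLocal h.isN2 f,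
    fld_translation h.isN2 f, fun n hn => ?_⟩
  · rw [← f.parity_mode n]
    exact op_mem_paritySpan _ hx
  · apply op_vacuum_eq_zero (c := c) h
    rintro ⟨h1, h2, h3, h4⟩
    cases f <;> simp [N2Field.mode, N2Gen.weight] at * <;> lia

/-- The modes of local fields act on the states of fields. -/
theorem exists_vertexField_mode (hA : A ∈ vertexFields X Ω i)
    (hB : B ∈ vertexFields X Ω j) (hAB : IsLocal (superSign i j) A B) (n : ℤ) :
    ∃ C ∈ vertexFields X Ω (i + j), C (-1) Ω = A n (B (-1) Ω) ∧
      ∀ ⦃k⦄ ⦃D : FormalSeries V⦄, IsLocal (superSign i k) A D → IsLocal (superSign j k) B D →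
        IsLocal (superSign (i + j) k) C D := by
  obtain ⟨N₀, hN₀⟩ := hAB
  -- The order of locality may be increased at will, so that `k = N - 1 - n` becomes a natural
  -- number for the prescribed `n`.
  obtain ⟨N, k, hN, hk⟩ : ∃ N k : ℕ, (subMul _ ^ N) (bracket (superSign i j) A B) = 0 ∧
      (N : ℤ) - k - 1 = n := by
    refine ⟨N₀ + n.natAbs + 1, (N₀ + n.natAbs - n).toNat,
      subMul_pow_eq_zero_of_le (by lia) hN₀, by lia⟩
  obtain ⟨a1, a2, a3, a4, a5⟩ := hA
  obtain ⟨b1, b2, b3, b4, b5⟩ := hB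
  obtain ⟨C, hC⟩ := exists_isProd a1 b1 hN k
  have hloc : ∀ ⦃k⦄ ⦃D : FormalSeries V⦄, IsLocal (superSign i k) A D →
      IsLocal (superSign j k) B D → IsLocal (superSign (i + j) k) C D := by
    intro k D h1 h2
    rw [superSign_add_left]
    exact hC.isLocal a1 b1 hN h1 h2
  obtain ⟨hc1, hc2⟩ := hC.creation hN a5 b5
  refine ⟨C, ⟨hC.isField a1 b1 hN, fun l t x hx => ?_, fun f => hloc (a3 f) (b3 f),
    hC.translation a1 b1 hN a4 b4, hc1⟩, by rw [hc2, hk], hloc⟩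
  refine hC.mem_of_forall (fun m n => ?_) t
  rw [add_assoc]
  exact a2 _ _ _ (b2 _ _ _ hx)

/-- Letters act through products with the generating fields. Locality with the fixed field `A` is
carried through the induction by Dong's lemma; it cannot yet be obtained from membership in
`vertexFields`. -/
theorem exists_vertexField_word (h : IsVacuumModule X Ω c) (hA : A ∈ vertexFields X Ω i)
    (w : List N2Gen) : ∃ C ∈ vertexFields X Ω (wordParity w), C (-1) Ω = X.word Ω w ∧
      IsLocal (superSign (wordParity w) i) C A := by
  induction w with
  | nil =>
    refine ⟨oneField V, oneField_mem_vertexFields, by simp [oneField], ?_⟩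
    simpa [wordParity] using oneField_isLocal _
  | cons g w ih =>
    obtain ⟨C, hC, hCΩ, hCA⟩ := ih
    obtain ⟨f, n, rfl⟩ := exists_mode g
    obtain ⟨D, hD, hDΩ, hDl⟩ := exists_vertexField_mode (fld_mem_vertexFields h f) hC
      (by rw [superSign_comm]; exact (hC.2.2.1 f).symm (superSign_mul_self _ _)) n
    have hp : wordParity (f.mode n :: w) = f.parity + wordParity w := by
      simp [wordParity, N2Field.parity_mode]
    rw [hp]
    refine ⟨D, hD, by rw [hDΩ, hCΩ]; rfl, hDl ?_ hCA⟩
    rw [superSign_comm]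
    exact (hA.2.2.1 f).symm (superSign_mul_self _ _)

theorem exists_vertexField_isLocal (h : IsVacuumModule X Ω c) (hA : A ∈ vertexFields X Ω i)
    {x : V} (hx : x ∈ paritySpan X Ω j) : ∃ C ∈ vertexFields X Ω j, C (-1) Ω = x ∧
      IsLocal (superSign j i) C A := by
  induction hx using Submodule.span_induction with
  | mem x hx =>
    obtain ⟨w, rfl, rfl⟩ := hx
    exact exists_vertexField_word h hA w
  | zero => exact ⟨0, zero_mem _, by simp, IsLocal.zero⟩
  | add x y _ _ hx hy =>
    obtain ⟨C, hC, h1, h2⟩ := hx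
    obtain ⟨D, hD, h3, h4⟩ := hy
    exact ⟨C + D, add_mem hC hD, by simp [h1, h3], h2.add h4⟩
  | smul a x _ hx =>
    obtain ⟨C, hC, h1, h2⟩ := hx
    exact ⟨a • C, Submodule.smul_mem _ _ hC, by simp [h1], h2.smul a⟩

theorem state_mem_paritySpan (hA : A ∈ vertexFields X Ω i) : A (-1) Ω ∈ paritySpan X Ω i := by
  simpa using hA.2.1 0 (-1) Ω (Submodule.subset_span ⟨[], rfl, rfl⟩)

/-- The state of `A` is also created by some field that is local with respect to `B`, and by
uniqueness that field is `A`. -/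
theorem isLocal_of_mem_vertexFields (h : IsVacuumModule X Ω c) (hA : A ∈ vertexFields X Ω i)
    (hB : B ∈ vertexFields X Ω j) : IsLocal (superSign i j) A B := by
  obtain ⟨C, hC, hCΩ, hCB⟩ := exists_vertexField_isLocal h hB (state_mem_paritySpan hA)
  rwa [eq_of_mem_vertexFields h hA hC hCΩ.symm]

end VertexFields

/-- The state-field correspondence of a vacuum module. -/
theorem exists_fieldMap (h : IsVacuumModule X Ω c) : ∃ Φ : V →ₗ[ℂ] FormalSeries V,
    (∀ i, ∀ a ∈ paritySpan X Ω i, Φ a ∈ vertexFields X Ω i) ∧ ∀ a, Φ a (-1) Ω = a := by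
  have hs : ∀ i, ∃ Φ : paritySpan X Ω i →ₗ[ℂ] FormalSeries V,
      ∀ a, Φ a ∈ vertexFields X Ω i ∧ Φ a (-1) Ω = a := by
    intro i
    have hex : ∀ a : paritySpan X Ω i, ∃ C ∈ vertexFields X Ω i, C (-1) Ω = a := fun a => by
      obtain ⟨C, hC, h1, -⟩ := exists_vertexField_isLocal h (oneField_mem_vertexFields) a.2
      exact ⟨C, hC, h1⟩
    choose f hf hfΩ using hex
    refine ⟨{ toFun := f, map_add' := fun a b => ?_, map_smul' := fun r a => ?_ },
      fun a => ⟨hf a, hfΩ a⟩⟩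
    · exact eq_of_mem_vertexFields h (hf _) (add_mem (hf a) (hf b)) (by simp [hfΩ])
    · exact eq_of_mem_vertexFields h (hf _) (Submodule.smul_mem _ _ (hf a)) (by simp [hfΩ])
  choose φ hφ using hs
  have hc := isCompl_paritySpan h.isN2 h.lowest.L_zero' h.cyclic
  refine ⟨LinearMap.ofIsCompl hc (φ 0) (φ 1), fun i a ha => ?_, fun a => ?_⟩
  · rcases ZMod.two_cases i with rfl | rfl
    · rw [LinearMap.ofIsCompl_apply_left hc ⟨a, ha⟩]
      exact (hφ 0 _).1
    · rw [LinearMap.ofIsCompl_apply_right hc ⟨a, ha⟩]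
      exact (hφ 1 _).1
  · have ha : a ∈ paritySpan X Ω 0 ⊔ paritySpan X Ω 1 := by
      rw [paritySpan_sup_eq_top h.cyclic]; trivial
    obtain ⟨u, hu, v, hv, rfl⟩ := Submodule.mem_sup.1 ha
    rw [map_add, LinearMap.ofIsCompl_apply_left hc ⟨u, hu⟩,
      LinearMap.ofIsCompl_apply_right hc ⟨v, hv⟩, Pi.add_apply, LinearMap.add_apply, (hφ 0 _).2,
      (hφ 1 _).2]

/-- A vertex superalgebra structure on a vacuum module whose generating fields are the `N = 2`
fields. -/
structure IsVacuumVOSA (X : N2Modes (Module.End ℂ V)) (Ω : V) (c : ℂ)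
    (Y : V →ₗ[ℂ] VertexOperator ℂ V) : Prop where
  isVacuumModule : IsVacuumModule X Ω c
  isVertexSuperalgebra : IsVertexSuperalgebra (paritySpan X Ω) Y Ω (X.L (-1))
  isN2StateField : IsN2StateField X Ω Y

theorem isField_nthProd (Y : V →ₗ[ℂ] VertexOperator ℂ V) (a : V) :
    IsField (nthProd Y a) := by
  intro v
  refine ⟨-(HahnSeries.order ((HahnModule.of ℂ).symm (Y a v))), fun n hn => ?_⟩
  exact VertexOperator.ncoeff_eq_zero_of_lt_order _ _ _ (by lia)

/-- Apart from mutual locality, the axioms are read off from membership in `vertexFields`, on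
homogeneous vectors and then on sums. -/
theorem exists_isVacuumVOSA (h : IsVacuumModule X Ω c) :
    ∃ Y : V →ₗ[ℂ] VertexOperator ℂ V, IsVacuumVOSA X Ω c Y := by
  obtain ⟨Φ, hΦ, hΦΩ⟩ := exists_fieldMap h
  have hc := isCompl_paritySpan h.isN2 h.lowest.L_zero' h.cyclic
  have hdec : ∀ (P : V → Prop), (∀ i, ∀ a ∈ paritySpan X Ω i, P a) →
      (∀ a b, P a → P b → P (a + b)) → ∀ a, P a := by
    intro P hP hadd a
    have ha : a ∈ paritySpan X Ω 0 ⊔ paritySpan X Ω 1 := by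
      rw [paritySpan_sup_eq_top h.cyclic]; trivial
    obtain ⟨u, hu, v, hv, rfl⟩ := Submodule.mem_sup.1 ha
    exact hadd _ _ (hP _ _ hu) (hP _ _ hv)
  have hfield : ∀ a, IsField (Φ a) := by
    refine hdec _ (fun i a ha => (hΦ i a ha).1) fun a b ha hb v => ?_
    obtain ⟨K, hK⟩ := ha v
    obtain ⟨K', hK'⟩ := hb v
    exact ⟨max K K', fun n hn => by
      simp [hK n (le_of_max_le_left hn), hK' n (le_of_max_le_right hn)]⟩
  have hbdd : ∀ a x, BddBelow (Function.support fun y : ℤ => Φ a (-y - 1) x) := by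
    intro a x
    obtain ⟨K, hK⟩ := hfield a x
    refine ⟨-K, fun y hy => ?_⟩
    by_contra hlt
    exact hy (hK _ (by lia))
  let Y : V →ₗ[ℂ] VertexOperator ℂ V :=
    { toFun := fun a => VertexOperator.of_coeff (fun y => Φ a (-y - 1)) (hbdd a)
      map_add' := fun a b => by
        apply HVertexOperator.coeff_inj
        ext n v
        change Φ (a + b) (-n - 1) v = Φ a (-n - 1) v + Φ b (-n - 1) v
        rw [map_add, Pi.add_apply, LinearMap.add_apply]
      map_smul' := fun r a => by
        apply HVertexOperator.coeff_inj
        ext n v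
        change Φ (r • a) (-n - 1) v = r • Φ a (-n - 1) v
        rw [map_smul, Pi.smul_apply, LinearMap.smul_apply] }
  have hY : ∀ a, nthProd Y a = Φ a := by
    intro a
    ext n : 1
    change VertexOperator.ncoeff (VertexOperator.of_coeff _ (hbdd a)) n = _
    rw [VertexOperator.ncoeff_of_coeff, show -(-n - 1) - 1 = n by ring]
  -- A field is recognized by its state. This yields both the vacuum axiom and the identification of
  -- the generating fields.
  have hst : ∀ i A, A ∈ vertexFields X Ω i → Φ (A (-1) Ω) = A := fun i A hA =>
    eq_of_mem_vertexFields h (hΦ i _ (state_mem_paritySpan hA)) hA (hΦΩ _)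
  have hfl : ∀ f : N2Field, Φ (X.fld f (-1) Ω) = X.fld f := fun f =>
    hst _ _ (fld_mem_vertexFields h f)
  refine ⟨Y, h, ⟨(isInternal_iff_isCompl _).2 hc, Submodule.subset_span ⟨[], rfl, rfl⟩,
    fun i x hx => ?_, fun i j a ha b hb n => ?_, fun n => ?_, fun a => ?_, fun a n hn => ?_, h.L_vac,
    fun a n => ?_, fun i j a ha b hb => ?_⟩, ⟨fun m => ?_, fun m => ?_, fun k => ?_, fun k => ?_⟩⟩
  · simpa [N2Gen.parity, op] using op_mem_paritySpan (.L (-1)) hx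
  · rw [hY]
    exact (hΦ i a ha).2.1 _ _ _ hb
  · have := hst 0 _ oneField_mem_vertexFields
    simp only [oneField, if_true, Module.End.one_apply] at this
    rw [hY, this]
    rfl
  · rw [hY, hΦΩ]
  · rw [hY]
    exact hdec (fun a => Φ a n Ω = 0) (fun i a ha => (hΦ i a ha).2.2.2.2 n hn)
      (fun a b ha hb => by simp [ha, hb]) a
  · rw [hY]
    refine hdec (fun a => X.L (-1) * Φ a n - Φ a n * X.L (-1) = (-(n : ℂ)) • Φ a (n - 1))
      (fun i a ha => (hΦ i a ha).2.2.2.1 n) (fun a b ha hb => ?_) a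
    simp only [map_add, Pi.add_apply, smul_add, mul_add, add_mul, ← ha, ← hb]
    abel
  · obtain ⟨N, hN⟩ := isLocal_of_mem_vertexFields h (hΦ i a ha) (hΦ j b hb)
    refine ⟨N, fun m n => ?_⟩
    rw [hY, hY]
    have := subMul_pow_apply N (bracket (superSign i j) (Φ a) (Φ b)) m n
    rw [hN] at this
    exact this.symm
  · have := congrFun (hfl .T) (m + 1)
    simp only [fld, N2Field.mode, op, add_sub_cancel_right] at this
    rw [hY, ← this]
    rfl
  · have := congrFun (hfl .J) m
    simp only [fld, N2Field.mode, op] at this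
    rw [hY, ← this]
  · have := congrFun (hfl .G1) (k + 1)
    simp only [fld, N2Field.mode, op, add_sub_cancel_right] at this
    rw [hY, ← this]
    rfl
  · have := congrFun (hfl .G2) (k + 1)
    simp only [fld, N2Field.mode, op, add_sub_cancel_right] at this
    rw [hY, ← this]
    rfl

end N2Modes

/-! ### Consequences of the vertex superalgebra structure -/

/-- Only additivity is required here, so that antilinear maps and the form in its first variable are
covered. -/
theorem FormalDist.subMul_pow_map_add {M M' : Type*} [AddCommGroup M] [Module ℂ M]
    [AddCommGroup M'] [Module ℂ M'] (f : M →+ M') (N : ℕ) (F : ℤ → ℤ → M) :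
    (subMul M' ^ N) (fun m n => f (F m n)) = fun m n => f ((subMul M ^ N) F m n) := by
  induction N with
  | zero => rfl
  | succ N ih =>
    ext m n
    rw [subMul_pow_succ, ih, subMul_pow_succ, map_sub]

namespace N2Modes

open FormalDist FormalSeries

variable {V : Type*} [AddCommGroup V] [Module ℂ V] {X : N2Modes (Module.End ℂ V)} {Ω : V} {c : ℂ}
  {Y : V →ₗ[ℂ] VertexOperator ℂ V}

theorem mem_paritySpan_induction (hcyc : IsCyclicVector X Ω) {P : V → Prop}
    (hP : ∀ i, ∀ a ∈ paritySpan X Ω i, P a) (hadd : ∀ a b, P a → P b → P (a + b)) (a : V) :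
    P a := by
  have ha : a ∈ paritySpan X Ω 0 ⊔ paritySpan X Ω 1 := by
    rw [paritySpan_sup_eq_top hcyc]; trivial
  obtain ⟨u, hu, v, hv, rfl⟩ := Submodule.mem_sup.1 ha
  exact hadd _ _ (hP _ _ hu) (hP _ _ hv)

theorem nthProd_add (a b : V) (n : ℤ) : nthProd Y (a + b) n = nthProd Y a n + nthProd Y b n := by
  simp [nthProd]

theorem nthProd_smul (r : ℂ) (a : V) (n : ℤ) : nthProd Y (r • a) n = r • nthProd Y a n := by
  simp [nthProd]

theorem nthProd_zero (n : ℤ) : nthProd Y 0 n = 0 := by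
  simp [nthProd]

namespace IsVacuumVOSA

theorem nthProd_fld (hY : IsVacuumVOSA X Ω c Y) (f : N2Field) :
    nthProd Y (X.fld f (-1) Ω) = X.fld f := by
  obtain ⟨h1, h2, h3, h4⟩ := hY.isN2StateField
  ext n : 1
  cases f
  · have := h1 (n - 1)
    rwa [sub_add_cancel] at this
  · exact h2 n
  · have := h3 (n - 1)
    rwa [sub_add_cancel] at this
  · have := h4 (n - 1)
    rwa [sub_add_cancel] at this

theorem isLocal_nthProd (hY : IsVacuumVOSA X Ω c Y) {i j : ZMod 2} {a b : V}
    (ha : a ∈ paritySpan X Ω i) (hb : b ∈ paritySpan X Ω j) :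
    IsLocal (superSign i j) (nthProd Y a) (nthProd Y b) := by
  obtain ⟨N, hN⟩ := hY.isVertexSuperalgebra.locality i j a ha b hb
  refine ⟨N, ?_⟩
  ext m n : 2
  rw [subMul_pow_apply]
  exact hN m n

theorem nthProd_mem_vertexFields (hY : IsVacuumVOSA X Ω c Y) {i : ZMod 2} {a : V}
    (ha : a ∈ paritySpan X Ω i) : nthProd Y a ∈ vertexFields X Ω i := by
  have hv := hY.isVertexSuperalgebra
  refine ⟨isField_nthProd Y a, fun j n x hx => hv.parity_nthProd i j a ha x hx n, fun f => ?_,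
    hv.translation a, hv.creation_nonneg a⟩
  rw [← hY.nthProd_fld f]
  exact hY.isLocal_nthProd ha
    (state_mem_paritySpan (fld_mem_vertexFields hY.isVacuumModule f))

theorem nthProd_state (hY : IsVacuumVOSA X Ω c Y) {i : ZMod 2} {A : FormalSeries V}
    (hA : A ∈ vertexFields X Ω i) : nthProd Y (A (-1) Ω) = A :=
  eq_of_mem_vertexFields hY.isVacuumModule
    (hY.nthProd_mem_vertexFields (state_mem_paritySpan hA)) hA
    (hY.isVertexSuperalgebra.creation _)

end IsVacuumVOSA

/-- Residues of commutators are again admissible fields, by Dong's lemma. On `Ω` only the leading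
term survives, so their states are the products that occur in Borcherds' formula. -/
theorem resProd_mem_vertexFields {i j : ZMod 2} {A B : FormalSeries V}
    (hA : A ∈ vertexFields X Ω i) (hB : B ∈ vertexFields X Ω j)
    (hAB : IsLocal (superSign i j) A B) (l : ℕ) :
    resProd (superSign i j) l A B ∈ vertexFields X Ω (i + j) ∧
      resProd (superSign i j) l A B (-1) Ω = A l (B (-1) Ω) := by
  obtain ⟨a1, a2, a3, a4, a5⟩ := hA
  obtain ⟨b1, b2, b3, b4, b5⟩ := hB
  have happ : ∀ t v, resProd (superSign i j) l A B t v =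
      ∑ k ∈ Finset.range (l + 1), ((-1 : ℂ) ^ k * (l.choose k : ℂ)) •
        (A (0 + l - k) (B (t + k) v) - superSign i j • B (t + k) (A (0 + l - k) v)) := by
    intro t v
    rw [resProd, subMul_pow_apply, LinearMap.sum_apply]
    rfl
  have hpos : ∀ k ∈ Finset.range (l + 1), (0 : ℤ) ≤ 0 + l - k := by
    intro k hk
    have := Finset.mem_range.1 hk
    lia
  refine ⟨⟨fun v => ?_, fun k t x hx => ?_, fun f => ?_, fun n => ?_, fun n hn => ?_⟩, ?_⟩
  · have hk : ∀ k : ℕ, ∃ K : ℤ, ∀ t, K ≤ t →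
        A (0 + l - k) (B (t + k) v) - superSign i j • B (t + k) (A (0 + l - k) v) = 0 := by
      intro k
      obtain ⟨K₁, h₁⟩ := b1 v
      obtain ⟨K₂, h₂⟩ := b1 (A (0 + l - k) v)
      exact ⟨max K₁ K₂, fun t ht => by
        rw [h₁ _ (by linarith [le_max_left K₁ K₂, (Nat.cast_nonneg k : (0 : ℤ) ≤ k)]),
          h₂ _ (by linarith [le_max_right K₁ K₂, (Nat.cast_nonneg k : (0 : ℤ) ≤ k)])]
        simp⟩
    choose K hK using hk
    obtain ⟨M, hM⟩ := ((Finset.range (l + 1)).image K).bddAbove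
    refine ⟨M, fun t ht => ?_⟩
    rw [happ]
    refine Finset.sum_eq_zero fun k hk => ?_
    rw [hK k t ((hM (Finset.mem_coe.2 (Finset.mem_image_of_mem K hk))).trans ht), smul_zero]
  · rw [happ]
    refine sum_mem fun k _ => Submodule.smul_mem _ _ (sub_mem ?_ (Submodule.smul_mem _ _ ?_))
    · rw [add_assoc]
      exact a2 _ _ _ (b2 _ _ _ hx)
    · rw [add_comm i j, add_assoc]
      exact b2 _ _ _ (a2 _ _ _ hx)
  · rw [superSign_add_left]
    exact hAB.resProd (a3 f) (b3 f) l
  · have h1 : ∀ m n, X.L (-1) * bracket (superSign i j) A B m n -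
        bracket (superSign i j) A B m n * X.L (-1) = transl (bracket (superSign i j) A B) m n := by
      intro m n
      have h2 := comm_mul_eq_transl a4 b4 m n
      have h3 := comm_mul_eq_transl b4 a4 n m
      simp only [transl] at h2 h3
      simp only [transl, bracket, mul_sub, sub_mul, mul_smul_comm, smul_mul_assoc]
      rw [sub_sub_sub_comm, h2, ← smul_sub, h3]
      module
    have := comm_subMul_pow_eq_transl h1 l 0 n
    rw [resProd, this]
    simp [transl, resProd]
  · rw [happ]
    refine Finset.sum_eq_zero fun k hk => ?_
    rw [a5 _ (hpos k hk), b5 _ (by lia)]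
    simp
  · rw [happ, Finset.sum_range_succ', Finset.sum_eq_zero]
    · simp [a5]
    · intro k hk
      rw [a5 _ (hpos (k + 1) (by simpa using hk)), b5 _ (by push_cast; lia)]
      simp

namespace IsVacuumVOSA

/-- Borcherds' commutator formula. -/
theorem bracket_nthProd (hY : IsVacuumVOSA X Ω c Y) {i j : ZMod 2} {a b : V}
    (ha : a ∈ paritySpan X Ω i) (hb : b ∈ paritySpan X Ω j) : ∃ N₀ : ℕ, ∀ N, N₀ ≤ N → ∀ m n,
    nthProd Y a m * nthProd Y b n - superSign i j • (nthProd Y b n * nthProd Y a m) =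
      ∑ l ∈ Finset.range N, cbinom m l • nthProd Y (nthProd Y a l b) (m + n - l) := by
  have hab := hY.isLocal_nthProd ha hb
  obtain ⟨N₀, hN₀⟩ := hab
  refine ⟨N₀, fun N hN m n => ?_⟩
  refine (eq_sum_residues (subMul_pow_eq_zero_of_le hN hN₀) m n).trans ?_
  refine Finset.sum_congr rfl fun l _ => ?_
  obtain ⟨h1, h2⟩ := resProd_mem_vertexFields (hY.nthProd_mem_vertexFields ha)
    (hY.nthProd_mem_vertexFields hb) ⟨N₀, hN₀⟩ l
  rw [hY.isVertexSuperalgebra.creation] at h2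
  rw [← h2, hY.nthProd_state h1]
  rfl

end IsVacuumVOSA

/-- The vertex operator superalgebra of a vacuum module. -/
def vosa (X : N2Modes (Module.End ℂ V)) (Ω : V) (Y : V →ₗ[ℂ] VertexOperator ℂ V) :
    VOSAData V where
  parity := paritySpan X Ω
  Y := Y
  vacuum := Ω
  conformal := X.L (-2) Ω

theorem vosa_L (hY : IsN2StateField X Ω Y) (m : ℤ) : (vosa X Ω Y).L m = X.L m :=
  hY.L_eq m

theorem vosa_weightSpace (hY : IsN2StateField X Ω Y) (d : ℂ) :
    (vosa X Ω Y).weightSpace d = (X.L 0).eigenspace d := by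
  rw [VOSAData.weightSpace, vosa_L hY]

theorem IsVacuumVOSA.isVOSA (hY : IsVacuumVOSA X Ω c Y) : (vosa X Ω Y).IsVOSA c := by
  have h := hY.isVacuumModule
  have hN := hY.isN2StateField
  obtain ⟨p0, p1⟩ := paritySpan_eq_iSup h.isN2 h.lowest.L_zero' h.cyclic
  refine ⟨?_, ?_, fun m n => ?_, ?_, ?_, fun k => ?_, 0, fun k hk => ?_⟩
  · rw [vosa_L hN]
    exact hY.isVertexSuperalgebra
  · exact state_mem_paritySpan (fld_mem_vertexFields h .T)
  · rw [vosa_L hN, vosa_L hN, vosa_L hN, h.isN2.L_L]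
    simp only [Algebra.algebraMap_eq_smul_one]
  · simp only [vosa_weightSpace hN]
    exact p0
  · simp only [vosa_weightSpace hN]
    exact p1
  · rw [vosa_weightSpace hN]
    exact finiteDimensional_eigenspace h.isN2 h.lowest h.cyclic k
  · rw [vosa_weightSpace hN]
    refine eigenspace_eq_bot h.isN2 h.lowest h.cyclic fun m hm => ?_
    have h1 : (k : ℂ) = m := by linear_combination 2 * hm
    have h2 : k = m := by exact_mod_cast h1
    subst h2
    push_cast at hk
    have : (0 : ℝ) ≤ m := Nat.cast_nonneg m
    linarith

/-! ### Irreducibility -/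

/-- There are no non-trivial submodules. -/
def IsIrreducible (X : N2Modes (Module.End ℂ V)) : Prop :=
  ∀ W : Submodule ℂ V, (∀ g, ∀ x ∈ W, X.op g x ∈ W) → W = ⊥ ∨ W = ⊤

/-- An ideal is stable under the modes of the generating fields, hence a submodule. -/
theorem IsVacuumVOSA.isSimple (hY : IsVacuumVOSA X Ω c Y) (hX : IsIrreducible X) :
    (vosa X Ω Y).IsSimple := by
  intro I hI
  refine hX I fun g x hx => ?_
  obtain ⟨f, n, rfl⟩ := exists_mode g
  have := hI (X.fld f (-1) Ω) x hx n
  rwa [vosa, hY.nthProd_fld] at this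

theorem aeval_mem {W : Submodule ℂ V} {A : Module.End ℂ V} (hA : ∀ x ∈ W, A x ∈ W)
    (p : Polynomial ℂ) {x : V} (hx : x ∈ W) : Polynomial.aeval A p x ∈ W := by
  induction p using Polynomial.induction_on' with
  | add p q hp hq => rw [map_add]; exact add_mem hp hq
  | monomial n a =>
    rw [Polynomial.aeval_monomial, Module.End.mul_apply, Module.algebraMap_end_apply]
    refine Submodule.smul_mem _ _ ?_
    induction n with
    | zero => simpa using hx
    | succ n ih => rw [pow_succ', Module.End.mul_apply]; exact hA _ ih

/-- A submodule that misses `Ω` has no weight-zero part, since that part would be a multiple of `Ω`.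
It is thus orthogonal to `Ω`, by invariance to the module generated by `Ω`, and in particular to
itself. -/
theorem IsVacuumModule.isIrreducible (h : IsVacuumModule X Ω c) {B : V →ₗ⋆[ℂ] V →ₗ[ℂ] ℂ}
    (hB : IsScalarProduct B) (hBX : IsInvariantForm X B) : IsIrreducible X := by
  intro W hW
  by_cases hΩ : Ω ∈ W
  · exact Or.inr (h.cyclic.eq_top_of_op hΩ hW)
  left
  have h1 : ∀ x ∈ W, B Ω x = 0 := by
    intro x hx
    obtain ⟨p, hp, hpx⟩ := exists_aeval_mem_wordSpan h.isN2 h.cyclic h.lowest.L_zero'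
      (op_vacuum_eq_zero h) 0 x
    rw [← eigenspace_eq_wordSpan h.isN2 h.cyclic h.lowest.L_zero' (op_vacuum_eq_zero h),
      eigenspace_zero_eq h.isN2 h.lowest h.cyclic] at hpx
    obtain ⟨t, ht⟩ := Submodule.mem_span_singleton.1 hpx
    have hW' := aeval_mem (hW (.L 0)) p hx
    change Polynomial.aeval (X.L 0) p x ∈ W at hW'
    rw [← ht] at hW'
    have ht0 : t = 0 := by
      by_contra hne
      exact hΩ ((Submodule.smul_mem_iff _ hne).1 hW')
    -- `L_0` is symmetric and kills `Ω`, so only the constant term of `q` is seen. For `q = p` the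
    -- left side is zero although `p(0) ≠ 0`.
    have h2 : ∀ (q : Polynomial ℂ), B Ω (Polynomial.aeval (X.L 0) q x) = q.eval 0 * B Ω x := by
      intro q
      induction q using Polynomial.induction_on' with
      | add p q hp hq => rw [map_add, LinearMap.add_apply, map_add, hp, hq, Polynomial.eval_add,
          add_mul]
      | monomial n a =>
        rw [Polynomial.aeval_monomial, Module.End.mul_apply, Module.algebraMap_end_apply, map_smul]
        cases n with
        | zero => simp
        | succ n =>
          have := hBX (.L 0) Ω ((X.L 0 ^ n) x)
          simp only [op, N2Gen.adj, neg_zero, h.lowest.L_zero', map_zero,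
            LinearMap.zero_apply] at this
          rw [pow_succ', Module.End.mul_apply, ← this]
          simp
    have h3 := h2 p
    rw [← ht, ht0, zero_smul, map_zero] at h3
    exact (mul_eq_zero.1 h3.symm).resolve_left hp
  rw [eq_bot_iff]
  intro x hx
  have h2 : ∀ y, ∀ x ∈ W, B y x = 0 := by
    let U : Submodule ℂ V :=
      { carrier := {y | ∀ x ∈ W, B y x = 0}
        zero_mem' := by simp
        add_mem' := by
          intro a b ha hb x hx
          simp [ha x hx, hb x hx]
        smul_mem' := by
          intro a y hy x hx
          simp [hy x hx] }
    have hU : U = ⊤ := h.cyclic.eq_top_of_op h1 fun g y hy x hx => by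
      rw [hBX]
      exact hy _ (hW _ _ hx)
    intro y
    exact (hU ▸ Submodule.mem_top : y ∈ U)
  by_contra hne
  have := hB.pos x (fun h0 => hne (by simp [h0]))
  rw [h2 x x hx] at this
  simp at this

/-! ### Transport of fields along semilinear isomorphisms -/

section Transport

variable {V' : Type*} [AddCommGroup V'] [Module ℂ V'] {X' : N2Modes (Module.End ℂ V')} {Ω' : V'}
  {c' : ℂ} {Y' : V' →ₗ[ℂ] VertexOperator ℂ V'} {σ σ' : ℂ →+* ℂ} [RingHomInvPair σ σ']
  [RingHomInvPair σ' σ]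

/-- The series `φ A(z) φ⁻¹`. -/
def transport (φ : V ≃ₛₗ[σ] V') (A : FormalSeries V) : FormalSeries V' :=
  fun n => (φ.toLinearMap.comp (A n)).comp φ.symm.toLinearMap

theorem transport_apply (φ : V ≃ₛₗ[σ] V') (A : FormalSeries V) (n : ℤ) (x : V') :
    transport φ A n x = φ (A n (φ.symm x)) := rfl

/-- The signs `s f` allow for `J ↦ -J`; the sign of `T` must be `1` because translation is a mode of
`T`. Semilinearity is harmless for locality, whose coefficients are real. -/
theorem transport_mem_vertexFields {φ : V ≃ₛₗ[σ] V'} (hΩ : φ Ω = Ω') {s : N2Field → ℂ}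
    (hs : ∀ f, s f * s f = 1) (hT : s .T = 1)
    (hφ : ∀ f n x, φ (X.fld f n x) = s f • X'.fld f n (φ x)) {i : ZMod 2} {A : FormalSeries V}
    (hA : A ∈ vertexFields X Ω i) : transport φ A ∈ vertexFields X' Ω' i := by
  have hφ' : ∀ f n x, X'.fld f n (φ x) = s f • φ (X.fld f n x) := by
    intro f n x
    rw [hφ, smul_smul, hs, one_smul]
  have hsurj : ∀ (j : ZMod 2), ∀ y ∈ paritySpan X' Ω' j, ∃ x ∈ paritySpan X Ω j, φ x = y := by
    intro j y hy
    suffices paritySpan X' Ω' j ≤ (paritySpan X Ω j).map φ.toLinearMap by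
      obtain ⟨x, hx, rfl⟩ := this hy
      exact ⟨x, hx, rfl⟩
    rw [paritySpan, Submodule.span_le]
    rintro _ ⟨w, rfl, rfl⟩
    clear hy
    induction w with
    | nil => exact ⟨Ω, Submodule.subset_span ⟨[], rfl, rfl⟩, hΩ⟩
    | cons g w ih =>
      obtain ⟨x, hx, hxw⟩ := ih
      obtain ⟨f, n, rfl⟩ := exists_mode g
      change φ x = _ at hxw
      rw [word_cons, ← hxw]
      change X'.fld f n (φ x) ∈ _
      rw [hφ']
      exact Submodule.smul_mem _ _ ⟨_, op_mem_paritySpan (f.mode n) hx, rfl⟩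
  have hmem : ∀ (j : ZMod 2), ∀ x ∈ paritySpan X Ω j, φ x ∈ paritySpan X' Ω' j := by
    intro j x hx
    suffices paritySpan X Ω j ≤ (paritySpan X' Ω' j).comap φ.toLinearMap from this hx
    rw [paritySpan, Submodule.span_le]
    rintro _ ⟨w, rfl, rfl⟩
    clear hx
    induction w with
    | nil => exact Submodule.subset_span ⟨[], rfl, hΩ.symm⟩
    | cons g w ih =>
      obtain ⟨f, n, rfl⟩ := exists_mode g
      replace ih : φ (X.word Ω w) ∈ paritySpan X' Ω' (wordParity w) := ih
      change φ (X.fld f n _) ∈ paritySpan X' Ω' (wordParity (f.mode n :: w))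
      rw [hφ]
      exact Submodule.smul_mem _ _ (op_mem_paritySpan (f.mode n) ih)
  obtain ⟨h1, h2, h3, h4, h5⟩ := hA
  have hL : ∀ x, φ (X.L (-1) x) = X'.L (-1) (φ x) := by
    intro x
    have := hφ .T 0 x
    rwa [hT, one_smul] at this
  refine ⟨fun v => ?_, fun j n y hy => ?_, fun f => ?_, fun n => ?_, fun n hn => ?_⟩
  · obtain ⟨K, hK⟩ := h1 (φ.symm v)
    exact ⟨K, fun n hn => by rw [transport_apply, hK n hn, map_zero]⟩
  · obtain ⟨x, hx, rfl⟩ := hsurj j y hy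
    rw [transport_apply, φ.symm_apply_apply]
    exact hmem _ _ (h2 _ _ _ hx)
  · obtain ⟨N, hN⟩ := h3 f
    refine ⟨N, ?_⟩
    let F : Module.End ℂ V →+ Module.End ℂ V' :=
      { toFun := fun A => s f • ((φ.toLinearMap.comp A).comp φ.symm.toLinearMap)
        map_zero' := by ext x; simp
        map_add' := fun A B => by ext x; simp }
    have hσ : σ (superSign i f.parity) = superSign i f.parity := by
      simp [superSign]
    have h6 : bracket (superSign i f.parity) (transport φ A) (X'.fld f) =
        fun m n => F (bracket (superSign i f.parity) A (X.fld f) m n) := by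
      ext m n y
      obtain ⟨x, rfl⟩ := φ.surjective y
      simp only [bracket, F, transport, LinearMap.sub_apply, LinearMap.smul_apply,
        Module.End.mul_apply, LinearMap.comp_apply, LinearEquiv.coe_coe, AddMonoidHom.coe_mk,
        ZeroHom.coe_mk, φ.symm_apply_apply, hφ', map_sub, map_smulₛₗ, hσ]
      rw [RingHom.id_apply, smul_comm (superSign i f.parity)]
    rw [h6, subMul_pow_map_add, hN]
    ext m n : 2
    exact map_zero F
  · ext y
    obtain ⟨x, rfl⟩ := φ.surjective y
    have := congrArg φ (DFunLike.congr_fun (h4 n) x)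
    simp only [LinearMap.sub_apply, Module.End.mul_apply, LinearMap.smul_apply, map_sub, hL,
      map_smulₛₗ] at this
    simp only [LinearMap.sub_apply, Module.End.mul_apply, LinearMap.smul_apply, transport_apply,
      φ.symm_apply_apply]
    rw [← hL x, φ.symm_apply_apply, this]
    simp
  · rw [transport_apply, ← hΩ, φ.symm_apply_apply, h5 n hn, map_zero]

/-- A semilinear isomorphism that intertwines the generating fields up to signs is an isomorphism
of vertex superalgebras. -/
theorem IsVacuumVOSA.map_nthProd (hY : IsVacuumVOSA X Ω c Y) (hY' : IsVacuumVOSA X' Ω' c' Y')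
    {φ : V ≃ₛₗ[σ] V'} (hΩ : φ Ω = Ω') {s : N2Field → ℂ} (hs : ∀ f, s f * s f = 1) (hT : s .T = 1)
    (hφ : ∀ f n x, φ (X.fld f n x) = s f • X'.fld f n (φ x)) (a : V) (n : ℤ) (b : V) :
    φ (nthProd Y a n b) = nthProd Y' (φ a) n (φ b) := by
  refine mem_paritySpan_induction (P := fun a => φ (nthProd Y a n b) = nthProd Y' (φ a) n (φ b))
    hY.isVacuumModule.cyclic (fun i a ha => ?_) (fun a a' h h' => ?_) a
  · have h1 := transport_mem_vertexFields hΩ hs hT hφ (hY.nthProd_mem_vertexFields ha)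
    have h2 := hY'.nthProd_state h1
    rw [transport_apply, ← hΩ, φ.symm_apply_apply, hY.isVertexSuperalgebra.creation] at h2
    rw [h2, transport_apply, φ.symm_apply_apply]
  · rw [nthProd_add, map_add, nthProd_add, LinearMap.add_apply, LinearMap.add_apply, map_add, h, h']

end Transport

theorem IsVacuumVOSA.isIso {V' : Type*} [AddCommGroup V'] [Module ℂ V']
    {X' : N2Modes (Module.End ℂ V')} {Ω' : V'} {c' : ℂ} {Y' : V' →ₗ[ℂ] VertexOperator ℂ V'}
    (hY : IsVacuumVOSA X Ω c Y) (hY' : IsVacuumVOSA X' Ω' c' Y') {φ : V ≃ₗ[ℂ] V'}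
    (hΩ : φ Ω = Ω') (hφ : ∀ g x, φ (X.op g x) = X'.op g (φ x)) :
    (vosa X Ω Y).IsIso (vosa X' Ω' Y') φ := by
  have hword : ∀ w, φ (X.word Ω w) = X'.word Ω' w := by
    intro w
    induction w with
    | nil => exact hΩ
    | cons g w ih => rw [word_cons, hφ, ih, word_cons]
  refine ⟨fun i => ?_, hΩ, ?_, fun a n b => ?_⟩
  · change (paritySpan X Ω i).map φ.toLinearMap = paritySpan X' Ω' i
    rw [paritySpan, Submodule.map_span, paritySpan]
    congr 1
    ext y
    constructor
    · rintro ⟨_, ⟨w, hw, rfl⟩, rfl⟩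
      exact ⟨w, hw, (hword w).symm⟩
    · rintro ⟨w, hw, rfl⟩
      exact ⟨_, ⟨w, hw, rfl⟩, hword w⟩
  · have := hφ (.L (-2)) Ω
    rw [hΩ] at this
    exact this
  · exact hY.map_nthProd hY' (s := fun _ => 1) hΩ (by simp) rfl
      (fun f n x => by rw [one_smul]; exact hφ _ x) a n b

end N2Modes

/-! ### The irreducible vacuum module -/

namespace N2Modes

variable {V : Type*} [AddCommGroup V] [Module ℂ V] {X : N2Modes (Module.End ℂ V)} {Ω : V} {c : ℂ}

/-- The homomorphism from the enveloping algebra defined by a representation. -/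
theorem IsN2.exists_algHom {A : Type*} [Ring A] [Algebra ℂ A] {X : N2Modes A} (hX : X.IsN2 c) :
    ∃ π : N2Env c →ₐ[ℂ] A, ∀ g, π (N2Env.gen c g) = X.op g := by
  have hL : ∀ m, FreeAlgebra.lift ℂ X.op (N2Modes.free.L m) = X.L m := fun m => by
    simp [free, op]
  have hJ : ∀ m, FreeAlgebra.lift ℂ X.op (N2Modes.free.J m) = X.J m := fun m => by
    simp [free, op]
  have hG1 : ∀ m, FreeAlgebra.lift ℂ X.op (N2Modes.free.G1 m) = X.G1 m := fun m => by
    simp [free, op]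
  have hG2 : ∀ m, FreeAlgebra.lift ℂ X.op (N2Modes.free.G2 m) = X.G2 m := fun m => by
    simp [free, op]
  refine ⟨RingQuot.liftAlgHom ℂ ⟨FreeAlgebra.lift ℂ X.op, ?_⟩, fun g => ?_⟩
  · intro x y hxy
    have hite : ∀ (b : Prop) [Decidable b] (z : ℂ),
        FreeAlgebra.lift ℂ X.op (if b then algebraMap ℂ _ z else 0) =
          if b then algebraMap ℂ A z else 0 := by
      intro b _ z
      split_ifs <;> simp
    have hmul : ∀ x y, FreeAlgebra.lift ℂ X.op (x * y) =
        FreeAlgebra.lift ℂ X.op x * FreeAlgebra.lift ℂ X.op y := map_mul _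
    cases hxy <;> simp only [map_sub, map_add, hmul, map_smul, hL, hJ, hG1, hG2, hite]
    exacts [hX.L_L _ _, hX.L_J _ _, hX.J_J _ _, hX.L_G1 _ _, hX.L_G2 _ _, hX.G1_G1 _ _,
      hX.G2_G2 _ _, hX.G1_G2 _ _, hX.G1_J _ _, hX.G2_J _ _]
  · exact (RingQuot.liftAlgHom_mkAlgHom_apply ℂ _ _ _).trans (FreeAlgebra.lift_ι_apply _ _)

/-- The image of a family of modes under an algebra homomorphism. -/
def mapAlgHom {A A' : Type*} [Ring A] [Algebra ℂ A] [Ring A'] [Algebra ℂ A'] (f : A →ₐ[ℂ] A')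
    (X : N2Modes A) : N2Modes A' where
  L m := f (X.L m)
  J m := f (X.J m)
  G1 k := f (X.G1 k)
  G2 k := f (X.G2 k)

theorem IsN2.mapAlgHom {A A' : Type*} [Ring A] [Algebra ℂ A] [Ring A'] [Algebra ℂ A']
    (f : A →ₐ[ℂ] A') {X : N2Modes A} (hX : X.IsN2 c) : (X.mapAlgHom f).IsN2 c where
  L_L m n := by simpa [N2Modes.mapAlgHom, apply_ite] using congrArg f (hX.L_L m n)
  L_J m n := by simpa [N2Modes.mapAlgHom, apply_ite] using congrArg f (hX.L_J m n)
  J_J m n := by simpa [N2Modes.mapAlgHom, apply_ite] using congrArg f (hX.J_J m n)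
  L_G1 m n := by simpa [N2Modes.mapAlgHom, apply_ite] using congrArg f (hX.L_G1 m n)
  L_G2 m n := by simpa [N2Modes.mapAlgHom, apply_ite] using congrArg f (hX.L_G2 m n)
  G1_G1 m n := by simpa [N2Modes.mapAlgHom, apply_ite] using congrArg f (hX.G1_G1 m n)
  G2_G2 m n := by simpa [N2Modes.mapAlgHom, apply_ite] using congrArg f (hX.G2_G2 m n)
  G1_G2 m n := by simpa [N2Modes.mapAlgHom, apply_ite] using congrArg f (hX.G1_G2 m n)
  G1_J m n := by simpa [N2Modes.mapAlgHom, apply_ite] using congrArg f (hX.G1_J m n)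
  G2_J m n := by simpa [N2Modes.mapAlgHom, apply_ite] using congrArg f (hX.G2_J m n)

/-- The modes acting on the quotient of the enveloping algebra by a left ideal. -/
noncomputable def quot (I : Submodule (N2Env c) (N2Env c)) :
    N2Modes (Module.End ℂ (N2Env c ⧸ I)) :=
  (N2Env.modes c).mapAlgHom (Algebra.lsmul ℂ ℂ (N2Env c ⧸ I))

theorem op_quot (I : Submodule (N2Env c) (N2Env c)) (g : N2Gen) :
    (quot I).op g = Algebra.lsmul ℂ ℂ (N2Env c ⧸ I) (N2Env.gen c g) := by
  cases g <;> rfl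

theorem op_quot_mk (I : Submodule (N2Env c) (N2Env c)) (g : N2Gen) (u : N2Env c) :
    (quot I).op g (Submodule.Quotient.mk u) = Submodule.Quotient.mk (N2Env.gen c g * u) := by
  rw [op_quot]
  rfl

theorem _root_.N2Env.induction {P : N2Env c → Prop} (h1 : P 1)
    (hadd : ∀ u v, P u → P v → P (u + v)) (hsmul : ∀ (r : ℂ) u, P u → P (r • u))
    (hmul : ∀ g u, P u → P (N2Env.gen c g * u)) (u : N2Env c) : P u := by
  have hsurj : Function.Surjective (N2Env.mk c) := RingQuot.mkAlgHom_surjective ℂ (N2Rel c)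
  suffices ∀ (a : FreeAlgebra ℂ N2Gen) (u : N2Env c), P u → P (N2Env.mk c a * u) by
    obtain ⟨a, rfl⟩ := hsurj u
    simpa using this a 1 h1
  intro a
  induction a using FreeAlgebra.induction with
  | grade0 r =>
    intro u hu
    rw [AlgHom.commutes, ← Algebra.smul_def]
    exact hsmul r u hu
  | grade1 g => exact hmul g
  | mul a b ha hb =>
    intro u hu
    rw [map_mul, mul_assoc]
    exact ha _ (hb _ hu)
  | add a b ha hb =>
    intro u hu
    rw [map_add, add_mul]
    exact hadd _ _ (ha _ hu) (hb _ hu)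

theorem isCyclicVector_quot (I : Submodule (N2Env c) (N2Env c)) :
    IsCyclicVector (quot I) (Submodule.Quotient.mk 1) := by
  intro W h1 hW
  have hop : ∀ g, ∀ x ∈ W, (quot I).op g x ∈ W := by
    intro g x hx
    cases g
    exacts [(hW _ x hx).1, (hW _ x hx).2.1, (hW _ x hx).2.2.1, (hW _ x hx).2.2.2]
  rw [eq_top_iff]
  rintro x -
  obtain ⟨u, rfl⟩ := Submodule.Quotient.mk_surjective I x
  refine N2Env.induction (P := fun u => Submodule.Quotient.mk u ∈ W) h1 (fun u v hu hv => ?_)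
    (fun r u hu => ?_) (fun g u hu => ?_) u
  · rw [Submodule.Quotient.mk_add]; exact add_mem hu hv
  · rw [Submodule.Quotient.mk_smul]; exact Submodule.smul_mem _ _ hu
  · rw [← op_quot_mk]; exact hop g _ hu

theorem gen_mem_N2VermaIdeal {g : N2Gen} (hg : ¬ 0 < g.weight) :
    N2Env.gen c g ∈ N2VermaIdeal c := by
  apply Submodule.subset_span
  cases g with
  | L m => exact Or.inl ⟨m, by simp only [N2Gen.weight] at hg; lia, Or.inl rfl⟩
  | J m => exact Or.inl ⟨m, by simp only [N2Gen.weight] at hg; lia, Or.inr rfl⟩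
  | G1 m => exact Or.inr ⟨m, by simp only [N2Gen.weight] at hg; lia, Or.inl rfl⟩
  | G2 m => exact Or.inr ⟨m, by simp only [N2Gen.weight] at hg; lia, Or.inr rfl⟩

/-- The annihilator of the vacuum of an irreducible vacuum module is the largest proper left ideal
containing the Verma ideal. -/
theorem mem_N2MaxIdeal_iff (h : IsVacuumModule X Ω c) (hirr : IsIrreducible X)
    {π : N2Env c →ₐ[ℂ] Module.End ℂ V} (hπ : ∀ g, π (N2Env.gen c g) = X.op g) (u : N2Env c) :
    u ∈ N2MaxIdeal c ↔ π u Ω = 0 := by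
  let K : Submodule (N2Env c) (N2Env c) :=
    { carrier := {u | π u Ω = 0}
      zero_mem' := by simp
      add_mem' := by
        intro a b ha hb
        simp only [Set.mem_ofPred_eq] at ha hb ⊢
        rw [map_add, LinearMap.add_apply, ha, hb, add_zero]
      smul_mem' := by
        intro a b hb
        simp only [Set.mem_ofPred_eq] at hb ⊢
        rw [smul_eq_mul, map_mul, Module.End.mul_apply, hb, map_zero] }
  have hVK : N2VermaIdeal c ≤ K := by
    rw [N2VermaIdeal, Submodule.span_le]
    have hg : ∀ g : N2Gen, g.weight ≤ 0 → N2Env.gen c g ∈ K := by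
      intro g hg
      change π _ Ω = 0
      rw [hπ, h.lowest.op_eq_zero hg]
    rintro x (⟨m, hm, rfl | rfl⟩ | ⟨m, hm, rfl | rfl⟩)
    · exact hg (.L m) (by simp only [N2Gen.weight]; lia)
    · exact hg (.J m) (by simp only [N2Gen.weight]; lia)
    · exact hg (.G1 m) (by simp only [N2Gen.weight]; lia)
    · exact hg (.G2 m) (by simp only [N2Gen.weight]; lia)
  have hK1 : K ≠ ⊤ := by
    intro hK
    have : (1 : N2Env c) ∈ K := hK ▸ Submodule.mem_top
    change π 1 Ω = 0 at this
    rw [map_one] at this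
    exact h.lowest.ne_zero this
  -- If `I` is not contained in `K`, then `I Ω` is a non-zero submodule, so `v Ω = Ω` for some `v ∈
  -- I`. Modulo the Verma ideal a polynomial `P = p(L_0)` with `p(0) ≠ 0` carries `v` to a scalar
  -- `t`; evaluating at `Ω` gives `t = p(0)`, so that `I` contains a non-zero scalar.
  have hmax : ∀ I : Submodule (N2Env c) (N2Env c), N2VermaIdeal c ≤ I → I ≠ ⊤ → I ≤ K := by
    intro I hVI hI
    by_contra hIK
    obtain ⟨u, huI, huK⟩ := SetLike.not_le_iff_exists.1 hIK
    let W : Submodule ℂ V :=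
      { carrier := {x | ∃ u ∈ I, π u Ω = x}
        zero_mem' := ⟨0, zero_mem _, by simp⟩
        add_mem' := by
          rintro _ _ ⟨a, ha, rfl⟩ ⟨b, hb, rfl⟩
          exact ⟨a + b, add_mem ha hb, by simp⟩
        smul_mem' := by
          rintro r _ ⟨a, ha, rfl⟩
          refine ⟨r • a, ?_, by simp⟩
          rw [Algebra.smul_def]
          exact I.smul_mem _ ha }
    have hW : W = ⊤ := by
      refine (hirr W ?_).resolve_left ?_
      · rintro g _ ⟨a, ha, rfl⟩
        exact ⟨N2Env.gen c g * a, I.smul_mem _ ha, by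
          rw [map_mul, hπ, Module.End.mul_apply]⟩
      · intro hW
        have : π u Ω ∈ W := ⟨u, huI, rfl⟩
        rw [hW] at this
        exact huK this
    obtain ⟨v, hvI, hv⟩ : Ω ∈ W := hW ▸ Submodule.mem_top
    have hN2 : (quot (N2VermaIdeal c)).IsN2 c := (N2Env.modes_isN2 c).mapAlgHom _
    have hcr : ∀ g : N2Gen, ¬ 0 < g.weight →
        (quot (N2VermaIdeal c)).op g (Submodule.Quotient.mk 1) = 0 := by
      intro g hg
      rw [op_quot_mk, mul_one, Submodule.Quotient.mk_eq_zero]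
      exact gen_mem_N2VermaIdeal hg
    obtain ⟨p, hp, hpv⟩ := exists_aeval_mem_wordSpan hN2 (isCyclicVector_quot _)
      (hcr (.L 0) (by simp [N2Gen.weight])) hcr 0 (Submodule.Quotient.mk v)
    have hle : wordSpan (quot (N2VermaIdeal c)) (Submodule.Quotient.mk 1)
        (fun g => 0 < g.weight) 0 ≤ Submodule.span ℂ {Submodule.Quotient.mk 1} := by
      rw [wordSpan, Submodule.span_le]
      rintro _ ⟨w, hw, hw0, rfl⟩
      have h1 := wordWeight_nonneg hw
      have h2 : wordWeight w = 0 := by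
        have : (wordWeight w : ℂ) = 0 := by linear_combination 2 * hw0
        exact_mod_cast this
      obtain rfl : w = [] := by
        rw [← List.length_eq_zero_iff]; lia
      exact Submodule.subset_span rfl
    obtain ⟨t, ht⟩ := Submodule.mem_span_singleton.1 (hle hpv)
    set P : N2Env c := Polynomial.aeval (N2Env.gen c (.L 0)) p with hP
    have h1 : Polynomial.aeval ((quot (N2VermaIdeal c)).L 0) p (Submodule.Quotient.mk v) =
        Submodule.Quotient.mk (P * v) := by
      change Polynomial.aeval ((quot (N2VermaIdeal c)).op (.L 0)) p _ = _
      rw [op_quot, Polynomial.aeval_algHom_apply]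
      rfl
    rw [h1, ← Submodule.Quotient.mk_smul, Submodule.Quotient.eq] at ht
    have h2 : π (P * v) Ω = p.eval 0 • Ω := by
      rw [map_mul, Module.End.mul_apply, hv, hP, ← Polynomial.aeval_algHom_apply, hπ]
      refine aeval_apply_of_mem_eigenspace ?_ p
      rw [Module.End.mem_eigenspace_iff, zero_smul]
      exact h.lowest.L_zero'
    have h3 : π (t • 1 - P * v) Ω = 0 := hVK ht
    rw [map_sub, LinearMap.sub_apply, h2, map_smul, map_one, LinearMap.smul_apply,
      Module.End.one_apply, ← sub_smul] at h3
    have h4 : t ≠ 0 := by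
      rintro rfl
      exact hp (by simpa [h.lowest.ne_zero] using h3)
    have h5 : t • (1 : N2Env c) ∈ I := by
      have := I.add_mem (hVI ht) (I.smul_mem P hvI)
      rwa [smul_eq_mul, sub_add_cancel] at this
    apply hI
    rw [Ideal.eq_top_iff_one]
    have := I.smul_mem (algebraMap ℂ _ t⁻¹) h5
    rwa [smul_eq_mul, ← Algebra.smul_def, smul_smul, inv_mul_cancel₀ h4, one_smul] at this
  have : N2MaxIdeal c = K :=
    le_antisymm (sSup_le fun I hI => hmax I hI.1 hI.2) (le_sSup ⟨hVK, hK1⟩)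
  rw [this]
  exact Iff.rfl

/-- An irreducible vacuum module is isomorphic to the standard one. -/
theorem exists_equiv_N2Simple (h : IsVacuumModule X Ω c) (hirr : IsIrreducible X) :
    ∃ φ : V ≃ₗ[ℂ] N2Simple c, φ Ω = N2Simple.vacuum c ∧
      ∀ g x, φ (X.op g x) = (N2Simple.modes c).op g (φ x) := by
  obtain ⟨π, hπ⟩ := h.isN2.exists_algHom
  let ev : N2Env c →ₗ[ℂ] V := (LinearMap.applyₗ Ω).comp π.toLinearMap
  have hev : ∀ u, ev u = π u Ω := fun u => rfl
  have hsurj : Function.Surjective ev := by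
    rw [← LinearMap.range_eq_top]
    refine h.cyclic.eq_top_of_op ⟨1, by rw [hev, map_one]; rfl⟩ ?_
    rintro g _ ⟨u, rfl⟩
    exact ⟨N2Env.gen c g * u, by rw [hev, hev, map_mul, hπ]; rfl⟩
  have hker : (N2MaxIdeal c).restrictScalars ℂ = LinearMap.ker ev := by
    ext u
    rw [Submodule.restrictScalars_mem, mem_N2MaxIdeal_iff h hirr hπ]
    exact Iff.rfl
  let ψ : N2Simple c ≃ₗ[ℂ] V :=
    ((Submodule.Quotient.restrictScalarsEquiv ℂ (N2MaxIdeal c)).symm.trans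
      (Submodule.quotEquivOfEq _ _ hker)).trans (ev.quotKerEquivOfSurjective hsurj)
  have hψ : ∀ u, ψ (Submodule.Quotient.mk u) = π u Ω := fun u => rfl
  refine ⟨ψ.symm, ?_, fun g x => ?_⟩
  · rw [LinearEquiv.symm_apply_eq, N2Simple.vacuum, hψ, map_one]
    rfl
  · rw [LinearEquiv.symm_apply_eq]
    obtain ⟨y, rfl⟩ := ψ.surjective x
    obtain ⟨u, rfl⟩ := Submodule.Quotient.mk_surjective _ y
    rw [LinearEquiv.symm_apply_apply]
    have : (N2Simple.modes c).op g (Submodule.Quotient.mk u) =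
        Submodule.Quotient.mk (N2Env.gen c g * u) := by
      rw [← op_quot_mk]
      cases g <;> rfl
    rw [this, hψ, hψ, map_mul, hπ]
    rfl

/-- Transport of the vacuum module structure along an isomorphism. -/
theorem IsVacuumModule.of_equiv {V' : Type*} [AddCommGroup V'] [Module ℂ V']
    {X' : N2Modes (Module.End ℂ V')} {Ω' : V'} (h : IsVacuumModule X Ω c) (hX' : X'.IsN2 c)
    (φ : V ≃ₗ[ℂ] V') (hΩ : φ Ω = Ω') (hφ : ∀ g x, φ (X.op g x) = X'.op g (φ x)) :
    IsVacuumModule X' Ω' c := by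
  have hz : ∀ g, X.op g Ω = 0 → X'.op g Ω' = 0 := by
    intro g hg
    rw [← hΩ, ← hφ, hg, map_zero]
  have hl := h.lowest
  refine ⟨hX', ⟨?_, ?_, ?_, fun m hm => hz (.L m) (hl.L_pos m hm),
    fun m hm => hz (.J m) (hl.J_pos m hm), fun m hm => hz (.G1 m) (hl.G1_pos m hm),
    fun m hm => hz (.G2 m) (hl.G2_pos m hm)⟩, fun W hW hinv => ?_, hz (.L (-1)) h.L_vac,
    hz (.G1 (-1)) h.G1_vac, hz (.G2 (-1)) h.G2_vac⟩
  · rw [← hΩ]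
    exact φ.map_ne_zero_iff.2 hl.ne_zero
  · rw [zero_smul]
    exact hz (.L 0) hl.L_zero'
  · rw [zero_smul]
    exact hz (.J 0) (by simpa [op] using hl.J_zero)
  · have h1 : W.comap φ.toLinearMap = ⊤ := by
      refine h.cyclic.eq_top_of_op (by simpa [hΩ] using hW) fun g x hx => ?_
      change φ _ ∈ W
      rw [hφ]
      cases g
      exacts [(hinv _ _ hx).1, (hinv _ _ hx).2.1, (hinv _ _ hx).2.2.1, (hinv _ _ hx).2.2.2]
    rw [eq_top_iff]
    intro y _
    obtain ⟨x, rfl⟩ := φ.surjective y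
    exact (h1 ▸ Submodule.mem_top : x ∈ W.comap φ.toLinearMap)

theorem modes_isN2 (c : ℂ) : (N2Simple.modes c).IsN2 c :=
  (N2Env.modes_isN2 c).mapAlgHom (Algebra.lsmul ℂ ℂ (N2Simple c))

theorem N2Simple_parity (c : ℂ) :
    N2Simple.parity c = paritySpan (N2Simple.modes c) (N2Simple.vacuum c) := by
  have hw : ∀ w : List N2Gen, (w.map (N2Env.gen c)).prod • N2Simple.vacuum c =
      (N2Simple.modes c).word (N2Simple.vacuum c) w := by
    intro w
    induction w with
    | nil => simp
    | cons g w ih =>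
      rw [word_cons, ← ih, List.map_cons, List.prod_cons, mul_smul]
      cases g <;> rfl
  funext i
  rw [N2Simple.parity, paritySpan]
  congr 1
  ext x
  simp only [hw, Set.mem_ofPred_eq, wordParity]
  exact exists_congr fun w => and_congr_right fun _ => eq_comm

theorem superVirasoroN2_eq (c : ℂ) : superVirasoroN2 c =
    vosa (N2Simple.modes c) (N2Simple.vacuum c) (N2Simple.stateField c) := by
  rw [superVirasoroN2, vosa, N2Simple_parity]

/-- The reconstruction supplies the existence required by the `dite` in `stateField`, so the choice
made there is a genuine structure and not the default value `0`. -/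
theorem isVacuumVOSA_stateField
    (h : IsVacuumModule (N2Simple.modes c) (N2Simple.vacuum c) c) :
    IsVacuumVOSA (N2Simple.modes c) (N2Simple.vacuum c) c (N2Simple.stateField c) := by
  obtain ⟨Y, hY⟩ := exists_isVacuumVOSA h
  have hex : ∃ Y : N2Simple c →ₗ[ℂ] VertexOperator ℂ (N2Simple c),
      IsVertexSuperalgebra (N2Simple.parity c) Y (N2Simple.vacuum c) ((N2Simple.modes c).L (-1)) ∧
        IsN2StateField (N2Simple.modes c) (N2Simple.vacuum c) Y := by
    refine ⟨Y, ?_, hY.isN2StateField⟩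
    rw [N2Simple_parity]
    exact hY.isVertexSuperalgebra
  have hs : N2Simple.stateField c = hex.choose := by
    rw [N2Simple.stateField, dif_pos hex]
  obtain ⟨h1, h2⟩ := hex.choose_spec
  rw [← hs] at h1 h2
  rw [N2Simple_parity] at h1
  exact ⟨h, h1, h2⟩

end N2Modes

/-! ### The antilinear involution -/

/-- The complex conjugate of a complex vector space. -/
def ConjSpace (V : Type*) : Type _ := V

namespace ConjSpace

variable {V : Type*} [AddCommGroup V] [Module ℂ V]

instance : AddCommGroup (ConjSpace V) := inferInstanceAs (AddCommGroup V)

noncomputable instance : Module ℂ (ConjSpace V) := Module.compHom V (starRingEnd ℂ)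

/-- The identity, as an antilinear map to the conjugate space. -/
noncomputable def equiv (V : Type*) [AddCommGroup V] [Module ℂ V] :
    V ≃ₛₗ[starRingEnd ℂ] ConjSpace V where
  toFun x := x
  invFun x := x
  map_add' _ _ := rfl
  map_smul' r x := by
    change r • x = (starRingEnd ℂ (starRingEnd ℂ r)) • x
    rw [Complex.conj_conj]
  left_inv _ := rfl
  right_inv _ := rfl

/-- An operator, as an operator on the conjugate space. -/
noncomputable def mapEnd (V : Type*) [AddCommGroup V] [Module ℂ V] :
    Module.End ℂ V →+* Module.End ℂ (ConjSpace V) where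
  toFun A := ((equiv V).toLinearMap.comp A).comp (equiv V).symm.toLinearMap
  map_one' := by ext; simp
  map_mul' A B := by ext; simp
  map_zero' := by ext; simp
  map_add' A B := by ext; simp

theorem mapEnd_apply (A : Module.End ℂ V) (x : V) : mapEnd V A (equiv V x) = equiv V (A x) := rfl

theorem mapEnd_smul (r : ℂ) (A : Module.End ℂ V) :
    mapEnd V (r • A) = starRingEnd ℂ r • mapEnd V A := by
  ext x
  obtain ⟨x, rfl⟩ := (equiv V).surjective x
  rw [LinearMap.smul_apply, mapEnd_apply, mapEnd_apply, LinearMap.smul_apply, map_smulₛₗ]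

end ConjSpace

namespace N2Modes

/-- The conjugate modes `L_m`, `-J_n`, `Gⁱ_r`. -/
def conjMap {A A' : Type*} [Ring A] [Ring A'] (f : A →+* A') (X : N2Modes A) : N2Modes A' where
  L m := f (X.L m)
  J m := -f (X.J m)
  G1 k := f (X.G1 k)
  G2 k := f (X.G2 k)

/-- Conjugation turns `i` into `-i`, which the sign of `J` compensates in the relations containing
`i`; the central terms are fixed because `c` is real. -/
theorem IsN2.conjMap {A A' : Type*} [Ring A] [Algebra ℂ A] [Ring A'] [Algebra ℂ A'] {f : A →+* A'}
    (hf : ∀ (r : ℂ) a, f (r • a) = starRingEnd ℂ r • f a) {X : N2Modes A} {c : ℝ}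
    (hX : X.IsN2 c) : (X.conjMap f).IsN2 c := by
  have hite : ∀ (b : Prop) [Decidable b] (z : ℂ), starRingEnd ℂ z = z →
      f (if b then algebraMap ℂ A z else 0) = if b then algebraMap ℂ A' z else 0 := by
    intro b _ z hz
    split_ifs
    · rw [Algebra.algebraMap_eq_smul_one, hf, hz, map_one, Algebra.algebraMap_eq_smul_one]
    · exact map_zero f
  have hmul : ∀ x y, f (x * y) = f x * f y := map_mul f
  have hsub : ∀ x y, f (x - y) = f x - f y := map_sub f
  have hadd : ∀ x y, f (x + y) = f x + f y := map_add f
  constructor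
  · intro m n
    have := congrArg f (hX.L_L m n)
    rw [hadd, hite _ _ (by simp [Complex.conj_ofNat])] at this
    simpa [N2Modes.conjMap, hmul, hf] using this
  · intro m n
    have := congrArg f (hX.L_J m n)
    rw [hsub, hmul, hmul, hf] at this
    simp only [N2Modes.conjMap, mul_neg, neg_mul, smul_neg]
    rw [← neg_sub', this]
    simp
  · intro m n
    have := congrArg f (hX.J_J m n)
    rw [hite _ _ (by simp [Complex.conj_ofNat]), hsub, hmul, hmul] at this
    simp only [N2Modes.conjMap, mul_neg, neg_mul, neg_neg]
    exact this
  · intro m n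
    have := congrArg f (hX.L_G1 m n)
    rw [hsub, hmul, hmul, hf] at this
    simpa [N2Modes.conjMap, Complex.conj_ofNat] using this
  · intro m n
    have := congrArg f (hX.L_G2 m n)
    rw [hsub, hmul, hmul, hf] at this
    simpa [N2Modes.conjMap, Complex.conj_ofNat] using this
  · intro m n
    have := congrArg f (hX.G1_G1 m n)
    rw [hadd, hadd, hmul, hmul, hf, hite _ _ (by simp [Complex.conj_ofNat])] at this
    simpa only [N2Modes.conjMap, Complex.conj_ofNat] using this
  · intro m n
    have := congrArg f (hX.G2_G2 m n)
    rw [hadd, hadd, hmul, hmul, hf, hite _ _ (by simp [Complex.conj_ofNat])] at this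
    simpa only [N2Modes.conjMap, Complex.conj_ofNat] using this
  · intro m n
    have := congrArg f (hX.G1_G2 m n)
    rw [hadd, hmul, hmul, hf] at this
    simpa [N2Modes.conjMap] using this
  · intro m n
    have := congrArg f (hX.G1_J m n)
    rw [hsub, hmul, hmul, hf] at this
    simp only [N2Modes.conjMap, mul_neg, neg_mul]
    rw [← neg_sub', this]
    simp
  · intro m n
    have := congrArg f (hX.G2_J m n)
    rw [hsub, hmul, hmul, hf] at this
    simp only [N2Modes.conjMap, mul_neg, neg_mul]
    rw [← neg_sub', this]
    simp

/-- The effect of the antilinear involution on the generating fields. -/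
def _root_.N2Field.conjSign : N2Field → ℂ
  | .T => 1
  | .J => -1
  | .G1 => 1
  | .G2 => 1

theorem _root_.N2Field.conjSign_mul_self (f : N2Field) : f.conjSign * f.conjSign = 1 := by
  cases f <;> simp [N2Field.conjSign]

variable {V : Type*} [AddCommGroup V] [Module ℂ V] {X : N2Modes (Module.End ℂ V)} {Ω : V} {c : ℝ}

/-- The antilinear involution of an irreducible vacuum module. -/
theorem exists_conjugation (h : IsVacuumModule X Ω c) (hirr : IsIrreducible X) :
    ∃ θ : V ≃ₛₗ[starRingEnd ℂ] V, θ Ω = Ω ∧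
      (∀ f n x, θ (X.fld f n x) = f.conjSign • X.fld f n (θ x)) ∧ ∀ x, θ (θ x) = x := by
  let e := ConjSpace.equiv V
  let X' := X.conjMap (ConjSpace.mapEnd V)
  have hX' : ∀ f n x, X'.fld f n (e x) = f.conjSign • e (X.fld f n x) := by
    intro f n x
    cases f
    · exact (one_smul ℂ _).symm
    · exact (neg_one_smul ℂ _).symm
    · exact (one_smul ℂ _).symm
    · exact (one_smul ℂ _).symm
  have hz : ∀ g x, X.op g x = 0 → X'.op g (e x) = 0 := by
    intro g x hg
    obtain ⟨f, n, rfl⟩ := exists_mode g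
    change X.fld f n x = 0 at hg
    change X'.fld f n (e x) = 0
    rw [hX', hg, map_zero, smul_zero]
  have hW : ∀ W : Submodule ℂ (ConjSpace V), (∀ g, ∀ x ∈ W, X'.op g x ∈ W) →
      ∀ g, ∀ x ∈ W.comap e.toLinearMap, X.op g x ∈ W.comap e.toLinearMap := by
    intro W hW g x hx
    obtain ⟨f, n, rfl⟩ := exists_mode g
    have h1 : X'.fld f n (e x) ∈ W := hW _ _ hx
    rw [hX', Submodule.smul_mem_iff] at h1
    · exact h1
    · cases f <;> simp [N2Field.conjSign]
  have hcomap : ∀ W : Submodule ℂ (ConjSpace V), W.comap e.toLinearMap = ⊤ → W = ⊤ := by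
    intro W h1
    rw [eq_top_iff]
    intro y _
    obtain ⟨x, rfl⟩ := e.surjective y
    exact (h1 ▸ Submodule.mem_top : x ∈ W.comap e.toLinearMap)
  have hl := h.lowest
  have h' : IsVacuumModule X' (e Ω) c := by
    refine ⟨h.isN2.conjMap ConjSpace.mapEnd_smul, ⟨?_, ?_, ?_, fun m hm => hz (.L m) _ (hl.L_pos m hm),
      fun m hm => hz (.J m) _ (hl.J_pos m hm), fun m hm => hz (.G1 m) _ (hl.G1_pos m hm),
      fun m hm => hz (.G2 m) _ (hl.G2_pos m hm)⟩, fun W hΩ hinv => ?_, hz (.L (-1)) _ h.L_vac,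
      hz (.G1 (-1)) _ h.G1_vac, hz (.G2 (-1)) _ h.G2_vac⟩
    · exact e.map_ne_zero_iff.2 hl.ne_zero
    · rw [zero_smul]
      exact hz (.L 0) _ hl.L_zero'
    · rw [zero_smul]
      exact hz (.J 0) _ (by simpa [op] using hl.J_zero)
    · refine hcomap W (h.cyclic.eq_top_of_op hΩ (hW W fun g x hx => ?_))
      cases g
      exacts [(hinv _ _ hx).1, (hinv _ _ hx).2.1, (hinv _ _ hx).2.2.1, (hinv _ _ hx).2.2.2]
  have hirr' : IsIrreducible X' := by
    intro W hinv
    refine (hirr _ (hW W hinv)).imp (fun h1 => ?_) (hcomap W)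
    rw [eq_bot_iff]
    intro y hy
    obtain ⟨x, rfl⟩ := e.surjective y
    have : x ∈ W.comap e.toLinearMap := hy
    rw [h1, Submodule.mem_bot] at this
    rw [this, map_zero]
    exact zero_mem _
  -- The module and its conjugate are both irreducible vacuum modules with the same `c`. Both are
  -- thus isomorphic to `N2Simple c`, and going from one to the other and back through the identity
  -- is antilinear.
  obtain ⟨φ, hφΩ, hφ⟩ := exists_equiv_N2Simple h hirr
  obtain ⟨ψ, hψΩ, hψ⟩ := exists_equiv_N2Simple h' hirr'
  let θ : V ≃ₛₗ[starRingEnd ℂ] V := (φ.trans ψ.symm).trans e.symm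
  have hθ : ∀ x, ψ (e (θ x)) = φ x := by
    intro x
    simp [θ]
  have hinj : ∀ x y, ψ (e x) = ψ (e y) → x = y := fun x y hxy =>
    e.injective (ψ.injective hxy)
  have hθΩ : θ Ω = Ω := hinj _ _ (by rw [hθ, hφΩ, hψΩ])
  have hθf : ∀ f n x, θ (X.fld f n x) = f.conjSign • X.fld f n (θ x) := by
    intro f n x
    apply hinj
    have h1 := hX' f n (θ x)
    have h2 : e (f.conjSign • X.fld f n (θ x)) = f.conjSign • e (X.fld f n (θ x)) := by
      rw [map_smulₛₗ]
      cases f <;> simp [N2Field.conjSign]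
    rw [hθ, h2, ← h1]
    exact (hφ _ _).trans ((congrArg _ (hθ x).symm).trans (hψ _ _).symm)
  refine ⟨θ, hθΩ, hθf, ?_⟩
  let W : Submodule ℂ V :=
    { carrier := {x | θ (θ x) = x}
      zero_mem' := by simp
      add_mem' := by
        intro a b ha hb
        simp only [Set.mem_ofPred_eq] at ha hb ⊢
        rw [map_add, map_add, ha, hb]
      smul_mem' := by
        intro r a ha
        simp only [Set.mem_ofPred_eq] at ha ⊢
        rw [map_smulₛₗ, map_smulₛₗ, ha, Complex.conj_conj] }
  -- The square of `θ` fixes `Ω` and commutes with all modes, as the signs square to one.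
  have hWtop : W = ⊤ := by
    refine h.cyclic.eq_top_of_fld (by change θ (θ Ω) = Ω; rw [hθΩ, hθΩ]) fun f n x hx => ?_
    change θ (θ _) = _
    have hx' : θ (θ x) = x := hx
    rw [hθf, map_smulₛₗ, hθf, hx']
    cases f <;> simp [N2Field.conjSign]
  intro x
  exact (hWtop ▸ Submodule.mem_top : x ∈ W)

/-- The antilinear involution preserves the products of the vertex superalgebra. -/
theorem isAntilinearInvolution {c : ℂ} {Y : V →ₗ[ℂ] VertexOperator ℂ V} (hY : IsVacuumVOSA X Ω c Y)
    {θ : V ≃ₛₗ[starRingEnd ℂ] V} (hΩ : θ Ω = Ω)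
    (hθ : ∀ f n x, θ (X.fld f n x) = f.conjSign • X.fld f n (θ x)) (hinv : ∀ x, θ (θ x) = x) :
    (vosa X Ω Y).IsAntilinearInvolution θ.toLinearMap where
  involutive := hinv
  map_vacuum := hΩ
  map_conformal := by
    have := hθ .T (-1) Ω
    rw [hΩ, N2Field.conjSign, one_smul] at this
    exact this
  map_nthProd := hY.map_nthProd hY hΩ N2Field.conjSign_mul_self rfl hθ

end N2Modes

/-! ### Commutation relations with the fields of a vacuum module -/

namespace N2Modes

open FormalDist FormalSeries

variable {V : Type*} [AddCommGroup V] [Module ℂ V] {X : N2Modes (Module.End ℂ V)} {Ω : V}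

section Commutators

variable {c : ℂ} {Y : V →ₗ[ℂ] VertexOperator ℂ V}

theorem eigenspace_le_paritySpan (h : IsVacuumModule X Ω c) (k : ℤ) :
    (X.L 0).eigenspace ((k : ℂ) / 2) ≤ paritySpan X Ω k := by
  rw [eigenspace_eq_wordSpan h.isN2 h.cyclic h.lowest.L_zero' (op_vacuum_eq_zero h), wordSpan,
    Submodule.span_le]
  rintro _ ⟨w, -, hw, rfl⟩
  have h1 : (wordWeight w : ℂ) = k := by linear_combination 2 * hw
  have h2 : wordWeight w = k := by exact_mod_cast h1
  exact Submodule.subset_span ⟨w, by rw [wordParity_eq, h2], rfl⟩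

/-- The commutator of a generator with a field, truncated at a suitable place. -/
theorem IsVacuumVOSA.fld_mul_nthProd (hY : IsVacuumVOSA X Ω c Y) (f : N2Field) {i : ZMod 2} {b : V}
    (hb : b ∈ paritySpan X Ω i) {N : ℕ} (hN : ∀ j : ℕ, N ≤ j → X.fld f j b = 0) (m n : ℤ) (x : V) :
    X.fld f m (nthProd Y b n x) =
      superSign f.parity i • nthProd Y b n (X.fld f m x) +
      ∑ l ∈ Finset.range N, cbinom m l • nthProd Y (X.fld f l b) (m + n - l) x := by
  obtain ⟨N₀, hN₀⟩ := hY.bracket_nthProd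
    (state_mem_paritySpan (fld_mem_vertexFields hY.isVacuumModule f)) hb
  have h1 := DFunLike.congr_fun (hN₀ (max N₀ N) (le_max_left _ _) m n) x
  rw [hY.nthProd_fld, LinearMap.sub_apply, LinearMap.smul_apply, Module.End.mul_apply,
    Module.End.mul_apply, sub_eq_iff_eq_add', LinearMap.sum_apply] at h1
  rw [h1]
  congr 1
  symm
  refine Finset.sum_subset (Finset.range_subset_range.2 (le_max_right _ _)) fun l _ hl => ?_
  rw [hN l (by simpa using hl), nthProd_zero]
  simp

theorem op_eq_zero_of_weight_neg (h : IsVacuumModule X Ω c) (g : N2Gen) {k : ℤ} {a : V}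
    (ha : a ∈ (X.L 0).eigenspace ((k : ℂ) / 2)) (hg : k + g.weight < 0) : X.op g a = 0 := by
  have h1 := op_mem_eigenspace h.isN2 g ha
  rw [eigenspace_eq_bot h.isN2 h.lowest h.cyclic] at h1
  · simpa using h1
  · intro m hm
    have h2 : ((k + g.weight : ℤ) : ℂ) = (m : ℤ) := by push_cast; linear_combination 2 * hm
    have h3 : k + g.weight = m := by exact_mod_cast h2
    lia

theorem op_mem_eigenspace_int (h : IsVacuumModule X Ω c) (g : N2Gen) {k k' : ℤ} {a : V}
    (ha : a ∈ (X.L 0).eigenspace ((k : ℂ) / 2)) (hg : k + g.weight = k') :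
    X.op g a ∈ (X.L 0).eigenspace ((k' : ℂ) / 2) := by
  have h1 := op_mem_eigenspace h.isN2 g ha
  rw [← hg]
  convert h1 using 2
  push_cast
  ring

/-! ### Divided powers of `L_1` -/

/-- The divided powers `L₁ˡ / l!`. -/
noncomputable def divPow (X : N2Modes (Module.End ℂ V)) (l : ℕ) : Module.End ℂ V :=
  ((l.factorial : ℂ)⁻¹) • X.L 1 ^ l

theorem divPow_zero : X.divPow 0 = 1 := by simp [divPow]

theorem succ_smul_divPow (l : ℕ) : ((l : ℂ) + 1) • X.divPow (l + 1) = X.L 1 * X.divPow l := by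
  have h1 : (l : ℂ) + 1 ≠ 0 := by exact_mod_cast l.succ_ne_zero
  rw [divPow, divPow, mul_smul_comm, ← pow_succ', smul_smul, Nat.factorial_succ]
  congr 1
  push_cast
  field_simp

theorem divPow_mul_of_commute {A : Module.End ℂ V} (hA : X.L 1 * A = A * X.L 1) (l : ℕ) :
    X.divPow l * A = A * X.divPow l := by
  have : Commute (X.L 1 ^ l) A := Commute.pow_left hA l
  rw [divPow, smul_mul_assoc, this.eq, mul_smul_comm]

/-- Coefficients of `e^{z L_1} A = (A + z C) e^{z L_1}`, where the adjoint action of `L_1` stops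
after one step. -/
theorem divPow_succ_mul {A C : Module.End ℂ V} (hA : X.L 1 * A - A * X.L 1 = C)
    (hC : X.L 1 * C = C * X.L 1) (l : ℕ) :
    X.divPow (l + 1) * A = A * X.divPow (l + 1) + C * X.divPow l := by
  rw [sub_eq_iff_eq_add] at hA
  induction l with
  | zero =>
    have := succ_smul_divPow (X := X) 0
    simp only [divPow_zero, mul_one, Nat.cast_zero, zero_add, one_smul] at this
    rw [zero_add, this, divPow_zero, mul_one, hA, add_comm]
  | succ l ih =>
    have h1 : ((l + 1 : ℕ) : ℂ) + 1 ≠ 0 := by exact_mod_cast (l + 1).succ_ne_zero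
    have h2 := succ_smul_divPow (X := X) (l + 1)
    have h3 := succ_smul_divPow (X := X) l
    apply smul_right_injective _ h1
    simp only
    rw [← smul_mul_assoc, h2, mul_assoc, ih, mul_add, ← mul_assoc, hA, ← mul_assoc, hC, smul_add,
      ← mul_smul_comm, h2, add_mul, mul_assoc C, ← h3, mul_assoc A, mul_smul_comm]
    push_cast
    module

/-- From `[L_1, J_n] = -n J_{n+1}` one gets `e^{z L_1} J_1 e^{-z L_1} = ∑ (-z)^i J_{1+i}`; these are
the coefficients. -/
theorem divPow_mul_J_one (hX : X.IsN2 c) (l : ℕ) :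
    X.divPow l * X.J 1 =
      ∑ i ∈ Finset.range (l + 1), (-1 : ℂ) ^ i • (X.J (1 + i) * X.divPow (l - i)) := by
  induction l with
  | zero => simp [divPow_zero]
  | succ l ih =>
    have h1 : (l : ℂ) + 1 ≠ 0 := by exact_mod_cast l.succ_ne_zero
    apply smul_right_injective _ h1
    simp only
    rw [← smul_mul_assoc, succ_smul_divPow, mul_assoc, ih, Finset.mul_sum]
    have h2 : ∀ i ∈ Finset.range (l + 1),
        X.L 1 * ((-1 : ℂ) ^ i • (X.J (1 + i) * X.divPow (l - i))) =
        (((l : ℂ) + 1 - i) * (-1) ^ i) • (X.J (1 + i) * X.divPow (l + 1 - i)) +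
        (((i + 1 : ℕ) : ℂ) * (-1) ^ (i + 1)) •
          (X.J (1 + (i + 1 : ℕ)) * X.divPow (l + 1 - (i + 1))) := by
      intro i hi
      have hi' : i ≤ l := by simpa [Nat.lt_succ_iff] using hi
      have h3 := sub_eq_iff_eq_add.1 (hX.L_J 1 (1 + i))
      have h4 := succ_smul_divPow (X := X) (l - i)
      rw [mul_smul_comm, ← mul_assoc, h3, add_mul, mul_assoc (X.J _), ← h4, Nat.succ_sub hi',
        Nat.succ_sub_succ, Nat.cast_sub hi', show (1 : ℤ) + (1 + i) = 1 + (i + 1 : ℕ) by push_cast; ring]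
      simp only [smul_mul_assoc, mul_smul_comm, smul_add, smul_smul, pow_succ]
      push_cast
      rw [add_comm]
      congr 2 <;> ring
    rw [Finset.sum_congr rfl h2, Finset.sum_add_distrib, Finset.smul_sum]
    have h5 := Finset.sum_range_succ' (fun i : ℕ => ((i : ℂ) * (-1) ^ i) •
      (X.J (1 + i) * X.divPow (l + 1 - i))) (l + 1)
    have h6 := Finset.sum_range_succ (fun i : ℕ => (((l : ℂ) + 1 - i) * (-1) ^ i) •
      (X.J (1 + i) * X.divPow (l + 1 - i))) (l + 1)
    simp only [Nat.cast_zero, zero_mul, zero_smul, add_zero] at h5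
    rw [← h5]
    have h7 : ((l : ℂ) + 1 - ((l + 1 : ℕ) : ℂ)) = 0 := by push_cast; ring
    rw [h7, zero_mul, zero_smul, add_zero] at h6
    rw [← h6, ← Finset.sum_add_distrib]
    refine Finset.sum_congr rfl fun i _ => ?_
    rw [← add_smul, smul_smul]
    congr 1
    ring

theorem divPow_mem_eigenspace (h : IsVacuumModule X Ω c) {k : ℤ} {a : V}
    (ha : a ∈ (X.L 0).eigenspace ((k : ℂ) / 2)) (l : ℕ) :
    X.divPow l a ∈ (X.L 0).eigenspace (((k - 2 * l : ℤ) : ℂ) / 2) := by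
  rw [divPow, LinearMap.smul_apply]
  refine Submodule.smul_mem _ _ ?_
  induction l with
  | zero => simpa using ha
  | succ l ih =>
    rw [pow_succ', Module.End.mul_apply]
    exact op_mem_eigenspace_int h (.L 1) ih (by simp only [N2Gen.weight]; push_cast; ring)

theorem eq_zero_of_mem_eigenspace_neg (h : IsVacuumModule X Ω c) {k : ℤ} {a : V}
    (ha : a ∈ (X.L 0).eigenspace ((k : ℂ) / 2)) (hk : k < 0) : a = 0 := by
  rw [eigenspace_eq_bot h.isN2 h.lowest h.cyclic] at ha
  · simpa using ha
  · intro m hm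
    have h2 : (k : ℂ) = (m : ℤ) := by push_cast; linear_combination 2 * hm
    have h3 : k = m := by exact_mod_cast h2
    lia

/-- The vacuum module is generated by `J_{-1}` and `Gⁱ_{-1/2}`. -/
theorem eq_top_of_creation (hX : X.IsN2 c) (hΩ : IsLowestWeightVector X Ω 0 0)
    (hcyc : IsCyclicVector X Ω) {W : Submodule ℂ V} (h0 : Ω ∈ W) (hJ : ∀ x ∈ W, X.J (-1) x ∈ W)
    (hG1 : ∀ x ∈ W, X.G1 (-1) x ∈ W) (hG2 : ∀ x ∈ W, X.G2 (-1) x ∈ W) : W = ⊤ := by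
  let P : (Module.End ℂ V) → Prop := fun A => ∀ x ∈ W, A x ∈ W
  have hmul : ∀ {A C}, P A → P C → P (A * C) := fun hA hC x hx => hA _ (hC _ hx)
  have hadd : ∀ {A C}, P A → P C → P (A + C) := fun hA hC x hx => add_mem (hA _ hx) (hC _ hx)
  have hsub : ∀ {A C}, P A → P C → P (A - C) := fun hA hC x hx => sub_mem (hA _ hx) (hC _ hx)
  have hdiv : ∀ {A} (r : ℂ), r ≠ 0 → P (r • A) → P A := fun r hr hA x hx =>
    (Submodule.smul_mem_iff _ hr).1 (hA x hx)
  -- `G_{-1/2}² = L_{-1}`; commutators with `L_{-1}` produce all `J_{-n}`, those of `J_{-n}` with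
  -- `G^i_{-1/2}` the other odd modes, and anticommutators with `G¹_{-1/2}` the remaining `L_{-n}`.
  have hL : P (X.L (-1)) := by
    have h1 := hX.G1_G1 (-1) (-1)
    have h2 := hadd (hmul hG1 hG1) (hmul hG1 hG1)
    rw [h1] at h2
    norm_num at h2
    exact hdiv 2 two_ne_zero h2
  have hJn : ∀ n : ℕ, P (X.J (-1 - n)) := by
    intro n
    induction n with
    | zero => simpa using hJ
    | succ n ih =>
      have h1 := hsub (hmul hL ih) (hmul ih hL)
      rw [hX.L_J] at h1
      have h2 := hdiv _ (by
        push_cast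
        have : (n : ℂ) + 1 ≠ 0 := by exact_mod_cast n.succ_ne_zero
        intro h; apply this; linear_combination h) h1
      rwa [show (-1 : ℤ) - (n + 1 : ℕ) = -1 + (-1 - n) by push_cast; ring]
  have hG2n : ∀ n : ℕ, P (X.G2 (-1 - n)) := by
    rintro (_ | n)
    · simpa using hG2
    · have h1 := hsub (hmul hG1 (hJn n)) (hmul (hJn n) hG1)
      rw [hX.G1_J] at h1
      have h2 := hdiv _ (neg_ne_zero.2 Complex.I_ne_zero) h1
      rwa [show (-1 : ℤ) - (n + 1 : ℕ) = -1 + (-1 - n) by push_cast; ring]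
  have hG1n : ∀ n : ℕ, P (X.G1 (-1 - n)) := by
    rintro (_ | n)
    · simpa using hG1
    · have h1 := hsub (hmul hG2 (hJn n)) (hmul (hJn n) hG2)
      rw [hX.G2_J] at h1
      have h2 := hdiv _ Complex.I_ne_zero h1
      rwa [show (-1 : ℤ) - (n + 1 : ℕ) = -1 + (-1 - n) by push_cast; ring]
  have hLn : ∀ n : ℕ, P (X.L (-1 - n)) := by
    intro n
    have h1 := hadd (hmul hG1 (hG1n n)) (hmul (hG1n n) hG1)
    rw [hX.G1_G1, if_neg (by lia), add_zero] at h1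
    have h2 := hdiv _ two_ne_zero h1
    rwa [show (-1 : ℤ) + (-1 - n) + 1 = -1 - n by ring] at h2
  have hop : ∀ g : N2Gen, 0 < g.weight → P (X.op g) := by
    intro g hg
    cases g with
    | L m =>
      obtain ⟨n, rfl⟩ : ∃ n : ℕ, m = -1 - n := ⟨(-1 - m).toNat, by
        simp only [N2Gen.weight] at hg; lia⟩
      exact hLn n
    | J m =>
      obtain ⟨n, rfl⟩ : ∃ n : ℕ, m = -1 - n := ⟨(-1 - m).toNat, by
        simp only [N2Gen.weight] at hg; lia⟩
      exact hJn n
    | G1 m =>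
      obtain ⟨n, rfl⟩ : ∃ n : ℕ, m = -1 - n := ⟨(-1 - m).toNat, by
        simp only [N2Gen.weight] at hg; lia⟩
      exact hG1n n
    | G2 m =>
      obtain ⟨n, rfl⟩ : ∃ n : ℕ, m = -1 - n := ⟨(-1 - m).toNat, by
        simp only [N2Gen.weight] at hg; lia⟩
      exact hG2n n
  rw [eq_top_iff, ← span_word_eq_top hX hcyc (cr := fun g => 0 < g.weight)
    (fun g hg => hΩ.op_eq_zero (not_lt.1 hg)), Submodule.span_le]
  rintro _ ⟨w, hw, rfl⟩
  induction w with
  | nil => exact h0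
  | cons g w ih =>
    exact hop g (hw g (by simp)) _ (ih fun g' hg' => hw g' (by simp [hg']))

end Commutators

end N2Modes

/-! ### Invariance of the scalar product under the vertex operators -/

/-- The sign `(-1)^(2 h² + h)` for `h = k / 2`. -/
noncomputable def weightSign (k : ℤ) : ℂ := (-1) ^ (k * (k + 1) / 2)

/-- For `h = k / 2` the exponent `2 h² + h` is the triangular number `k (k + 1) / 2`. -/
theorem weightSign_add_one (k : ℤ) : weightSign (k + 1) = weightSign k * (-1) ^ (k + 1) := by
  have h : (k + 1) * (k + 1 + 1) / 2 = k * (k + 1) / 2 + (k + 1) := by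
    rw [show (k + 1) * (k + 1 + 1) = k * (k + 1) + 2 * (k + 1) by ring,
      Int.add_mul_ediv_left _ _ two_ne_zero]
  rw [weightSign, h, zpow_add₀ (by norm_num), weightSign]

theorem neg_one_zpow_mul_self (k : ℤ) : (-1 : ℂ) ^ k * (-1) ^ k = 1 := by
  rw [← mul_zpow]; simp

theorem weightSign_add_two (k : ℤ) : weightSign (k + 2) = -weightSign k := by
  rw [show k + 2 = k + 1 + 1 by ring, weightSign_add_one, weightSign_add_one,
    zpow_add_one₀ (by norm_num) (k + 1), mul_assoc, ← mul_assoc ((-1 : ℂ) ^ (k + 1)),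
    neg_one_zpow_mul_self]
  ring

theorem superSign_one_intCast (k : ℤ) : superSign 1 (k : ZMod 2) = (-1) ^ k := by
  rcases Int.even_or_odd k with hk | hk
  · rw [(ZMod.intCast_zmod_eq_zero_iff_dvd k 2).2 hk.two_dvd, hk.neg_one_zpow]
    simp
  · have : (k : ZMod 2) = 1 := by
      obtain ⟨m, rfl⟩ := hk
      push_cast
      rw [show (2 : ZMod 2) = 0 from rfl, zero_mul, zero_add]
    rw [this, hk.neg_one_zpow, superSign_one_one]

/-- Reflecting both indices corresponds to `z ↦ 1/z`, `w ↦ 1/w`, under which `z - w` is reproduced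
up to a sign and a monomial. -/
theorem FormalDist.subMul_pow_reflect {M : Type*} [AddCommGroup M] [Module ℂ M] {G : ℤ → ℤ → M}
    {N : ℕ} (hG : (subMul M ^ N) G = 0) (κ l : ℤ) :
    (subMul M ^ N) (fun m n => G (κ - m) (l - n)) = 0 := by
  suffices ∀ m n, (subMul M ^ N) (fun m n => G (κ - m) (l - n)) m n =
      (-1 : ℂ) ^ N • (subMul M ^ N) G (κ - m - N) (l - n - N) by
    ext m n
    rw [this, hG]
    simp
  clear hG
  induction N with
  | zero => intro m n; simp
  | succ N ih =>
    intro m n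
    rw [subMul_pow_succ, ih, ih, subMul_pow_succ, pow_succ, ← smul_sub, mul_smul, neg_one_smul,
      neg_sub]
    push_cast
    congr 3 <;> ring_nf

theorem sum_sum_range_sub {g : ℕ → ℕ → ℂ} {M : ℕ} (hg : ∀ i l, M ≤ i + l → g i l = 0) :
    ∑ l ∈ Finset.range M, ∑ i ∈ Finset.range (l + 1), g i (l - i) =
      ∑ l ∈ Finset.range M, ∑ i ∈ Finset.range M, g i l := by
  rw [Finset.sum_range_diag_flip, Finset.sum_comm]
  refine Finset.sum_congr rfl fun i _ => ?_
  refine Finset.sum_subset (Finset.range_subset_range.2 (Nat.sub_le _ _)) fun l _ hl => hg _ _ ?_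
  simp only [Finset.mem_range, not_lt] at hl
  lia

namespace N2Modes

open FormalDist FormalSeries

variable {V : Type*} [AddCommGroup V] [Module ℂ V] {X : N2Modes (Module.End ℂ V)} {Ω : V}
  {c : ℂ} {Y : V →ₗ[ℂ] VertexOperator ℂ V}

/-- A zero mode is a superderivation of all products: in Borcherds' formula only the term `l = 0`
survives. -/
theorem IsVacuumVOSA.fld_zero_mul_nthProd (hY : IsVacuumVOSA X Ω c Y) (f : N2Field) {i : ZMod 2}
    {b : V} (hb : b ∈ paritySpan X Ω i) (n : ℤ) (x : V) :
    X.fld f 0 (nthProd Y b n x) = superSign f.parity i • nthProd Y b n (X.fld f 0 x) +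
      nthProd Y (X.fld f 0 b) n x := by
  obtain ⟨N₀, hN₀⟩ := hY.bracket_nthProd
    (state_mem_paritySpan (fld_mem_vertexFields hY.isVacuumModule f)) hb
  have h1 := DFunLike.congr_fun (hN₀ (N₀ + 1) (by lia) 0 n) x
  rw [hY.nthProd_fld, LinearMap.sub_apply, LinearMap.smul_apply, Module.End.mul_apply,
    Module.End.mul_apply, sub_eq_iff_eq_add', Finset.sum_range_succ', Finset.sum_eq_zero] at h1
  · simpa using h1
  · intro l _
    rw [Int.cast_zero, cbinom_zero_succ, zero_smul]

theorem IsVacuumVOSA.fld_one_mul_nthProd (hY : IsVacuumVOSA X Ω c Y) (f : N2Field) {i : ZMod 2}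
    {b : V} (hb : b ∈ paritySpan X Ω i) (n : ℤ) (x : V) :
    X.fld f 1 (nthProd Y b n x) = superSign f.parity i • nthProd Y b n (X.fld f 1 x) +
      (nthProd Y (X.fld f 0 b) (n + 1) x + nthProd Y (X.fld f 1 b) n x) := by
  obtain ⟨N₀, hN₀⟩ := hY.bracket_nthProd
    (state_mem_paritySpan (fld_mem_vertexFields hY.isVacuumModule f)) hb
  have h1 := DFunLike.congr_fun (hN₀ (N₀ + 1 + 1) (by lia) 1 n) x
  rw [hY.nthProd_fld, LinearMap.sub_apply, LinearMap.smul_apply, Module.End.mul_apply,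
    Module.End.mul_apply, sub_eq_iff_eq_add', Finset.sum_range_succ', Finset.sum_range_succ',
    Finset.sum_eq_zero] at h1
  · rw [h1]
    simp [add_comm]
  · intro l _
    have := cbinom_natCast_of_lt (m := 1) (k := l + 1 + 1) (by lia)
    rw [Nat.cast_one] at this
    rw [Int.cast_one, this, zero_smul]

theorem op_mode_adj (f : N2Field) : ∃ l : ℤ, ∀ m, (f.mode m).adj = f.mode (l - m) := by
  cases f
  · exact ⟨2, fun m => by simp only [N2Field.mode, N2Gen.adj]; congr 1; lia⟩
  · exact ⟨0, fun m => by simp only [N2Field.mode, N2Gen.adj]; congr 1; lia⟩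
  · exact ⟨1, fun m => by simp only [N2Field.mode, N2Gen.adj]; congr 1; lia⟩
  · exact ⟨1, fun m => by simp only [N2Field.mode, N2Gen.adj]; congr 1; lia⟩

/-- A vacuum module with its vertex superalgebra structure, an invariant form and an antilinear
involution. -/
structure IsInvolutive (X : N2Modes (Module.End ℂ V)) (Ω : V) (c : ℂ)
    (Y : V →ₗ[ℂ] VertexOperator ℂ V) (B : V →ₗ⋆[ℂ] V →ₗ[ℂ] ℂ) (θ : V ≃ₛₗ[starRingEnd ℂ] V) :
    Prop where
  isVacuumVOSA : IsVacuumVOSA X Ω c Y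
  isInvariantForm : IsInvariantForm X B
  map_vacuum : θ Ω = Ω
  map_fld : ∀ f n x, θ (X.fld f n x) = f.conjSign • X.fld f n (θ x)

namespace IsInvolutive

variable {B : V →ₗ⋆[ℂ] V →ₗ[ℂ] ℂ} {θ : V ≃ₛₗ[starRingEnd ℂ] V}

theorem fld_map (H : IsInvolutive X Ω c Y B θ) (f : N2Field) (n : ℤ) (x : V) :
    X.fld f n (θ x) = f.conjSign • θ (X.fld f n x) := by
  rw [H.map_fld, smul_smul, f.conjSign_mul_self, one_smul]

theorem map_mem_eigenspace (H : IsInvolutive X Ω c Y B θ)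
    {k : ℤ} {a : V} (ha : a ∈ (X.L 0).eigenspace ((k : ℂ) / 2)) :
    θ a ∈ (X.L 0).eigenspace ((k : ℂ) / 2) := by
  have h1 := H.map_fld .T 1 a
  rw [Module.End.mem_eigenspace_iff] at ha ⊢
  change θ (X.L 0 a) = (1 : ℂ) • X.L 0 (θ a) at h1
  rw [ha, one_smul] at h1
  rw [← h1, map_smulₛₗ]
  congr 1
  simp [Complex.conj_ofNat]

/-- For `q < -1`, `v_(q) Ω` is a multiple of an `L_{-1}`-image, and such vectors are orthogonal to
`Ω` because `L_1 Ω = 0`. -/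
theorem form_vacuum_left (H : IsInvolutive X Ω c Y B θ) (v : V) (q : ℤ) :
    B Ω (nthProd Y v q Ω) = if q = -1 then B Ω v else 0 := by
  have hv := H.isVacuumVOSA.isVertexSuperalgebra
  split_ifs with hq
  · rw [hq, hv.creation]
  rcases le_or_gt 0 q with h0 | h0
  · rw [hv.creation_nonneg v q h0, map_zero]
  have h1 := congrArg (B Ω) (DFunLike.congr_fun (hv.translation v (q + 1)) Ω)
  have h2 := H.isInvariantForm (.L 1) Ω (nthProd Y v (q + 1) Ω)
  simp only [op, N2Gen.adj, H.isVacuumVOSA.isVacuumModule.lowest.L_pos 1 one_pos, map_zero,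
    LinearMap.zero_apply] at h2
  simp only [LinearMap.sub_apply, Module.End.mul_apply, hv.translation_vacuum, map_zero, sub_zero,
    LinearMap.smul_apply, map_smul, smul_eq_mul, ← h2, add_sub_cancel_right] at h1
  refine (mul_eq_zero.1 h1.symm).resolve_left (neg_ne_zero.2 ?_)
  exact_mod_cast (by lia : q + 1 ≠ 0)

theorem form_vacuum_right (H : IsInvolutive X Ω c Y B θ) (v : V) (q : ℤ) :
    B (nthProd Y v q Ω) Ω = if q = -1 then B v Ω else 0 := by
  have hv := H.isVacuumVOSA.isVertexSuperalgebra
  split_ifs with hq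
  · rw [hq, hv.creation]
  rcases le_or_gt 0 q with h0 | h0
  · rw [hv.creation_nonneg v q h0, map_zero, LinearMap.zero_apply]
  have h1 := congrArg (fun x => B x Ω) (DFunLike.congr_fun (hv.translation v (q + 1)) Ω)
  have h2 := H.isInvariantForm (.L (-1)) (nthProd Y v (q + 1) Ω) Ω
  simp only [op, N2Gen.adj, neg_neg, H.isVacuumVOSA.isVacuumModule.lowest.L_pos 1 one_pos,
    map_zero] at h2
  simp only [LinearMap.sub_apply, Module.End.mul_apply, hv.translation_vacuum, map_zero, sub_zero,
    LinearMap.smul_apply, map_smulₛₗ, smul_eq_mul, h2, add_sub_cancel_right] at h1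
  rw [map_neg, map_intCast] at h1
  refine (mul_eq_zero.1 h1.symm).resolve_left (neg_ne_zero.2 ?_)
  exact_mod_cast (by lia : q + 1 ≠ 0)

theorem form_vacuum_eq_zero (H : IsInvolutive X Ω c Y B θ) {k : ℤ} (hk : k ≠ 0) {a : V}
    (ha : a ∈ (X.L 0).eigenspace ((k : ℂ) / 2)) : B Ω a = 0 ∧ B a Ω = 0 := by
  have h1 := H.isInvariantForm (.L 0) Ω a
  have h2 := H.isInvariantForm (.L 0) a Ω
  have hk' : (k : ℂ) ≠ 0 := by exact_mod_cast hk
  rw [Module.End.mem_eigenspace_iff] at ha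
  simp only [op, N2Gen.adj, neg_zero, H.isVacuumVOSA.isVacuumModule.lowest.L_zero', ha, map_zero,
    LinearMap.zero_apply, map_smul, map_smulₛₗ, LinearMap.smul_apply, smul_eq_mul] at h1 h2
  refine ⟨(mul_eq_zero.1 h1.symm).resolve_left (by simpa using hk'),
    (mul_eq_zero.1 h2).resolve_left (by simpa using hk')⟩

/-- Invariance of the form on the pairs `(Y(θ a, z) Ω | d)`. -/
def VacuumInvariance (X : N2Modes (Module.End ℂ V)) (Ω : V) (Y : V →ₗ[ℂ] VertexOperator ℂ V)
    (B : V →ₗ⋆[ℂ] V →ₗ[ℂ] ℂ) (θ : V ≃ₛₗ[starRingEnd ℂ] V) (d : V) : Prop :=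
  ∀ (k : ℤ), ∀ a ∈ (X.L 0).eigenspace ((k : ℂ) / 2), ∀ (n : ℤ) (M : ℕ), k < M →
    B (nthProd Y (θ a) n Ω) d = weightSign k *
      ∑ l ∈ Finset.range M, B Ω (nthProd Y (X.divPow l a) (k - l - n - 2) d)

/-- `Ω` is orthogonal to all non-zero weights and to `L_1`-images (as `L_{-1} Ω = 0`), so both sides
vanish unless `a` is a multiple of `Ω`. -/
theorem vacuumInvariance_vacuum (H : IsInvolutive X Ω c Y B θ) : VacuumInvariance X Ω Y B θ Ω := by
  intro k a ha n M hM
  have h := H.isVacuumVOSA.isVacuumModule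
  rw [H.form_vacuum_right]
  simp only [H.form_vacuum_left]
  rcases eq_or_ne k 0 with rfl | hk
  · have ha' : a ∈ Submodule.span ℂ {Ω} := by
      rw [← eigenspace_zero_eq h.isN2 h.lowest h.cyclic]
      simpa using ha
    obtain ⟨t, rfl⟩ := Submodule.mem_span_singleton.1 ha'
    obtain ⟨M, rfl⟩ : ∃ M', M = M' + 1 := ⟨M - 1, by lia⟩
    rw [Finset.sum_range_succ', Finset.sum_eq_zero, map_smulₛₗ, H.map_vacuum, divPow_zero]
    · have : (-n - 2 = -1) ↔ n = -1 := by lia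
      simp [weightSign, this]
    · intro l _
      have h1 := succ_smul_divPow (X := X) l
      have h2 : X.divPow (l + 1) (t • Ω) = 0 := by
        have h3 : (l : ℂ) + 1 ≠ 0 := by exact_mod_cast l.succ_ne_zero
        have h4 := DFunLike.congr_fun h1 (t • Ω)
        have h5 : X.L 1 * X.divPow l = X.divPow l * X.L 1 :=
          (divPow_mul_of_commute rfl l).symm
        rw [h5, Module.End.mul_apply, map_smul (X.L 1), h.lowest.L_pos 1 one_pos, smul_zero, map_zero,
          LinearMap.smul_apply] at h4
        exact (smul_eq_zero.1 h4).resolve_left h3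
      rw [h2, map_zero, ite_self]
  · rw [(H.form_vacuum_eq_zero hk (H.map_mem_eigenspace ha)).2, ite_self, Finset.sum_eq_zero,
      mul_zero]
    rintro (_ | l) _
    · rw [divPow_zero, Module.End.one_apply, (H.form_vacuum_eq_zero hk ha).1, ite_self]
    · have h3 : (l : ℂ) + 1 ≠ 0 := by exact_mod_cast l.succ_ne_zero
      have h4 := congrArg (B Ω) (DFunLike.congr_fun (succ_smul_divPow (X := X) l) a)
      have h5 := H.isInvariantForm (.L (-1)) Ω (X.divPow l a)
      simp only [op, N2Gen.adj, neg_neg, h.L_vac, map_zero, LinearMap.zero_apply] at h5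
      rw [Module.End.mul_apply, ← h5, LinearMap.smul_apply, map_smul, smul_eq_mul] at h4
      rw [(mul_eq_zero.1 h4).resolve_left h3, ite_self]

/-- On the left, `J_{-1}` is moved across the form to `J_1`, which acts on `θ a` by a commutator. On
the right it is commuted to the front, where it dies against `Ω`. The two results match through the
conjugation of `J_1` by `e^{z L_1}`. -/
theorem vacuumInvariance_J (H : IsInvolutive X Ω c Y B θ)
    {d : V} (hd : VacuumInvariance X Ω Y B θ d) :
    VacuumInvariance X Ω Y B θ (X.J (-1) d) := by
  intro k a ha n M hM
  have hY := H.isVacuumVOSA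
  have h := hY.isVacuumModule
  set u : V → ℤ → ℂ := fun b q => B Ω (nthProd Y b q d) with hu
  have h1 : B (nthProd Y (θ a) n Ω) (X.J (-1) d) =
      -B (nthProd Y (θ (X.J 0 a)) (n + 1) Ω) d - B (nthProd Y (θ (X.J 1 a)) n Ω) d := by
    have e1 := H.isInvariantForm (.J 1) (nthProd Y (θ a) n Ω) d
    have e2 := hY.fld_one_mul_nthProd .J
      (eigenspace_le_paritySpan h k (H.map_mem_eigenspace ha)) n Ω
    rw [H.fld_map, H.fld_map] at e2
    change X.J 1 _ = _ • nthProd Y (θ a) n (X.J 1 Ω) + (nthProd Y (_ • θ (X.J 0 a)) _ _ +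
      nthProd Y (_ • θ (X.J 1 a)) _ _) at e2
    rw [h.lowest.J_pos 1 one_pos, N2Field.conjSign, nthProd_smul, nthProd_smul, map_zero,
      smul_zero, zero_add] at e2
    change B (X.J 1 _) d = B _ (X.J (-1) d) at e1
    rw [← e1, e2]
    simp [sub_eq_add_neg]
  have h2 : ∀ l : ℕ, B Ω (nthProd Y (X.divPow l a) (k - l - n - 2) (X.J (-1) d)) =
      ∑ i ∈ Finset.range M, (-1) ^ i * u (X.J (1 + i) (X.divPow l a)) (k - 2 - n - 2 - (i + l)) -
        u (X.J 0 (X.divPow l a)) (k - l - (n + 1) - 2) := by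
    intro l
    have hl := divPow_mem_eigenspace h ha l
    have e1 := H.isInvariantForm (.J 1) Ω (nthProd Y (X.divPow l a) (k - l - n - 2) d)
    change B (X.J 1 Ω) _ = B _ (X.J (-1) _) at e1
    rw [h.lowest.J_pos 1 one_pos, map_zero, LinearMap.zero_apply] at e1
    -- Truncation at `M + 1` loses nothing by weight; once the term with `J_0` is split off, the
    -- remaining sum has length `M`.
    have e2 := hY.fld_mul_nthProd .J (eigenspace_le_paritySpan h _ hl) (N := M + 1) (fun j hj =>
      op_eq_zero_of_weight_neg h (.J j) hl (by simp only [N2Gen.weight]; lia)) (-1)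
      (k - l - n - 2) d
    change X.J (-1) _ = superSign 0 _ • nthProd Y _ _ (X.J (-1) d) + _ at e2
    rw [e2, superSign_zero_left, one_smul, map_add, map_sum] at e1
    rw [eq_neg_of_add_eq_zero_left e1.symm, Finset.sum_range_succ', neg_add', ← Finset.sum_neg_distrib]
    congr 1
    · refine Finset.sum_congr rfl fun i _ => ?_
      rw [map_smul, smul_eq_mul, Int.cast_neg, Int.cast_one, cbinom_neg_one, pow_succ]
      simp only [hu]
      rw [show (-1 : ℤ) + (k - l - n - 2) - (i + 1 : ℕ) = k - 2 - n - 2 - (i + l) by push_cast; ring,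
        show (1 : ℤ) + i = (i + 1 : ℕ) by push_cast; ring]
      simp only [mul_neg, mul_one, neg_mul, neg_neg]
      rfl
    · simp only [cbinom_zero, one_smul, hu, Nat.cast_zero, sub_zero]
      rw [show (-1 : ℤ) + (k - l - n - 2) = k - l - (n + 1) - 2 by ring]
      rfl
  have h3 : ∀ l : ℕ, u (X.divPow l (X.J 1 a)) (k - 2 - l - n - 2) =
      ∑ i ∈ Finset.range (l + 1), (-1) ^ i *
        u (X.J (1 + i) (X.divPow (l - i) a)) (k - 2 - n - 2 - (i + (l - i : ℕ))) := by
    intro l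
    have e1 := DFunLike.congr_fun (divPow_mul_J_one h.isN2 l) a
    rw [Module.End.mul_apply] at e1
    rw [e1, LinearMap.sum_apply]
    simp only [hu, nthProd, map_sum, Finset.sum_apply, LinearMap.sum_apply]
    refine Finset.sum_congr rfl fun i hi => ?_
    have hi' : i ≤ l := by simpa [Nat.lt_succ_iff] using hi
    rw [Nat.cast_sub hi', show k - 2 - l - n - 2 = k - 2 - n - 2 - ((i : ℤ) + (l - i)) by ring]
    simp
  have h4 : ∀ l : ℕ, X.divPow l (X.J 0 a) = X.J 0 (X.divPow l a) := by
    intro l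
    have e1 := h.isN2.L_J 1 0
    simp only [Int.cast_zero, neg_zero, zero_smul, sub_eq_zero] at e1
    exact DFunLike.congr_fun (divPow_mul_of_commute e1 l) a
  rw [h1, hd k (X.J 0 a) (op_mem_eigenspace_int h (.J 0) ha (by simp [N2Gen.weight])) (n + 1) M hM,
    hd (k - 2) (X.J 1 a) (op_mem_eigenspace_int h (.J 1) ha (by simp [N2Gen.weight]; ring)) n M
      (by lia)]
  change -(_ * ∑ l ∈ Finset.range M, u (X.divPow l (X.J 0 a)) _) -
    _ * ∑ l ∈ Finset.range M, u (X.divPow l (X.J 1 a)) _ = _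
  simp only [h2, h3, h4]
  -- Convolution and rectangular double sum agree because terms with `i + l ≥ M` contain a vector of
  -- negative weight.
  rw [sum_sum_range_sub (g := fun i l => (-1) ^ i *
    u (X.J (1 + i) (X.divPow l a)) (k - 2 - n - 2 - (i + l)))]
  · have e1 := weightSign_add_two (k - 2)
    rw [sub_add_cancel] at e1
    rw [Finset.sum_sub_distrib, e1]
    ring
  · intro i l hil
    have e1 := op_eq_zero_of_weight_neg h (.J (1 + i)) (divPow_mem_eigenspace h ha l)
      (by simp only [N2Gen.weight]; lia)
    change X.J (1 + i) _ = 0 at e1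
    simp only [e1, hu, nthProd_zero]
    simp

/-- The same exchange as for `J_{-1}`, with `f_(0) = G_{-1/2}` and `f_(1) = G_{1/2}`. It is shorter
since `[L_1, G_{-1/2}] = G_{1/2}` commutes with `L_1`; the sign from moving an odd mode past `a` is
the ratio of consecutive values of `weightSign`, up to a minus sign. -/
theorem vacuumInvariance_G (H : IsInvolutive X Ω c Y B θ)
    (f : N2Field) (hp : f.parity = 1) (hs : f.conjSign = 1)
    (hadj : (f.mode 1).adj = f.mode 0) (hw : (f.mode 0).weight = 1) (hw' : (f.mode 1).weight = -1)
    (hc : X.L 1 * X.fld f 0 - X.fld f 0 * X.L 1 = X.fld f 1)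
    (hc' : X.L 1 * X.fld f 1 = X.fld f 1 * X.L 1) {d : V}
    (hd : VacuumInvariance X Ω Y B θ d) : VacuumInvariance X Ω Y B θ (X.fld f 0 d) := by
  intro k a ha n M hM
  have hY := H.isVacuumVOSA
  have h := hY.isVacuumModule
  have hΩ : X.fld f 1 Ω = 0 := h.lowest.op_eq_zero (by rw [hw']; lia)
  have hinv : ∀ x y, B (X.fld f 1 x) y = B x (X.fld f 0 y) := by
    intro x y
    have := H.isInvariantForm (f.mode 1) x y
    rwa [hadj] at this
  set u : V → ℤ → ℂ := fun b q => B Ω (nthProd Y b q d) with hu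
  have h1 : B (nthProd Y (θ a) n Ω) (X.fld f 0 d) =
      B (nthProd Y (θ (X.fld f 0 a)) (n + 1) Ω) d + B (nthProd Y (θ (X.fld f 1 a)) n Ω) d := by
    rw [← hinv, hY.fld_one_mul_nthProd f
      (eigenspace_le_paritySpan h k (H.map_mem_eigenspace ha)), hΩ, H.fld_map, H.fld_map, hs]
    simp
  have h2 : ∀ l : ℕ, B Ω (nthProd Y (X.divPow l a) (k - l - n - 2) (X.fld f 0 d)) =
      -((-1) ^ k * u (X.fld f 0 (X.divPow l a)) (k - l - n - 2)) := by
    intro l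
    have hl := divPow_mem_eigenspace h ha l
    have e1 := hinv Ω (nthProd Y (X.divPow l a) (k - l - n - 2) d)
    rw [hΩ, map_zero, LinearMap.zero_apply, hY.fld_zero_mul_nthProd f
      (eigenspace_le_paritySpan h _ hl), hp, superSign_one_intCast, zpow_sub₀ (by norm_num),
      (even_two_mul (l : ℤ)).neg_one_zpow, div_one, map_add, map_smul, smul_eq_mul] at e1
    have e2 := neg_one_zpow_mul_self k
    simp only [hu]
    linear_combination -(-1) ^ k * e1 - B Ω (nthProd Y (X.divPow l a) (k - l - n - 2)
      (X.fld f 0 d)) * e2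
  have h3 : ∀ l : ℕ, X.divPow (l + 1) (X.fld f 0 a) =
      X.fld f 0 (X.divPow (l + 1) a) + X.fld f 1 (X.divPow l a) := fun l =>
    DFunLike.congr_fun (divPow_succ_mul hc hc' l) a
  have h4 : ∀ l : ℕ, X.divPow l (X.fld f 1 a) = X.fld f 1 (X.divPow l a) := fun l =>
    DFunLike.congr_fun (divPow_mul_of_commute hc' l) a
  have huadd : ∀ b b' q, u (b + b') q = u b q + u b' q := by
    intro b b' q
    simp only [hu, nthProd_add, LinearMap.add_apply, map_add]
  rw [h1, hd (k + 1) (X.fld f 0 a) (op_mem_eigenspace_int h (f.mode 0) ha (by rw [hw])) (n + 1) (M + 1)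
    (by push_cast; lia), hd (k - 1) (X.fld f 1 a)
    (op_mem_eigenspace_int h (f.mode 1) ha (by rw [hw']; ring)) n M (by lia)]
  change _ * ∑ l ∈ Finset.range (M + 1), u (X.divPow l (X.fld f 0 a)) _ +
    _ * ∑ l ∈ Finset.range M, u (X.divPow l (X.fld f 1 a)) _ = _
  rw [Finset.sum_range_succ']
  simp only [h2, h3, h4, huadd]
  -- `G_{-1/2} a` has doubled weight `k + 1`, so its sum was taken with `M + 1` terms; the lengths
  -- are reconciled by `L_1^M a = 0`.
  have h5 : ∑ l ∈ Finset.range M, u (X.fld f 0 (X.divPow l a)) (k - l - n - 2) =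
      ∑ l ∈ Finset.range M, u (X.fld f 0 (X.divPow (l + 1) a)) (k + 1 - (l + 1 : ℕ) - (n + 1) - 2) +
        u (X.divPow 0 (X.fld f 0 a)) (k + 1 - (0 : ℕ) - (n + 1) - 2) := by
    have e1 := Finset.sum_range_succ (fun l : ℕ => u (X.fld f 0 (X.divPow l a)) (k - l - n - 2)) M
    have e2 : X.divPow M a = 0 := eq_zero_of_mem_eigenspace_neg h (divPow_mem_eigenspace h ha M)
      (by lia)
    have e3 : u (X.fld f 0 (X.divPow M a)) (k - M - n - 2) = 0 := by
      simp only [hu, e2, map_zero, nthProd_zero]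
      simp
    rw [e3, add_zero, Finset.sum_range_succ'] at e1
    rw [← e1]
    congr 1
    · refine Finset.sum_congr rfl fun l _ => ?_
      congr 1; push_cast; ring
    · rw [divPow_zero, Module.End.one_apply, Module.End.one_apply]
      congr 1; push_cast; ring
  rw [Finset.sum_neg_distrib, ← Finset.mul_sum, h5, Finset.sum_add_distrib]
  have h6 : ∑ l ∈ Finset.range M, u (X.fld f 1 (X.divPow l a)) (k + 1 - (l + 1 : ℕ) - (n + 1) - 2) =
      ∑ l ∈ Finset.range M, u (X.fld f 1 (X.divPow l a)) (k - 1 - l - n - 2) := by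
    refine Finset.sum_congr rfl fun l _ => ?_
    congr 1; push_cast; ring
  have e1 := weightSign_add_two (k - 1)
  rw [show k - 1 + 2 = k + 1 by ring] at e1
  have e2 := weightSign_add_one k
  rw [zpow_add_one₀ (by norm_num)] at e2
  rw [h6, show weightSign (k - 1) = -weightSign (k + 1) by rw [e1, neg_neg], e2]
  ring

theorem vacuumInvariance (H : IsInvolutive X Ω c Y B θ) (d : V) : VacuumInvariance X Ω Y B θ d := by
  have h := H.isVacuumVOSA.isVacuumModule
  let W : Submodule ℂ V :=
    { carrier := {d | VacuumInvariance X Ω Y B θ d}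
      zero_mem' := by intro k a ha n M hM; simp
      add_mem' := by
        intro x y hx hy k a ha n M hM
        simp only [map_add]
        rw [hx k a ha n M hM, hy k a ha n M hM, Finset.sum_add_distrib, mul_add]
      smul_mem' := by
        intro r x hx k a ha n M hM
        simp only [map_smul, smul_eq_mul]
        rw [hx k a ha n M hM, ← Finset.mul_sum]
        ring }
  have hc1 := h.isN2.L_G1 1
  have hc2 := h.isN2.L_G2 1
  have hW : W = ⊤ := by
    refine eq_top_of_creation h.isN2 h.lowest h.cyclic (W := W) H.vacuumInvariance_vacuum
      (fun x hx => H.vacuumInvariance_J hx) (fun x hx => ?_) (fun x hx => ?_)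
    · refine H.vacuumInvariance_G .G1 rfl rfl rfl rfl rfl ?_ ?_ hx
      · have := hc1 (-1)
        norm_num at this
        exact this
      · have := hc1 0
        norm_num [sub_eq_zero] at this
        exact this
    · refine H.vacuumInvariance_G .G2 rfl rfl rfl rfl rfl ?_ ?_ hx
      · have := hc2 (-1)
        norm_num at this
        exact this
      · have := hc2 0
        norm_num [sub_eq_zero] at this
        exact this
  exact (hW ▸ Submodule.mem_top : d ∈ W)

end IsInvolutive

end N2Modes

/-! ### From invariance at the vacuum to invariance on all vectors. -/

namespace N2Modes

open FormalDist FormalSeries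

variable {V : Type*} [AddCommGroup V] [Module ℂ V] {X : N2Modes (Module.End ℂ V)} {Ω : V}
  {c : ℂ} {Y : V →ₗ[ℂ] VertexOperator ℂ V}

namespace IsInvolutive

variable {B : V →ₗ⋆[ℂ] V →ₗ[ℂ] ℂ} {θ : V ≃ₛₗ[starRingEnd ℂ] V}

/-- Invariance passes from `b` to `f_(m) b`. The failure, as a series in two variables, is bounded
in the variable of `f` and killed by a power of `z - w`, hence zero. -/
theorem form_nthProd_fld (H : IsInvolutive X Ω c Y B θ)
    {k : ℤ} {a : V} (ha : a ∈ (X.L 0).eigenspace ((k : ℂ) / 2)) (M : ℕ)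
    {b : V} (hb : ∀ n d, B (nthProd Y (θ a) n b) d = weightSign k *
      ∑ l ∈ Finset.range M, B b (nthProd Y (X.divPow l a) (k - l - n - 2) d))
    (f : N2Field) (m n : ℤ) (d : V) :
    B (nthProd Y (θ a) n (X.fld f m b)) d = weightSign k *
      ∑ l ∈ Finset.range M, B (X.fld f m b) (nthProd Y (X.divPow l a) (k - l - n - 2) d) := by
  have hY := H.isVacuumVOSA
  have h := hY.isVacuumModule
  obtain ⟨κ, hκ⟩ := op_mode_adj f
  have hadj : ∀ m x y, B (X.fld f m x) y = B x (X.fld f (κ - m) y) := by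
    intro m x y
    have := H.isInvariantForm (f.mode m) x y
    rwa [hκ] at this
  set s := superSign (k : ZMod 2) f.parity with hs
  have hs' : starRingEnd ℂ s = s := superSign_conj _ _
  have hss : s * s = 1 := superSign_mul_self _ _
  have hf := state_mem_paritySpan (fld_mem_vertexFields h f)
  have hloc : ∀ l : ℕ, IsLocal s (nthProd Y (X.divPow l a)) (X.fld f) := by
    intro l
    have h1 := hY.isLocal_nthProd (eigenspace_le_paritySpan h _ (divPow_mem_eigenspace h ha l)) hf
    rw [hY.nthProd_fld] at h1
    convert h1 using 2
    push_cast
    rw [show (2 : ZMod 2) = 0 from rfl]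
    ring
  have hloc' : IsLocal s (nthProd Y (θ a)) (X.fld f) := by
    have h1 := hY.isLocal_nthProd (eigenspace_le_paritySpan h _ (H.map_mem_eigenspace ha)) hf
    rwa [hY.nthProd_fld] at h1
  obtain ⟨N', hN'⟩ := hloc'
  choose K hK using hloc
  obtain ⟨N, hN, hNl⟩ : ∃ N, (subMul _ ^ N) (bracket s (nthProd Y (θ a)) (X.fld f)) = 0 ∧
      ∀ l ∈ Finset.range M,
        (subMul _ ^ N) (bracket s (nthProd Y (X.divPow l a)) (X.fld f)) = 0 :=
    ⟨N' + ∑ l ∈ Finset.range M, K l, subMul_pow_eq_zero_of_le (by lia) hN', fun l hl =>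
      subMul_pow_eq_zero_of_le ((Finset.single_le_sum (fun _ _ => Nat.zero_le _) hl).trans
        (by lia)) (hK l)⟩
  let F : ℤ → ℤ → ℂ := fun n m => B (nthProd Y (θ a) n (X.fld f m b)) d - weightSign k *
    ∑ l ∈ Finset.range M, B (X.fld f m b) (nthProd Y (X.divPow l a) (k - l - n - 2) d)
  let P : Module.End ℂ V →+ ℂ :=
    { toFun := fun A => B (A b) d
      map_zero' := by simp
      map_add' := fun A C => by simp }
  let Q : Module.End ℂ V →+ ℂ :=
    { toFun := fun A => weightSign k * (s * B b (A d))
      map_zero' := by simp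
      map_add' := fun A C => by simp [mul_add] }
  -- Exchange the fields on the left, move `f` to `d` by adjointness, use the assumption on `b`,
  -- exchange the fields again and move `f` back. The two exchange signs cancel by `hss`, so only
  -- supercommutators remain.
  have hF : F = (fun n m => P (bracket s (nthProd Y (θ a)) (X.fld f) n m)) +
      ∑ l ∈ Finset.range M, fun n m =>
        Q (bracket s (nthProd Y (X.divPow l a)) (X.fld f) (k - l - 2 - n) (κ - m)) := by
    ext n m
    have h1 := hb n (X.fld f (κ - m) d)
    rw [← hadj] at h1
    have h2 : ∀ l : ℕ, k - l - 2 - n = k - l - n - 2 := fun l => by ring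
    simp only [F, P, Q, Pi.add_apply, Finset.sum_apply, bracket, AddMonoidHom.coe_mk,
      ZeroHom.coe_mk, LinearMap.smul_apply, Module.End.mul_apply, map_sub,
      map_smul, map_smulₛₗ, smul_eq_mul, hs', h1, hadj m b, h2, ← Finset.mul_sum,
      Finset.sum_sub_distrib]
    linear_combination weightSign k * (∑ l ∈ Finset.range M,
      B b (X.fld f (κ - m) (nthProd Y (X.divPow l a) (k - l - n - 2) d))) * hss
  have hF0 : (subMul ℂ ^ N) F = 0 := by
    rw [hF, map_add, map_sum, subMul_pow_map_add, hN, Finset.sum_eq_zero, add_zero]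
    · ext n m
      exact map_zero P
    · intro l hl
      have h1 := subMul_pow_map_add Q N (bracket s (nthProd Y (X.divPow l a)) (X.fld f))
      rw [hNl l hl] at h1
      refine subMul_pow_reflect (G := fun n m =>
        Q (bracket s (nthProd Y (X.divPow l a)) (X.fld f) n m)) ?_ _ _
      rw [h1]
      ext n m
      exact map_zero Q
  obtain ⟨K₀, hK₀⟩ := fld_isField h.isN2 h.lowest h.cyclic f b
  have := eq_zero_of_subMul_pow_eq_zero (F := F) (K := K₀) (fun n m hm => by
    simp only [F, hK₀ m hm, map_zero, LinearMap.zero_apply, Finset.sum_const_zero, mul_zero,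
      sub_zero]) hF0
  have h2 := congrFun (congrFun this n) m
  exact sub_eq_zero.1 h2

theorem form_nthProd (H : IsInvolutive X Ω c Y B θ)
    {k : ℤ} {a : V} (ha : a ∈ (X.L 0).eigenspace ((k : ℂ) / 2)) {M : ℕ}
    (hM : k < M) (b : V) : ∀ n d, B (nthProd Y (θ a) n b) d = weightSign k *
      ∑ l ∈ Finset.range M, B b (nthProd Y (X.divPow l a) (k - l - n - 2) d) := by
  have h := H.isVacuumVOSA.isVacuumModule
  let W : Submodule ℂ V :=
    { carrier := {b | ∀ n d, B (nthProd Y (θ a) n b) d = weightSign k *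
        ∑ l ∈ Finset.range M, B b (nthProd Y (X.divPow l a) (k - l - n - 2) d)}
      zero_mem' := by intro n d; simp
      add_mem' := by
        intro x y hx hy n d
        simp only [map_add, LinearMap.add_apply]
        rw [hx n d, hy n d, Finset.sum_add_distrib, mul_add]
      smul_mem' := by
        intro r x hx n d
        simp only [map_smul, map_smulₛₗ, LinearMap.smul_apply, smul_eq_mul]
        rw [hx n d, ← Finset.mul_sum]
        ring }
  have hW : W = ⊤ := h.cyclic.eq_top_of_fld (W := W)
    (fun n d => H.vacuumInvariance d k a ha n M hM)
    fun f m x hx n d => H.form_nthProd_fld ha M hx f m n d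
  exact (hW ▸ Submodule.mem_top : b ∈ W)

/-- The vertex operator superalgebra of a vacuum module with an invariant scalar product is
unitary. -/
theorem isUnitary (H : IsInvolutive X Ω c Y B θ) (hB : IsScalarProduct B) (hθ : ∀ x, θ (θ x) = x) :
    (vosa X Ω Y).IsUnitary ((B Ω Ω)⁻¹ • B) := by
  have hY := H.isVacuumVOSA
  have h := hY.isVacuumModule
  have hpos := hB.pos Ω h.lowest.ne_zero
  have him : (B Ω Ω).im = 0 := Complex.conj_eq_iff_im.1 (hB.conj_symm Ω Ω)
  have hne : B Ω Ω ≠ 0 := fun h0 => by simp [h0] at hpos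
  have hre : B Ω Ω = ((B Ω Ω).re : ℂ) := Complex.ext rfl (by simpa using him)
  have hinv : (B Ω Ω)⁻¹ = (((B Ω Ω).re)⁻¹ : ℝ) := by rw [hre]; simp
  refine ⟨⟨fun x y => ?_, fun x hx => ?_⟩, ?_, θ.toLinearMap,
    isAntilinearInvolution hY H.map_vacuum H.map_fld hθ, fun k a ha n b d => ?_⟩
  · simp only [LinearMap.smul_apply, smul_eq_mul]
    rw [map_mul, hB.conj_symm, hinv, Complex.conj_ofReal]
  · simp only [LinearMap.smul_apply, smul_eq_mul]
    rw [hinv, Complex.re_ofReal_mul]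
    exact mul_pos (inv_pos.2 hpos) (hB.pos x hx)
  · exact inv_mul_cancel₀ hne
  · rw [vosa_weightSpace hY.isN2StateField] at ha
    -- `L_1^l a` has negative weight for `l > k.toNat`, so the `finsum` is a sum over this range.
    have hM : k < (k.toNat + 1 : ℕ) := by lia
    have h1 := H.form_nthProd ha hM b n d
    have h2 : ∀ l : ℕ, ((l.factorial : ℂ)⁻¹) * ((B Ω Ω)⁻¹ • B) b
        (nthProd (vosa X Ω Y).Y (((vosa X Ω Y).L 1 ^ l) a) (k - l - n - 2) d) =
        (B Ω Ω)⁻¹ * B b (nthProd Y (X.divPow l a) (k - l - n - 2) d) := by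
      intro l
      rw [vosa_L hY.isN2StateField, divPow, LinearMap.smul_apply (a := (l.factorial : ℂ)⁻¹),
        nthProd_smul]
      simp only [LinearMap.smul_apply, map_smul, smul_eq_mul, vosa]
      ring
    simp only [h2]
    rw [finsum_eq_sum_of_support_subset (s := Finset.range (k.toNat + 1)), ← Finset.mul_sum]
    · change (B Ω Ω)⁻¹ * B (nthProd Y (θ a) n b) d = _
      rw [h1, weightSign]
      ring
    · intro l hl
      simp only [Finset.coe_range, Set.mem_Iio]
      by_contra hlt
      apply hl
      have h3 : X.divPow l a = 0 :=
        eq_zero_of_mem_eigenspace_neg h (divPow_mem_eigenspace h ha l) (by lia)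
      simp [h3, nthProd_zero]

end IsInvolutive

end N2Modes

/-! ### Uniqueness of the scalar product -/

namespace N2Modes

variable {V : Type*} [AddCommGroup V] [Module ℂ V] {X : N2Modes (Module.End ℂ V)} {Ω : V} {c : ℂ}

/-- Invariant forms on a vacuum module are determined by their value at the vacuum. -/
theorem IsInvariantForm.eq (h : IsVacuumModule X Ω c) {B B' : V →ₗ⋆[ℂ] V →ₗ[ℂ] ℂ}
    (hB : IsInvariantForm X B) (hB' : IsInvariantForm X B') (hΩ : B Ω Ω = B' Ω Ω) : B = B' := by
  -- `L_0` is symmetric and kills `Ω`, so `Ω` is orthogonal to all positive weights. Since weight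
  -- zero is the line of `Ω`, the functional `D Ω` is fixed by its value at `Ω`.
  have hz : ∀ {D : V →ₗ⋆[ℂ] V →ₗ[ℂ] ℂ}, IsInvariantForm X D → ∀ (k : ℕ), k ≠ 0 →
      ∀ x ∈ (X.L 0).eigenspace ((k : ℂ) / 2), D Ω x = 0 := by
    intro D hD k hk x hx
    have h1 := hD (.L 0) Ω x
    rw [Module.End.mem_eigenspace_iff] at hx
    simp only [op, N2Gen.adj, neg_zero, h.lowest.L_zero', hx, map_zero, LinearMap.zero_apply,
      map_smul, smul_eq_mul] at h1
    have hk' : (k : ℂ) ≠ 0 := by exact_mod_cast hk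
    exact (mul_eq_zero.1 h1.symm).resolve_left (by simpa using hk')
  have hvac : ∀ x, B Ω x = B' Ω x := by
    intro x
    have hx : x ∈ (⨆ k : ℕ, (X.L 0).eigenspace ((k : ℂ) / 2)) := by
      rw [exists_weight_eigenspace h.isN2 h.lowest h.cyclic]; trivial
    induction hx using Submodule.iSup_induction' with
    | mem k x hx =>
      rcases eq_or_ne k 0 with rfl | hk
      · rw [Nat.cast_zero, zero_div, eigenspace_zero_eq h.isN2 h.lowest h.cyclic] at hx
        obtain ⟨t, rfl⟩ := Submodule.mem_span_singleton.1 hx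
        rw [map_smul, map_smul, hΩ]
      · rw [hz hB k hk x hx, hz hB' k hk x hx]
    | zero => simp
    | add x y _ _ hx hy => rw [map_add, map_add, hx, hy]
  let W : Submodule ℂ V :=
    { carrier := {x | ∀ y, B x y = B' x y}
      zero_mem' := by simp
      add_mem' := by
        intro a b ha hb y
        simp [ha y, hb y]
      smul_mem' := by
        intro r a ha y
        simp [ha y] }
  have hW : W = ⊤ := h.cyclic.eq_top_of_op (W := W) hvac fun g x hx y => by
    rw [hB, hB', hx]
  ext x y
  exact (hW ▸ Submodule.mem_top : x ∈ W) y

/-! ### Rotations of the odd generators -/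

/-- The modes in which `(G¹, G²)` is rotated to `(p G¹ + q G², -q G¹ + p G²)`. -/
def rotate {A : Type*} [Ring A] [Algebra ℂ A] (p q : ℂ) (X : N2Modes A) : N2Modes A where
  L := X.L
  J := X.J
  G1 k := p • X.G1 k + q • X.G2 k
  G2 k := (-q) • X.G1 k + p • X.G2 k

/-- `J_0` acts on the odd generators as an infinitesimal rotation, so these are its exponentiated
symmetries, with a complex angle allowed. -/
theorem IsN2.rotate {A : Type*} [Ring A] [Algebra ℂ A] {p q : ℂ} (hpq : p ^ 2 + q ^ 2 = 1)
    {X : N2Modes A} (hX : X.IsN2 c) : (X.rotate p q).IsN2 c := by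
  have e12 := hX.G1_G2
  have e21 : ∀ k l : ℤ, X.G2 k * X.G1 l + X.G1 l * X.G2 k =
      (Complex.I * ((l : ℂ) - k)) • X.J (k + l + 1) := by
    intro k l
    rw [add_comm, e12, add_comm l k]
  have exp : ∀ (r s r' s' : ℂ) (k l : ℤ),
      (r • X.G1 k + s • X.G2 k) * (r' • X.G1 l + s' • X.G2 l) +
        (r' • X.G1 l + s' • X.G2 l) * (r • X.G1 k + s • X.G2 k) =
      (r * r') • (X.G1 k * X.G1 l + X.G1 l * X.G1 k) +
        (s * s') • (X.G2 k * X.G2 l + X.G2 l * X.G2 k) +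
        (r * s') • (X.G1 k * X.G2 l + X.G2 l * X.G1 k) +
        (s * r') • (X.G2 k * X.G1 l + X.G1 l * X.G2 k) := by
    intro r s r' s' k l
    simp only [add_mul, mul_add, smul_mul_assoc, mul_smul_comm, smul_smul, smul_add, mul_comm r',
      mul_comm s']
    abel
  have sq : p * p + q * q = 1 := by rw [← hpq]; ring
  refine ⟨hX.L_L, hX.L_J, hX.J_J, fun m k => ?_, fun m k => ?_, fun k l => ?_, fun k l => ?_,
    fun k l => ?_, fun k n => ?_, fun k n => ?_⟩
  · simp only [N2Modes.rotate, mul_add, add_mul, mul_smul_comm, smul_mul_assoc]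
    rw [add_sub_add_comm, ← smul_sub, ← smul_sub, hX.L_G1, hX.L_G2]
    module
  · simp only [N2Modes.rotate, mul_add, add_mul, mul_smul_comm, smul_mul_assoc]
    rw [add_sub_add_comm, ← smul_sub, ← smul_sub, hX.L_G1, hX.L_G2]
    module
  · simp only [N2Modes.rotate]
    rw [exp, hX.G1_G1, hX.G2_G2, e12, e21, ← add_smul, sq, one_smul]
    module
  · simp only [N2Modes.rotate]
    rw [exp, hX.G1_G1, hX.G2_G2, e12, e21, ← add_smul, neg_mul_neg, add_comm (q * q), sq, one_smul]
    module
  · simp only [N2Modes.rotate]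
    rw [exp, hX.G1_G1, hX.G2_G2, e12, e21, ← add_smul, show p * -q + q * p = 0 by ring, zero_smul,
      zero_add, smul_smul, smul_smul, ← add_smul]
    congr 1
    linear_combination Complex.I * ((k : ℂ) - l) * hpq
  · simp only [N2Modes.rotate, mul_add, add_mul, mul_smul_comm, smul_mul_assoc]
    rw [add_sub_add_comm, ← smul_sub, ← smul_sub, hX.G1_J, hX.G2_J]
    module
  · simp only [N2Modes.rotate, mul_add, add_mul, mul_smul_comm, smul_mul_assoc]
    rw [add_sub_add_comm, ← smul_sub, ← smul_sub, hX.G1_J, hX.G2_J]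
    module

section Rotate

variable {p q : ℂ}

theorem rotate_G1_apply (k : ℤ) (x : V) :
    (X.rotate p q).G1 k x = p • X.G1 k x + q • X.G2 k x := rfl

theorem rotate_G2_apply (k : ℤ) (x : V) :
    (X.rotate p q).G2 k x = (-q) • X.G1 k x + p • X.G2 k x := rfl

theorem IsVacuumModule.rotate (hpq : p ^ 2 + q ^ 2 = 1) (h : IsVacuumModule X Ω c) :
    IsVacuumModule (X.rotate p q) Ω c := by
  have hl := h.lowest
  refine ⟨h.isN2.rotate hpq, ⟨hl.ne_zero, hl.L_zero, hl.J_zero, hl.L_pos, hl.J_pos,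
    fun k hk => ?_, fun k hk => ?_⟩, fun W hΩ hW => h.cyclic W hΩ fun m x hx => ?_, h.L_vac, ?_, ?_⟩
  · rw [rotate_G1_apply, hl.G1_pos k hk, hl.G2_pos k hk, smul_zero, smul_zero, add_zero]
  · rw [rotate_G2_apply, hl.G1_pos k hk, hl.G2_pos k hk, smul_zero, smul_zero, add_zero]
  · obtain ⟨h1, h2, h3, h4⟩ := hW m x hx
    rw [rotate_G1_apply] at h3
    rw [rotate_G2_apply] at h4
    refine ⟨h1, h2, ?_, ?_⟩
    · convert sub_mem (W.smul_mem p h3) (W.smul_mem q h4) using 1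
      rw [smul_add, smul_add, smul_smul, smul_smul, smul_smul, smul_smul, add_sub_add_comm,
        ← sub_smul, ← sub_smul, show p * p - q * -q = 1 by rw [← hpq]; ring,
        show p * q - q * p = 0 by ring, zero_smul, one_smul, add_zero]
    · convert add_mem (W.smul_mem q h3) (W.smul_mem p h4) using 1
      rw [smul_add, smul_add, smul_smul, smul_smul, smul_smul, smul_smul, add_add_add_comm,
        ← add_smul, ← add_smul, show q * q + p * p = 1 by rw [← hpq]; ring,
        show q * p + p * -q = 0 by ring, zero_smul, one_smul, zero_add]
  · rw [rotate_G1_apply, h.G1_vac, h.G2_vac, smul_zero, smul_zero, add_zero]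
  · rw [rotate_G2_apply, h.G1_vac, h.G2_vac, smul_zero, smul_zero, add_zero]

/-- Rotated modes are modes of rotated states of the same `Y`. The vertex superalgebra therefore
does not distinguish the two sets of generators, and matching them gives automorphisms. -/
theorem IsVacuumVOSA.rotate {Y : V →ₗ[ℂ] VertexOperator ℂ V} (hpq : p ^ 2 + q ^ 2 = 1)
    (hY : IsVacuumVOSA X Ω c Y) : IsVacuumVOSA (X.rotate p q) Ω c Y ∧
      vosa (X.rotate p q) Ω Y = vosa X Ω Y := by
  have h := hY.isVacuumModule
  have h' := h.rotate hpq
  have hpar : paritySpan (X.rotate p q) Ω = paritySpan X Ω := by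
    funext i
    symm
    refine parity_eq_paritySpan (parity := paritySpan X Ω) (c := c)
      ⟨hY.isVertexSuperalgebra.isInternal, h'.isN2, fun m i x hx => ?_, fun m i x hx => ?_,
        fun m i x hx => ?_, fun m i x hx => ?_⟩ hY.isVertexSuperalgebra.vacuum_even h'.cyclic i
    · simpa [N2Gen.parity, op, N2Modes.rotate] using op_mem_paritySpan (.L m) hx
    · simpa [N2Gen.parity, op, N2Modes.rotate] using op_mem_paritySpan (.J m) hx
    · rw [add_comm]
      exact add_mem (Submodule.smul_mem _ _ (op_mem_paritySpan (.G1 m) hx))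
        (Submodule.smul_mem _ _ (op_mem_paritySpan (.G2 m) hx))
    · rw [add_comm]
      exact add_mem (Submodule.smul_mem _ _ (op_mem_paritySpan (.G1 m) hx))
        (Submodule.smul_mem _ _ (op_mem_paritySpan (.G2 m) hx))
  have hN := hY.isN2StateField
  refine ⟨⟨h', ?_, hN.L_eq, hN.J_eq, fun k => ?_, fun k => ?_⟩, ?_⟩
  · rw [hpar]
    exact hY.isVertexSuperalgebra
  · rw [rotate_G1_apply, nthProd_add, nthProd_smul, nthProd_smul, hN.G1_eq, hN.G2_eq]
    rfl
  · rw [rotate_G2_apply, nthProd_add, nthProd_smul, nthProd_smul, hN.G1_eq, hN.G2_eq]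
    rfl
  · rw [vosa, vosa, hpar]
    rfl

end Rotate

end N2Modes

/-! ### Unitary structures on the vertex superalgebra of a vacuum module -/

namespace N2Modes

variable {V : Type*} [AddCommGroup V] [Module ℂ V] {X : N2Modes (Module.End ℂ V)} {Ω : V}

/-- The space of vectors of weight `3 / 2` is spanned by the `Gⁱ_{-3/2} Ω`. -/
theorem eigenspace_three_half_le {c : ℂ} (h : IsVacuumModule X Ω c) :
    (X.L 0).eigenspace (((3 : ℤ) : ℂ) / 2) ≤ Submodule.span ℂ {X.G1 (-2) Ω, X.G2 (-2) Ω} := by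
  rw [eigenspace_eq_wordSpan h.isN2 h.cyclic h.lowest.L_zero' (op_vacuum_eq_zero h), wordSpan,
    Submodule.span_le]
  rintro _ ⟨w, hw, hw2, rfl⟩
  apply Submodule.subset_span
  have h2 : wordWeight w = 3 := by
    have : (wordWeight w : ℂ) = (3 : ℤ) := by linear_combination 2 * hw2
    exact_mod_cast this
  have h1 : ∀ g ∈ w, 2 ≤ g.weight := by
    intro g hg
    obtain ⟨h0, ha, hb, hc⟩ := hw g hg
    cases g <;> simp only [N2Gen.weight, ne_eq, N2Gen.L.injEq, N2Gen.G1.injEq,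
      N2Gen.G2.injEq] at * <;> lia
  match w, h1, h2 with
  | [], _, h2 => simp at h2
  | [g], h1, h2 =>
    simp only [wordWeight_cons, wordWeight_nil, add_zero] at h2
    cases g with
    | L m => simp only [N2Gen.weight] at h2; lia
    | J m => simp only [N2Gen.weight] at h2; lia
    | G1 m =>
      obtain rfl : m = -2 := by simp only [N2Gen.weight] at h2; lia
      exact Or.inl rfl
    | G2 m =>
      obtain rfl : m = -2 := by simp only [N2Gen.weight] at h2; lia
      exact Or.inr rfl
  | g :: g' :: l, h1, h2 =>
    have h3 := h1 g (by simp)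
    have h4 := h1 g' (by simp)
    have h5 := wordWeight_nonneg (w := l) (fun a ha => (hw a (by simp [ha])).1)
    simp only [wordWeight_cons] at h2
    lia

/-- The half-angle formulas for a rotation by an imaginary angle. -/
theorem exists_half_rotation {a b : ℂ} (ha : 0 < a.re) (ha' : starRingEnd ℂ a = a)
    (hb : starRingEnd ℂ b = -b) (hab : a ^ 2 + b ^ 2 = 1) :
    ∃ p q : ℂ, starRingEnd ℂ p = p ∧ starRingEnd ℂ q = -q ∧ p ^ 2 + q ^ 2 = 1 ∧
      p ^ 2 - q ^ 2 = a ∧ 2 * p * q = b := by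
  have hre : a = (a.re : ℂ) := (Complex.conj_eq_iff_re.1 ha').symm
  -- With `a = cos φ` and `b = sin φ` this is `cos (φ / 2)`, and `sin (φ / 2) = b / (2 r)`;
  -- positivity of `a` keeps `r` away from zero.
  set r := Real.sqrt ((1 + a.re) / 2) with hr
  have hr2 : r ^ 2 = (1 + a.re) / 2 := Real.sq_sqrt (by linarith)
  have hrpos : 0 < r := Real.sqrt_pos.2 (by linarith)
  have hr0 : (r : ℂ) ≠ 0 := by exact_mod_cast hrpos.ne'
  have hp2 : (r : ℂ) ^ 2 = (1 + a) / 2 := by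
    rw [hre]
    exact_mod_cast hr2
  have hq2 : (b / (2 * r)) ^ 2 = (1 - a) / 2 := by
    have h1 : (1 : ℂ) + a ≠ 0 := by
      rw [hre]
      exact_mod_cast (by linarith : 1 + a.re ≠ 0)
    rw [div_pow, mul_pow, hp2]
    field_simp
    linear_combination hab
  refine ⟨r, b / (2 * r), Complex.conj_ofReal r, ?_, ?_, ?_, ?_⟩
  · rw [map_div₀, map_mul, Complex.conj_ofReal, hb, Complex.conj_ofNat, neg_div]
  · rw [hp2, hq2]; ring
  · rw [hp2, hq2]; ring
  · field_simp

variable {c : ℝ} {Y : V →ₗ[ℂ] VertexOperator ℂ V}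

/-- A scalar product that makes the vertex operator superalgebra of a vacuum module unitary is
invariant for modes in which the odd generators are rotated. -/
theorem exists_rotate_isInvariantForm (hc : 0 < c) (hY : IsVacuumVOSA X Ω c Y)
    {B : V →ₗ⋆[ℂ] V →ₗ[ℂ] ℂ} (hB : (vosa X Ω Y).IsUnitary B) :
    ∃ p q : ℂ, p ^ 2 + q ^ 2 = 1 ∧ IsInvariantForm (X.rotate p q) B := by
  obtain ⟨hsp, hnorm, θ, hθ, hinv⟩ := hB
  have h := hY.isVacuumModule
  have hl := h.lowest
  have hN := hY.isN2StateField
  replace hnorm : B Ω Ω = 1 := hnorm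
  have hcC : (c : ℂ) ≠ 0 := by exact_mod_cast hc.ne'
  have hmap : ∀ a n b, θ (nthProd Y a n b) = nthProd Y (θ a) n (θ b) := hθ.map_nthProd
  have hθΩ : θ Ω = Ω := hθ.map_vacuum
  have hθν : θ (X.L (-2) Ω) = X.L (-2) Ω := hθ.map_conformal
  have hθθ : ∀ a, θ (θ a) = a := hθ.involutive
  -- For vectors killed by `L_1` only `l = 0` survives in the invariance formula. This covers `ν`,
  -- `j`, `τ¹` and `τ²`.
  have hprim : ∀ (k : ℤ), ∀ a ∈ (X.L 0).eigenspace ((k : ℂ) / 2), X.L 1 a = 0 → ∀ (n : ℤ) (b d : V),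
      B (nthProd Y (θ a) n b) d = weightSign k * B b (nthProd Y a (k - n - 2) d) := by
    intro k a ha ha1 n b d
    have h1 := hinv k a (by rwa [vosa_weightSpace hN]) n b d
    rw [vosa_L hN, finsum_eq_single _ 0] at h1
    · simpa [vosa, weightSign] using h1
    · rintro (_ | l) hl
      · exact absurd rfl hl
      · rw [pow_succ, Module.End.mul_apply, ha1, map_zero]
        change _ * B b (nthProd Y 0 _ d) = 0
        rw [nthProd_zero]
        simp
  have hΩ0 : Ω ∈ (X.L 0).eigenspace (((0 : ℤ) : ℂ) / 2) := by
    rw [Int.cast_zero, zero_div, Module.End.mem_eigenspace_iff, zero_smul]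
    exact hl.L_zero'
  have hθL : ∀ n a, θ (X.L n a) = X.L n (θ a) := by
    intro n a
    have := hmap (X.L (-2) Ω) (n + 1) a
    rwa [hθν, hN.L_eq] at this
  have hθeig : ∀ k : ℤ, ∀ a ∈ (X.L 0).eigenspace ((k : ℂ) / 2),
      θ a ∈ (X.L 0).eigenspace ((k : ℂ) / 2) := by
    intro k a ha
    rw [Module.End.mem_eigenspace_iff] at ha ⊢
    rw [← hθL, ha, map_smulₛₗ]
    congr 1
    simp [Complex.conj_ofNat]
  -- the conformal vector
  have hL : ∀ m x y, B (X.L m x) y = B x (X.L (-m) y) := by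
    intro m x y
    have h1 : X.L 1 (X.L (-2) Ω) = 0 := by
      have := DFunLike.congr_fun (h.isN2.L_L 1 (-2)) Ω
      norm_num [hl.L_pos 1 one_pos, h.L_vac] at this
      exact this
    have h2 := hprim 4 _ (op_mem_eigenspace_int h (.L (-2)) hΩ0 (by simp [N2Gen.weight])) h1
      (m + 1) x y
    change B (nthProd Y (θ (X.L (-2) Ω)) _ _) _ = _ * B x (nthProd Y (X.L (-2) Ω) _ y) at h2
    rw [hθν, hN.L_eq, show (4 : ℤ) - (m + 1) - 2 = -m + 1 by ring, hN.L_eq] at h2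
    rw [h2, weightSign]
    norm_num
  -- the current
  have hJJ : X.J 1 (X.J (-1) Ω) = ((c : ℂ) / 3) • Ω := by
    have := DFunLike.congr_fun (h.isN2.J_J 1 (-1)) Ω
    norm_num [hl.J_pos 1 one_pos] at this
    exact this
  have hj0 : X.J (-1) Ω ≠ 0 := by
    intro h0
    rw [h0, map_zero] at hJJ
    exact (smul_ne_zero (div_ne_zero hcC three_ne_zero) hl.ne_zero) hJJ.symm
  have hjeig : X.J (-1) Ω ∈ (X.L 0).eigenspace (((2 : ℤ) : ℂ) / 2) :=
    op_mem_eigenspace_int h (.J (-1)) hΩ0 (by simp [N2Gen.weight])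
  have hjprim : X.L 1 (X.J (-1) Ω) = 0 := by
    have := DFunLike.congr_fun (h.isN2.L_J 1 (-1)) Ω
    norm_num [hl.L_pos 1 one_pos, hl.J_zero] at this
    exact this
  -- Weight one is the line of `j`, so `θ j = t j` with `|t| = 1`. Invariance gives `t̄ (j | j) = -c
  -- / 3`; positivity then makes `t` a negative real, that is `-1`.
  have hθj : θ (X.J (-1) Ω) = -X.J (-1) Ω := by
    have h1 := hθeig 2 _ hjeig
    rw [show (((2 : ℤ) : ℂ) / 2) = 1 by norm_num] at h1
    obtain ⟨t, ht⟩ := Submodule.mem_span_singleton.1 (eigenspace_one_le h h1)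
    have h2 := hprim 2 _ hjeig hjprim (-1) Ω (X.J (-1) Ω)
    rw [← ht, nthProd_smul, hN.J_eq, hN.J_eq] at h2
    norm_num [hJJ, hnorm, weightSign] at h2
    have h3 := hθθ (X.J (-1) Ω)
    rw [← ht, map_smulₛₗ, ← ht, smul_smul] at h3
    have h4 : starRingEnd ℂ t * t = 1 := by
      have h5 : (starRingEnd ℂ t * t - 1) • X.J (-1) Ω = 0 := by
        rw [sub_smul, h3, one_smul, sub_self]
      exact sub_eq_zero.1 ((smul_eq_zero.1 h5).resolve_right hj0)
    have hpos := hsp.pos _ hj0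
    set g := B (X.J (-1) Ω) (X.J (-1) Ω) with hg
    have hgre : g = (g.re : ℂ) := (Complex.conj_eq_iff_re.1 (hsp.conj_symm _ _)).symm
    have h5 : starRingEnd ℂ t = ((-(c / 3) / g.re : ℝ) : ℂ) := by
      have hg0 : (g.re : ℂ) ≠ 0 := by exact_mod_cast hpos.ne'
      push_cast
      rw [eq_div_iff hg0, ← hgre, h2]
    have h6 : t = ((-(c / 3) / g.re : ℝ) : ℂ) := by
      rw [← Complex.conj_conj t, h5, Complex.conj_ofReal]
    rw [h5, h6] at h4
    have h7 : (-(c / 3) / g.re) * (-(c / 3) / g.re) = 1 := by exact_mod_cast h4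
    have h8 : -(c / 3) / g.re < 0 := div_neg_of_neg_of_pos (by linarith) hpos
    have h9 : -(c / 3) / g.re = -1 := by nlinarith
    rw [← ht, h6, h9]
    simp
  have hJ : ∀ m x y, B (X.J m x) y = B x (X.J (-m) y) := by
    intro m x y
    have h2 := hprim 2 _ hjeig hjprim m x y
    rw [hθj, ← neg_one_smul ℂ, nthProd_smul, hN.J_eq, hN.J_eq,
      show (2 : ℤ) - m - 2 = -m by ring] at h2
    norm_num [weightSign] at h2
    exact h2
  -- the supercurrents
  have g11 : X.G1 1 (X.G1 (-2) Ω) = (2 * (c : ℂ) / 3) • Ω := by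
    have := DFunLike.congr_fun (h.isN2.G1_G1 1 (-2)) Ω
    norm_num [hl.G1_pos 1, hl.L_zero'] at this
    rw [this, smul_smul]
    congr 1
    ring
  have g22 : X.G2 1 (X.G2 (-2) Ω) = (2 * (c : ℂ) / 3) • Ω := by
    have := DFunLike.congr_fun (h.isN2.G2_G2 1 (-2)) Ω
    norm_num [hl.G2_pos 1, hl.L_zero'] at this
    rw [this, smul_smul]
    congr 1
    ring
  have g12 : X.G1 1 (X.G2 (-2) Ω) = 0 := by
    have := DFunLike.congr_fun (h.isN2.G1_G2 1 (-2)) Ω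
    norm_num [hl.G1_pos 1, hl.J_zero] at this
    exact this
  have g21 : X.G2 1 (X.G1 (-2) Ω) = 0 := by
    have := DFunLike.congr_fun (h.isN2.G1_G2 (-2) 1) Ω
    norm_num [hl.G2_pos 1, hl.J_zero] at this
    exact this
  set τ₁ := X.G1 (-2) Ω with hτ₁
  set τ₂ := X.G2 (-2) Ω with hτ₂
  have hd0 : (2 * (c : ℂ) / 3) ≠ 0 := div_ne_zero (mul_ne_zero two_ne_zero hcC) three_ne_zero
  have hind : ∀ {r s r' s' : ℂ}, r • τ₁ + s • τ₂ = r' • τ₁ + s' • τ₂ → r = r' ∧ s = s' := by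
    intro r s r' s' hrs
    have e1 := congrArg (X.G1 1) hrs
    have e2 := congrArg (X.G2 1) hrs
    simp only [map_add, map_smul, g11, g12, g21, g22, smul_zero, add_zero, zero_add] at e1 e2
    exact ⟨smul_left_injective ℂ (smul_ne_zero hd0 hl.ne_zero) e1,
      smul_left_injective ℂ (smul_ne_zero hd0 hl.ne_zero) e2⟩
  have h1eig : τ₁ ∈ (X.L 0).eigenspace (((3 : ℤ) : ℂ) / 2) :=
    op_mem_eigenspace_int h (.G1 (-2)) hΩ0 (by simp [N2Gen.weight])
  have h2eig : τ₂ ∈ (X.L 0).eigenspace (((3 : ℤ) : ℂ) / 2) :=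
    op_mem_eigenspace_int h (.G2 (-2)) hΩ0 (by simp [N2Gen.weight])
  have h1prim : X.L 1 τ₁ = 0 := by
    have := DFunLike.congr_fun (h.isN2.L_G1 1 (-2)) Ω
    norm_num [hl.L_pos 1, h.G1_vac] at this
    exact this
  have h2prim : X.L 1 τ₂ = 0 := by
    have := DFunLike.congr_fun (h.isN2.L_G2 1 (-2)) Ω
    norm_num [hl.L_pos 1, h.G2_vac] at this
    exact this
  obtain ⟨a, b, hθ1⟩ : ∃ a b : ℂ, a • τ₁ + b • τ₂ = θ τ₁ :=
    Submodule.mem_span_pair.1 (eigenspace_three_half_le h (hθeig 3 _ h1eig))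
  have hJ1 : X.J 0 τ₁ = Complex.I • τ₂ := by
    have := DFunLike.congr_fun (h.isN2.G1_J (-2) 0) Ω
    norm_num [hl.J_zero] at this
    exact this
  have hJ2 : X.J 0 τ₂ = (-Complex.I) • τ₁ := by
    have := DFunLike.congr_fun (h.isN2.G2_J (-2) 0) Ω
    norm_num [hl.J_zero] at this
    rw [neg_smul]
    exact neg_eq_iff_eq_neg.1 this
  -- `τ₂` is a multiple of `J_0 τ₁`, and `θ` anticommutes with `J_0` because `θ j = -j`.
  have hθ2 : θ τ₂ = (-b) • τ₁ + a • τ₂ := by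
    have h1 := hmap (X.J (-1) Ω) 0 τ₁
    rw [hN.J_eq, hJ1, hθj, ← neg_one_smul ℂ, nthProd_smul, hN.J_eq, ← hθ1, map_smulₛₗ,
      Complex.conj_I, LinearMap.smul_apply, map_add, map_smul, map_smul, hJ1, hJ2] at h1
    have h2 := congrArg (fun x => Complex.I • x) h1
    simp only [smul_smul, smul_add, mul_neg, Complex.I_mul_I, neg_neg, one_smul] at h2
    rw [h2, add_comm]
    congr 1
    · congr 1
      linear_combination b * Complex.I_mul_I
    · congr 1
      linear_combination -a * Complex.I_mul_I
  obtain ⟨e1, e2⟩ : starRingEnd ℂ a * a - starRingEnd ℂ b * b = 1 ∧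
      starRingEnd ℂ a * b + starRingEnd ℂ b * a = 0 := by
    have h1 := hθθ τ₁
    rw [← hθ1, map_add, map_smulₛₗ, map_smulₛₗ, ← hθ1, hθ2] at h1
    apply hind
    rw [one_smul, zero_smul, add_zero]
    refine Eq.trans ?_ h1
    module
  have hG : ∀ k x y,
      (starRingEnd ℂ a * B (X.G1 k x) y + starRingEnd ℂ b * B (X.G2 k x) y =
        B x (X.G1 (-k - 1) y)) ∧
      (-starRingEnd ℂ b * B (X.G1 k x) y + starRingEnd ℂ a * B (X.G2 k x) y =
        B x (X.G2 (-k - 1) y)) := by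
    intro k x y
    have e3 := hprim 3 _ h1eig h1prim (k + 1) x y
    have e4 := hprim 3 _ h2eig h2prim (k + 1) x y
    rw [← hθ1, nthProd_add, nthProd_smul, nthProd_smul, hN.G1_eq, hN.G2_eq,
      show (3 : ℤ) - (k + 1) - 2 = -k - 1 + 1 by ring, hN.G1_eq] at e3
    rw [hθ2, nthProd_add, nthProd_smul, nthProd_smul, hN.G1_eq, hN.G2_eq,
      show (3 : ℤ) - (k + 1) - 2 = -k - 1 + 1 by ring, hN.G2_eq] at e4
    norm_num [weightSign] at e3 e4
    exact ⟨e3, by rw [← e4]; ring⟩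
  have hτ0 : τ₁ ≠ 0 := by
    intro h0
    rw [h0, map_zero] at g11
    exact (smul_ne_zero hd0 hl.ne_zero) g11.symm
  -- Otherwise `θ² = 1` would give `-|b|² = 1`.
  have ha0 : a ≠ 0 := by
    rintro rfl
    have h1 : starRingEnd ℂ b * b = ((Complex.normSq b : ℝ) : ℂ) := by
      rw [mul_comm, Complex.mul_conj]
    rw [mul_zero, zero_sub, h1] at e1
    have h2 : -Complex.normSq b = 1 := by exact_mod_cast e1
    linarith [Complex.normSq_nonneg b]
  -- Eliminate `(τ₂ | τ₁)` from the two adjoint relations at `(Ω, τ₁)`. It follows that `a` is real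
  -- and positive, and `θ² = 1` then makes `b` imaginary.
  have hga : B τ₁ τ₁ = a * (2 * c / 3) := by
    obtain ⟨e3, -⟩ := hG (-2) Ω τ₁
    obtain ⟨-, e4⟩ := hG (-2) Ω τ₁
    norm_num [g11, g21, hnorm, ← hτ₁, ← hτ₂] at e3 e4
    have hca : starRingEnd ℂ a ≠ 0 := (map_ne_zero _).2 ha0
    apply mul_left_cancel₀ hca
    linear_combination starRingEnd ℂ a * a * e3 - a * starRingEnd ℂ b * e4 -
      starRingEnd ℂ a * B τ₁ τ₁ * e1 - starRingEnd ℂ b * B τ₁ τ₁ * e2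
  have hare : a = ((3 * (B τ₁ τ₁).re / (2 * c) : ℝ) : ℂ) := by
    have h1 : B τ₁ τ₁ = ((B τ₁ τ₁).re : ℂ) :=
      (Complex.conj_eq_iff_re.1 (hsp.conj_symm _ _)).symm
    push_cast
    rw [← h1, hga]
    field_simp
  have hapos : 0 < a.re := by
    rw [hare, Complex.ofReal_re]
    exact div_pos (mul_pos three_pos (hsp.pos _ hτ0)) (mul_pos two_pos hc)
  have hconja : starRingEnd ℂ a = a := by rw [hare, Complex.conj_ofReal]
  have hconjb : starRingEnd ℂ b = -b := by
    rw [hconja] at e2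
    apply mul_right_cancel₀ ha0
    linear_combination e2
  rw [hconja, hconjb] at e1
  -- The adjoint of the pair `(G¹, G²)` is twisted by the rotation `(a, b)`. Since `p` is real and
  -- `q` imaginary, rotating by half the angle contributes one half on each side of the form and
  -- absorbs the twist.
  obtain ⟨p, q, hp, hq, hpq, ea, eb⟩ := exists_half_rotation hapos hconja hconjb
    (by linear_combination e1)
  refine ⟨p, q, hpq, fun g x y => ?_⟩
  cases g with
  | L m => exact hL m x y
  | J m => exact hJ m x y
  | G1 k =>
    obtain ⟨e3, e4⟩ := hG k x y
    change B (p • X.G1 k x + q • X.G2 k x) y = B x (p • X.G1 (-k - 1) y + q • X.G2 (-k - 1) y)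
    simp only [map_add, map_smul, map_smulₛₗ, LinearMap.add_apply, LinearMap.smul_apply,
      smul_eq_mul, ← e3, ← e4, hp, hq, hconja, hconjb]
    rw [← ea, ← eb]
    linear_combination (-p * B (X.G1 k x) y + q * B (X.G2 k x) y) * hpq
  | G2 k =>
    obtain ⟨e3, e4⟩ := hG k x y
    change B ((-q) • X.G1 k x + p • X.G2 k x) y =
      B x ((-q) • X.G1 (-k - 1) y + p • X.G2 (-k - 1) y)
    simp only [map_add, map_smul, map_smulₛₗ, map_neg, LinearMap.add_apply, LinearMap.smul_apply,
      smul_eq_mul, ← e3, ← e4, hp, hq, hconja, hconjb]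
    rw [← ea, ← eb]
    linear_combination (-q * B (X.G1 k x) y - p * B (X.G2 k x) y) * hpq

end N2Modes

/-! ### Unitary representations with a cyclic vacuum vector -/

namespace N2Modes

variable {V : Type*} [AddCommGroup V] [Module ℂ V] {X : N2Modes (Module.End ℂ V)} {Ω : V}

theorem _root_.IsN2Rep.shift {parity : ZMod 2 → Submodule ℂ V} {c : ℂ} (h : IsN2Rep parity X c)
    (ε : ZMod 2) : IsN2Rep (fun i => parity (i + ε)) X c := by
  refine ⟨?_, h.isN2, fun m i => h.even_L m _, fun m i => h.even_J m _, fun k i x hx => ?_,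
    fun k i x hx => ?_⟩
  · have hc := (isInternal_iff_isCompl _).1 h.isInternal
    rw [isInternal_iff_isCompl]
    fin_cases ε
    · exact hc
    · exact hc.symm
  · have := h.odd_G1 k _ x hx
    rwa [add_right_comm] at this
  · have := h.odd_G2 k _ x hx
    rwa [add_right_comm] at this

/-- The lowest weight vector is homogeneous. -/
theorem _root_.IsN2Rep.exists_mem_parity {parity : ZMod 2 → Submodule ℂ V} {c : ℂ}
    (h : IsN2Rep parity X c) (hΩ : IsLowestWeightVector X Ω 0 0) (hcyc : IsCyclicVector X Ω) :
    ∃ ε, Ω ∈ parity ε := by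
  have hc := (isInternal_iff_isCompl _).1 h.isInternal
  obtain ⟨u, hu, v, hv, huv⟩ := Submodule.mem_sup.1
    (show Ω ∈ parity 0 ⊔ parity 1 by rw [hc.sup_eq_top]; trivial)
  -- `L_0` preserves parity, so the even part of `Ω` has weight zero by itself and is a multiple of
  -- `Ω`.
  have h1 : X.L 0 u = -X.L 0 v := by
    rw [← add_eq_zero_iff_eq_neg, ← map_add, huv, hΩ.L_zero']
  have h2 : X.L 0 u = 0 := by
    refine Submodule.disjoint_def.1 hc.disjoint _ (h.even_L 0 0 u hu) ?_
    rw [h1]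
    exact neg_mem (h.even_L 0 1 v hv)
  have h3 : u ∈ (X.L 0).eigenspace 0 := by
    rw [Module.End.mem_eigenspace_iff, h2, zero_smul]
  rw [eigenspace_zero_eq h.isN2 hΩ hcyc] at h3
  obtain ⟨t, rfl⟩ := Submodule.mem_span_singleton.1 h3
  by_cases ht : t = 0
  · refine ⟨1, ?_⟩
    rw [ht, zero_smul, zero_add] at huv
    exact huv ▸ hv
  · exact ⟨0, (Submodule.smul_mem_iff _ ht).1 hu⟩

/-- Symmetry of the fields up to multiplication by trigonometric polynomials vanishing at `-1`
relates the defects of adjacent modes. -/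
theorem adjDefect_add_adjDefect {B : V →ₗ⋆[ℂ] V →ₗ[ℂ] ℂ} (hJ : FormalSeries.IsDagger B X.J X.J)
    (hT : ∀ p : LaurentPolynomial ℂ, trigEvalNegOne p = 0 →
      FormalSeries.IsDagger B (FormalSeries.polyMul p X.L)
        (FormalSeries.polyMul (trigConj p) X.L))
    (hG1 : ∀ p : LaurentPolynomial ℂ, trigEvalNegOne p = 0 →
      FormalSeries.IsDagger B (FormalSeries.polyMul p X.G1)
        (FormalSeries.polyMul (trigConj p) fun n => X.G1 (n - 1)))
    (hG2 : ∀ p : LaurentPolynomial ℂ, trigEvalNegOne p = 0 →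
      FormalSeries.IsDagger B (FormalSeries.polyMul p X.G2)
        (FormalSeries.polyMul (trigConj p) fun n => X.G2 (n - 1)))
    (i : N2Field) (n : ℤ) (x y : V) : adjDefect X B i n x y + adjDefect X B i (n + 1) x y = 0 := by
  cases i with
  | T =>
    have := FormalSeries.adjoint_add_of_polyMul hT (n - 1) x y
    rw [show -(n - 1) - 1 = -(n + 1 - 1) by ring, show n - 1 + 1 = n + 1 - 1 by ring] at this
    exact this
  | J =>
    have h : ∀ n, adjDefect X B .J n x y = 0 := fun n => sub_eq_zero.2 (hJ n x y)
    rw [h, h, add_zero]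
  | G1 =>
    have := FormalSeries.adjoint_add_of_polyMul hG1 (n - 1) x y
    rw [show -(n - 1) - 1 - 1 = -(n + 1 - 1) - 1 by ring,
      show n - 1 + 1 = n + 1 - 1 by ring] at this
    exact this
  | G2 =>
    have := FormalSeries.adjoint_add_of_polyMul hG2 (n - 1) x y
    rw [show -(n - 1) - 1 - 1 = -(n + 1 - 1) - 1 by ring,
      show n - 1 + 1 = n + 1 - 1 by ring] at this
    exact this

/-- The vertex operator superalgebra of a unitary vacuum module is unitary. -/
theorem IsVacuumVOSA.isUnitary {c : ℝ} {Y : V →ₗ[ℂ] VertexOperator ℂ V}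
    (hY : IsVacuumVOSA X Ω c Y) {B : V →ₗ⋆[ℂ] V →ₗ[ℂ] ℂ} (hB : IsScalarProduct B)
    (hBX : IsInvariantForm X B) : (vosa X Ω Y).IsUnitary ((B Ω Ω)⁻¹ • B) := by
  obtain ⟨θ, hθΩ, hθX, hθθ⟩ :=
    exists_conjugation hY.isVacuumModule (hY.isVacuumModule.isIrreducible hB hBX)
  exact IsInvolutive.isUnitary ⟨hY, hBX, hθΩ, hθX⟩ hB hθθ

theorem isVacuumModule_N2Simple {c : ℂ} (h : IsVacuumModule X Ω c) (hirr : IsIrreducible X) :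
    IsVacuumModule (N2Simple.modes c) (N2Simple.vacuum c) c := by
  obtain ⟨φ, hφΩ, hφX⟩ := exists_equiv_N2Simple h hirr
  exact h.of_equiv (modes_isN2 c) φ hφΩ hφX

/-- The vertex operator superalgebra of an irreducible vacuum module is isomorphic to
`V^c(N2)`. -/
theorem IsVacuumVOSA.exists_isIso {c : ℂ} {Y : V →ₗ[ℂ] VertexOperator ℂ V}
    (hY : IsVacuumVOSA X Ω c Y) (hirr : IsIrreducible X) :
    ∃ φ : V ≃ₗ[ℂ] N2Simple c, (vosa X Ω Y).IsIso (superVirasoroN2 c) φ := by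
  obtain ⟨φ, hφΩ, hφX⟩ := exists_equiv_N2Simple hY.isVacuumModule hirr
  rw [superVirasoroN2_eq]
  exact ⟨φ, hY.isIso (isVacuumVOSA_stateField (isVacuumModule_N2Simple hY.isVacuumModule hirr))
    hφΩ hφX⟩

/-- The isomorphism with `V^c(N2)` can be chosen isometric for any unitary structure on the
latter. -/
theorem IsVacuumVOSA.exists_isIso_isometric {c : ℝ} (hc : 0 < c)
    {Y : V →ₗ[ℂ] VertexOperator ℂ V} (hY : IsVacuumVOSA X Ω c Y) {B : V →ₗ⋆[ℂ] V →ₗ[ℂ] ℂ}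
    (hB : IsScalarProduct B) (hBX : IsInvariantForm X B)
    {B' : N2Simple (c : ℂ) →ₗ⋆[ℂ] N2Simple (c : ℂ) →ₗ[ℂ] ℂ}
    (hB' : (superVirasoroN2 (c : ℂ)).IsUnitary B') :
    ∃ φ : V ≃ₗ[ℂ] N2Simple (c : ℂ), (vosa X Ω Y).IsIso (superVirasoroN2 (c : ℂ)) φ ∧
      ∀ x y, B' (φ x) (φ y) = ((B Ω Ω)⁻¹ • B) x y := by
  have h := hY.isVacuumModule
  have hirr := h.isIrreducible hB hBX
  have hS := isVacuumVOSA_stateField (isVacuumModule_N2Simple h hirr)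
  rw [superVirasoroN2_eq] at hB' ⊢
  obtain ⟨p, q, hpq, hinv⟩ := exists_rotate_isInvariantForm hc hS hB'
  obtain ⟨hS', hrot⟩ := hS.rotate hpq
  obtain ⟨φ₁, hφ₁Ω, hφ₁X⟩ := exists_equiv_N2Simple h hirr
  obtain ⟨φ₂, hφ₂Ω, hφ₂X⟩ := exists_equiv_N2Simple hS'.isVacuumModule
    (hS'.isVacuumModule.isIrreducible hB'.isScalarProduct hinv)
  -- `N2Simple c` with rotated modes is again an irreducible vacuum module. The composite sends the
  -- given modes to the rotated ones, for which `B'` is invariant.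
  let φ := φ₁.trans φ₂.symm
  have hφΩ : φ Ω = N2Simple.vacuum c := φ₂.symm_apply_eq.2 (hφ₁Ω.trans hφ₂Ω.symm)
  have hφX : ∀ g x, φ (X.op g x) = ((N2Simple.modes c).rotate p q).op g (φ x) := by
    intro g x
    simp [φ, hφ₁X, LinearEquiv.symm_apply_eq, hφ₂X]
  refine ⟨φ, hrot ▸ hY.isIso hS' hφΩ hφX, fun x y => ?_⟩
  -- The pulled-back form is invariant and normalized, hence equal to the normalized form on `V`.
  let D : V →ₗ⋆[ℂ] V →ₗ[ℂ] ℂ := LinearMap.mk₂'ₛₗ (starRingEnd ℂ) (RingHom.id ℂ)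
    (fun x y => B' (φ x) (φ y)) (by simp) (by simp) (by simp) (by simp)
  have hD : IsInvariantForm X D := by
    intro g x y
    change B' (φ _) (φ _) = B' (φ _) (φ _)
    rw [hφX, hφX, hinv]
  have hBn : IsInvariantForm X ((B Ω Ω)⁻¹ • B) := by
    intro g x y
    simp only [LinearMap.smul_apply, hBX g x y]
  have hne : B Ω Ω ≠ 0 := by
    intro h0
    have := hB.pos Ω h.lowest.ne_zero
    rw [h0] at this
    exact lt_irrefl _ this
  refine DFunLike.congr_fun (DFunLike.congr_fun (hD.eq h hBn ?_) x) y
  change B' (φ Ω) (φ Ω) = (B Ω Ω)⁻¹ * B Ω Ω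
  rw [hφΩ, inv_mul_cancel₀ hne]
  exact hB'.normalized

end N2Modes

theorem mainTheorem6 {V : Type*} [AddCommGroup V] [Module ℂ V]
    (parity : ZMod 2 → Submodule ℂ V) (X : N2Modes (Module.End ℂ V)) (c : ℝ) (hc : 3 ≤ c)
    (hX : IsN2Rep parity X (c : ℂ))
    (Ω : V) (hΩ : IsLowestWeightVector X Ω 0 0) (hcyc : IsCyclicVector X Ω)
    (B : V →ₗ⋆[ℂ] V →ₗ[ℂ] ℂ) (hB : IsScalarProduct B)
    (hJ : FormalSeries.IsDagger B X.J X.J)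
    (hT : ∀ p : LaurentPolynomial ℂ, trigEvalNegOne p = 0 →
      FormalSeries.IsDagger B (FormalSeries.polyMul p X.L)
        (FormalSeries.polyMul (trigConj p) X.L))
    -- `X.Gi` lists the coefficients of `z^(1/2) Gⁱ(z)`, its shift those of `z^(-1/2) Gⁱ(z)`
    (hG1 : ∀ p : LaurentPolynomial ℂ, trigEvalNegOne p = 0 →
      FormalSeries.IsDagger B (FormalSeries.polyMul p X.G1)
        (FormalSeries.polyMul (trigConj p) fun n => X.G1 (n - 1)))
    (hG2 : ∀ p : LaurentPolynomial ℂ, trigEvalNegOne p = 0 →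
      FormalSeries.IsDagger B (FormalSeries.polyMul p X.G2)
        (FormalSeries.polyMul (trigConj p) fun n => X.G2 (n - 1))) :
    (∀ m, IsAdjoint B (X.L m) (X.L (-m))) ∧
    (∀ k, IsAdjoint B (X.G1 k) (X.G1 (-k - 1))) ∧
    (∀ k, IsAdjoint B (X.G2 k) (X.G2 (-k - 1))) ∧
    ∃ ε : ZMod 2, Ω ∈ parity ε ∧
      ∃ S : VOSAData V,
        (∀ i, S.parity i = parity (i + ε)) ∧
        S.vacuum = Ω ∧ S.conformal = X.L (-2) Ω ∧ IsN2StateField X Ω S.Y ∧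
        S.IsVOSA (c : ℂ) ∧ S.IsSimple ∧ S.IsUnitary ((B Ω Ω)⁻¹ • B) ∧
        (∃ φ : V ≃ₗ[ℂ] N2Simple (c : ℂ), S.IsIso (superVirasoroN2 (c : ℂ)) φ) ∧
        ∀ B' : N2Simple (c : ℂ) →ₗ⋆[ℂ] N2Simple (c : ℂ) →ₗ[ℂ] ℂ,
          (superVirasoroN2 (c : ℂ)).IsUnitary B' →
            ∃ φ : V ≃ₗ[ℂ] N2Simple (c : ℂ), S.IsIso (superVirasoroN2 (c : ℂ)) φ ∧
              ∀ x y, B' (φ x) (φ y) = ((B Ω Ω)⁻¹ • B) x y := by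
  obtain ⟨h, hBX⟩ := N2Modes.isVacuumModule_and_isInvariantForm hX.isN2 hΩ hcyc hB
    (N2Modes.adjDefect_add_adjDefect hJ hT hG1 hG2)
  refine ⟨fun m => hBX (.L m), fun k => hBX (.G1 k), fun k => hBX (.G2 k), ?_⟩
  obtain ⟨ε, hε⟩ := hX.exists_mem_parity hΩ hcyc
  obtain ⟨Y, hY⟩ := N2Modes.exists_isVacuumVOSA h
  have hirr := h.isIrreducible hB hBX
  exact ⟨ε, hε, X.vosa Ω Y,
    fun i => (N2Modes.parity_eq_paritySpan (hX.shift ε) (by rwa [zero_add]) hcyc i).symm, rfl, rfl,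
    hY.isN2StateField, hY.isVOSA, hY.isSimple hirr, hY.isUnitary hB hBX, hY.exists_isIso hirr,
    fun B' hB' => hY.exists_isIso_isometric (by linarith) hB hBX hB'⟩
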